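/- Let $\alpha<2$, $\alpha\neq 0$, $\kappa>0$, and let $V(r)=\dfrac{\kappa}{\alpha r^{\alpha}}$ for $r>0$. For $L>0$ let $$W(r;L)=\frac{L^2}{2r^2}-V(r),\qquad r_0(L)=\Bigl(\frac{L^2}{\kappa}\Bigr)^{\frac1{2-\alpha}},\qquad w_0(L)=-W(r_0(L);L),$$ and let $\Lambda$ be the set of all $(H,L)\in\mathbb R^2$ with $L>0$, $H>-w_0(L)$ and, when $\alpha>0$, also $H<0$. For $(H,L)\in\Lambda$ let $r_-(H,L)<r_+(H,L)$ be the solutions $r>0$ of $W(r;L)=H$, and let $$T(H,L)=\sqrt2\int_{r_-(H,L)}^{r_+(H,L)}\frac{dr}{\sqrt{H-W(r;L)}},\qquad \Theta(H,L)=\sqrt2\,L\int_{r_-(H,L)}^{r_+(H,L)}\frac{dr}{r^2\sqrt{H-W(r;L)}}$$ (the radial period, and the apsidal angle of the central force problem $\ddot x=V'(|x|)\,x/|x|$ in the plane), and $$D(H,L)=\partial_HT(H,L)\,\partial_L\Theta(H,L)-\partial_LT(H,L)\,\partial_H\Theta(H,L).$$ 1. These notions are well defined: $V$ is $C^2$ on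 $(0,\infty)$; for every $L>0$ one has $r_0(L)>0$, $w_0(L)=\frac{2-\alpha}{2\alpha}\kappa^{\frac2{2-\alpha}}L^{-\frac{2\alpha}{2-\alpha}}$, $\partial_rW(\cdot\,;L)<0$ on $(0,r_0(L))$ and $\partial_rW(\cdot\,;L)>0$ on $(r_0(L),\infty)$; the set $\Lambda$ is open and non-empty and consists exactly of the pairs $(H,L)$ with $L>0$ for which $W(r;L)=H$ has exactly two solutions $r>0$; for $(H,L)\in\Lambda$ these satisfy $0<r_-(H,L)<r_0(L)<r_+(H,L)$, and the two integrals converge; and $T$ and $\Theta$ are of class $C^1$ on $\Lambda$. 2. For all $(H,L)\in\Lambda$, $$D(H,L)=-\frac{2+\alpha}{2-\alpha}\,L^{-1}\,T(H,L)\,\partial_H\Theta(H,L).$$ 3. If moreover $\alpha\notin\{-2,1\}$, then for all $(H,L)\in\Lambda$: - $D(H,L)\neq0$; more precisely $D(H,L)>0$ if $\alpha<1$, and $D(H,L)<0$ if $\alpha>1$; - $\partial_H\Theta(H,L)>0$ if $\alpha<-2$ or $\alpha>1$, and $\partial_H\Theta(H,L)<0$ if $-2<\alpha<1$; - $\partial_L\Theta(H,L)<0$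 if $\alpha<-2$ or $\alpha>1$, and $\partial_L\Theta(H,L)>0$ if $-2<\alpha<1$. Moreover, there are $(H,L)\in\Lambda$ and coprime positive integers $n,k$ with $\Theta(H,L)=2\pi k/n$ (the condition for the bounded solutions with energy $H$ and angular momentum $L$ to be periodic). Thus the nondegeneracy condition $D\neq0$, under which periodic solutions bifurcate from invariant tori filled by periodic solutions, holds at every such torus, and such tori exist. -/

import Mathlib

noncomputable section

namespace CentralForce

/-- The homogeneous potential `V(r) = κ / (α r ^ α)`. -/
def homPotential (α κ r : ℝ) : ℝ := κ / (α * r ^ α)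

/-- The effective potential `W(r; L) = L ^ 2 / (2 r ^ 2) - V(r)`. -/
def effPotential (V : ℝ → ℝ) (L r : ℝ) : ℝ := L ^ 2 / (2 * r ^ 2) - V r

/-- The radii `r > 0` at which `W(r; L) = H`. -/
def apsidalRadii (V : ℝ → ℝ) (H L : ℝ) : Set ℝ := {r | 0 < r ∧ effPotential V L r = H}

/-- The pericentral radius `r₋(H, L)`: the smaller one of the two solutions of `W(r; L) = H`
(used only where there are exactly two). -/
def rMinus (V : ℝ → ℝ) (H L : ℝ) : ℝ := sInf (apsidalRadii V H L)

/-- The apocentral radius `r₊(H, L)`: the larger one of the two solutions of `W(r; L) = H`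
(used only where there are exactly two). -/
def rPlus (V : ℝ → ℝ) (H L : ℝ) : ℝ := sSup (apsidalRadii V H L)

/-- The radial period `T(H, L) = √2 ∫_{r₋}^{r₊} dr / √(H - W(r; L))`. -/
def radialPeriod (V : ℝ → ℝ) (H L : ℝ) : ℝ :=
  √2 * ∫ r in (rMinus V H L)..(rPlus V H L), 1 / √(H - effPotential V L r)

/-- The apsidal angle: the integral of `dϑ/dt = L / r ^ 2` over one radial period, that is,
`Θ(H, L) = √2 L ∫_{r₋}^{r₊} dr / (r ^ 2 √(H - W(r; L)))`. -/
def apsidalAngle (V : ℝ → ℝ) (H L : ℝ) : ℝ :=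
  √2 * L * ∫ r in (rMinus V H L)..(rPlus V H L), 1 / (r ^ 2 * √(H - effPotential V L r))

/-- The partial derivative in the energy `H` of a function of `(H, L)`. -/
def partialH (f : ℝ → ℝ → ℝ) (H L : ℝ) : ℝ := deriv (fun h => f h L) H

/-- The partial derivative in the angular momentum `L` of a function of `(H, L)`. -/
def partialL (f : ℝ → ℝ → ℝ) (H L : ℝ) : ℝ := deriv (fun l => f H l) L

/-- The nondegeneracy function `D = ∂_H T · ∂_L Θ - ∂_L T · ∂_H Θ`. -/
def nondegeneracy (V : ℝ → ℝ) (H L : ℝ) : ℝ :=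
  partialH (radialPeriod V) H L * partialL (apsidalAngle V) H L
    - partialL (radialPeriod V) H L * partialH (apsidalAngle V) H L

/-- The point `r₀(L) = (L ^ 2 / κ) ^ (1 / (2 - α))` of minimum of the effective potential of
the homogeneous potential. -/
def homRadius (α κ L : ℝ) : ℝ := (L ^ 2 / κ) ^ (1 / (2 - α))

/-- The set `Λ` of pairs `(H, L)` with `L > 0` and `H` strictly between the minimum
`W(r₀(L); L)` and the limit of `W(r; L)` as `r → ∞`; this limit is `0` for `0 < α < 2` and
`+∞` for `α < 0`. -/
def homDomain (α κ : ℝ) : Set (ℝ × ℝ) :=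
  {p | 0 < p.2 ∧ effPotential (homPotential α κ) p.2 (homRadius α κ p.2) < p.1
    ∧ (0 < α → p.1 < 0)}

end CentralForce

end

/-! By homogeneity an orbit is determined, up to scaling, by the ratio of its apsidal radii.
Substitute r = c x^(-p) with p = 3/(4-α), where c is the geometric mean of r₋ and r₊, so that the
turning points become x = e^(±z). With δ = 3α/(4-α), H - W becomes (L/c)² x^(2p-2) times -x²/2 + B
x^((1+δ)/2) + A x^((1-δ)/2), and vanishing at e^(±z) makes A and B explicit functions of z
(`radCoeff`). This p makes the two exponents sum to 1. The Kepler case α = 1 (δ = 1) and the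
oscillator α = -2 (δ = -1) then give quadratic radicands, and the symmetry δ ↦ -δ is the duality
(2-α)(2-α') = 4.

Homogeneity gives the formula for D. With γ = 2α/(2-α) and β = (2+α)/(2-α), the scaled energy H L^γ
is a strictly increasing function of z (`orbitEnergyDeriv_pos`), Θ depends on z alone, and T is L^β
times a function of z. Hence Θ = G(H L^γ) and T = L^β F(H L^γ). The inverse function theorem gives
the C¹ regularity. In D the terms with F' cancel, and only the L-derivative of the prefactor L^β
survives (`nondegeneracy_eq`).

The signs come from a pointwise statement. With x = cosh z + y sinh z and y = sin φ, the radicand is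
sinh² z (1-y²) Q(z,y) with Q continuous and positive up to y = ±1 (`radQuot_pos`), and Θ = √2 p ∫
Q(z, sin φ)^(-1/2) dφ over [-π/2, π/2]. It is therefore enough that ∂_z Q has the sign of 1-|δ| for
|y| < 1 (`radQuotDeriv_pos`). Now sinh³ z (1-y²) ∂_z Q is an exponential sum in log x with five
terms (`radDerivList`), so it has at most four zeros. It vanishes at log x = ±z. Its slopes there,
together with its signs at ±∞, force one further zero on each outer side, so none is left between -z
and z. The slopes reduce to a one-variable inequality for an eight-term sum (`turningList_pos`).

Finally Hα < 0 on the domain links the signs of ∂_L Θ and ∂_H Θ. Since Θ is continuous and not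
constant in z, it takes a value that is a rational multiple of 2π. -/

namespace CentralForce

/-! ### Exponential sums: counting zeros and propagating signs. -/

/-- The exponential sum `∑ c * exp (μ * v)` over the pairs `(c, μ)` of a list. -/
noncomputable def expSum (l : List (ℝ × ℝ)) (v : ℝ) : ℝ :=
  (l.map fun q => q.1 * Real.exp (q.2 * v)).sum

/-- The list of the exponential sum `f' - a f`, where `f` is the exponential sum of `l`. -/
noncomputable def expSumStep (a : ℝ) (l : List (ℝ × ℝ)) : List (ℝ × ℝ) :=
  l.map fun q => (q.1 * (q.2 - a), q.2)

@[simp] lemma expSum_nil (v : ℝ) : expSum [] v = 0 := by simp [expSum]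

@[simp] lemma expSum_cons (q : ℝ × ℝ) (l : List (ℝ × ℝ)) (v : ℝ) :
    expSum (q :: l) v = q.1 * Real.exp (q.2 * v) + expSum l v := by simp [expSum]

@[simp] lemma expSumStep_nil (a : ℝ) : expSumStep a [] = [] := rfl

@[simp] lemma expSumStep_cons (a : ℝ) (q : ℝ × ℝ) (l : List (ℝ × ℝ)) :
    expSumStep a (q :: l) = (q.1 * (q.2 - a), q.2) :: expSumStep a l := rfl

lemma hasDerivAt_expSum (a : ℝ) (l : List (ℝ × ℝ)) (v : ℝ) :
    HasDerivAt (expSum l) (expSum (expSumStep a l) v + a * expSum l v) v := by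
  induction l with
  | nil => simpa [funext expSum_nil] using hasDerivAt_const v (0 : ℝ)
  | cons q l ih =>
    have h1 : HasDerivAt (fun v => q.1 * Real.exp (q.2 * v))
        (q.1 * (Real.exp (q.2 * v) * (q.2 * 1))) v :=
      (((hasDerivAt_id v).const_mul q.2).exp).const_mul q.1
    have := h1.add ih
    rw [show expSum (q :: l) = (fun v => q.1 * Real.exp (q.2 * v)) + expSum l from
      funext fun v => expSum_cons q l v]
    refine this.congr_deriv ?_
    simp only [expSumStep_cons, expSum_cons, Pi.add_apply]
    ring

lemma continuous_expSum (l : List (ℝ × ℝ)) : Continuous (expSum l) :=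
  continuous_iff_continuousAt.2 fun v => (hasDerivAt_expSum 0 l v).continuousAt

/-- `exp (-a v) f(v)` has the derivative `exp (-a v) (f' - a f)(v)`. -/
lemma hasDerivAt_exp_mul_expSum (a : ℝ) (l : List (ℝ × ℝ)) (v : ℝ) :
    HasDerivAt (fun v => Real.exp (-a * v) * expSum l v)
      (Real.exp (-a * v) * expSum (expSumStep a l) v) v := by
  have h1 : HasDerivAt (fun v => Real.exp (-a * v)) (Real.exp (-a * v) * (-a * 1)) v :=
    ((hasDerivAt_id v).const_mul (-a)).exp
  refine (h1.mul (hasDerivAt_expSum a l v)).congr_deriv ?_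
  ring

/-- An exponential sum with distinct exponents and as many distinct zeros as terms vanishes. -/
lemma coeff_eq_zero_of_expSum_zeros (n : ℕ) : ∀ (l : List (ℝ × ℝ)), l.length = n →
    (l.map Prod.snd).Nodup → ∀ v : Fin n → ℝ, StrictMono v → (∀ j, expSum l (v j) = 0) →
    ∀ q ∈ l, q.1 = 0 := by
  induction n with
  | zero =>
    intro l hl _ v _ _ q hq
    rw [List.length_eq_zero_iff.1 hl] at hq
    simp at hq
  | succ n ih =>
    intro l hl hnd v hv hz
    obtain ⟨q, l, rfl⟩ := List.exists_cons_of_length_eq_add_one hl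
    simp only [List.map_cons, List.nodup_cons] at hnd
    set a := q.2 with ha
    -- Rolle applied to e^(-av) f, where a is the exponent of the head: its derivative has lost that
    -- term and vanishes between consecutive zeros of f, so one term and one zero are given up
    -- together.
    have key : ∀ j : Fin n, ∃ c, v j.castSucc < c ∧ c < v j.succ ∧
        expSum (expSumStep a (q :: l)) c = 0 := by
      intro j
      have hlt : v j.castSucc < v j.succ := hv Fin.castSucc_lt_succ
      have hcont : ContinuousOn (fun v => Real.exp (-a * v) * expSum (q :: l) v)
          (Set.Icc (v j.castSucc) (v j.succ)) := fun x _ =>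
        (hasDerivAt_exp_mul_expSum a (q :: l) x).continuousAt.continuousWithinAt
      obtain ⟨c, hc, hc0⟩ := exists_hasDerivAt_eq_zero hlt hcont (by simp only [hz, mul_zero])
        (fun x _ => hasDerivAt_exp_mul_expSum a (q :: l) x)
      refine ⟨c, hc.1, hc.2, ?_⟩
      rcases mul_eq_zero.1 hc0 with h | h
      · exact absurd h (Real.exp_pos _).ne'
      · exact h
    choose w hw1 hw2 hw3 using key
    have hw : StrictMono w := by
      intro i j hij
      refine (hw2 i).trans_le (le_trans (hv.monotone ?_) (hw1 j).le)
      rw [Fin.le_def]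
      simp only [Fin.val_succ, Fin.val_castSucc]
      exact hij
    have hall := ih (expSumStep a l) (by simpa [expSumStep] using hl)
      (by simpa [expSumStep, List.map_map, Function.comp_def] using hnd.2) w hw (by
        intro j
        have := hw3 j
        simpa [← ha] using this)
    have hl0 : ∀ r ∈ l, r.1 = 0 := by
      intro r hr
      have := hall (r.1 * (r.2 - a), r.2) (List.mem_map.2 ⟨r, hr, rfl⟩)
      rcases mul_eq_zero.1 this with h | h
      · exact h
      · exact absurd (List.mem_map.2 ⟨r, hr, by linarith⟩) hnd.1
    have hsum : ∀ x, expSum l x = 0 := by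
      intro x
      refine List.sum_eq_zero fun y hy => ?_
      obtain ⟨r, hr, rfl⟩ := List.mem_map.1 hy
      simp [hl0 r hr]
    intro r hr
    rcases List.mem_cons.1 hr with rfl | hr
    · have := hz 0
      rw [expSum_cons, hsum, add_zero] at this
      exact (mul_eq_zero.1 this).resolve_right (Real.exp_pos _).ne'
    · exact hl0 r hr

/-- The derivative of e^(-av) f is e^(-av) (f' - af), so this product increases strictly through its
zero at 0. With the next lemma, it lets one exponent be removed at a time while the sign around 0 is
tracked. -/
lemma expSum_mul_self_pos_of_step_pos {a : ℝ} {l : List (ℝ × ℝ)} (h0 : expSum l 0 = 0)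
    (h : ∀ v, v ≠ 0 → 0 < expSum (expSumStep a l) v) {v : ℝ} (hv : v ≠ 0) :
    0 < v * expSum l v := by
  have hc : Continuous fun v => Real.exp (-a * v) * expSum l v :=
    (Real.continuous_exp.comp (by fun_prop)).mul (continuous_expSum l)
  have hd : ∀ v, deriv (fun v => Real.exp (-a * v) * expSum l v) v
      = Real.exp (-a * v) * expSum (expSumStep a l) v :=
    fun v => (hasDerivAt_exp_mul_expSum a l v).deriv
  have e0 : Real.exp (-a * v) * (v * expSum l v) = v * (Real.exp (-a * v) * expSum l v) := by ring
  rw [← mul_pos_iff_of_pos_left (Real.exp_pos (-a * v)), e0]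
  rcases lt_or_gt_of_ne hv with hv | hv
  · have hm : StrictMonoOn (fun v => Real.exp (-a * v) * expSum l v) (Set.Iic 0) := by
      refine strictMonoOn_of_deriv_pos (convex_Iic 0) hc.continuousOn fun x hx => ?_
      rw [interior_Iic] at hx
      rw [hd]
      exact mul_pos (Real.exp_pos _) (h x hx.ne)
    have := hm hv.le (Set.mem_Iic.2 le_rfl) hv
    simp only [h0, mul_zero] at this
    exact mul_pos_of_neg_of_neg hv this
  · have hm : StrictMonoOn (fun v => Real.exp (-a * v) * expSum l v) (Set.Ici 0) := by
      refine strictMonoOn_of_deriv_pos (convex_Ici 0) hc.continuousOn fun x hx => ?_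
      rw [interior_Ici] at hx
      rw [hd]
      exact mul_pos (Real.exp_pos _) (h x (ne_of_gt hx))
    have := hm (Set.mem_Ici.2 le_rfl) hv.le hv
    simp only [h0, mul_zero] at this
    exact mul_pos hv this

/-- Here e^(-av) f decreases on the left of 0 and increases on the right, so 0 is its strict
minimum. -/
lemma expSum_pos_of_mul_self_step_pos {a : ℝ} {l : List (ℝ × ℝ)} (h0 : expSum l 0 = 0)
    (h : ∀ v, v ≠ 0 → 0 < v * expSum (expSumStep a l) v) {v : ℝ} (hv : v ≠ 0) :
    0 < expSum l v := by
  have hc : Continuous fun v => Real.exp (-a * v) * expSum l v :=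
    (Real.continuous_exp.comp (by fun_prop)).mul (continuous_expSum l)
  have hd : ∀ v, deriv (fun v => Real.exp (-a * v) * expSum l v) v
      = Real.exp (-a * v) * expSum (expSumStep a l) v :=
    fun v => (hasDerivAt_exp_mul_expSum a l v).deriv
  rw [← mul_pos_iff_of_pos_left (Real.exp_pos (-a * v))]
  rcases lt_or_gt_of_ne hv with hv | hv
  · have hm : StrictAntiOn (fun v => Real.exp (-a * v) * expSum l v) (Set.Iic 0) := by
      refine strictAntiOn_of_deriv_neg (convex_Iic 0) hc.continuousOn fun x hx => ?_
      rw [interior_Iic] at hx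
      rw [hd]
      exact mul_neg_of_pos_of_neg (Real.exp_pos _) (neg_of_mul_pos_right (h x hx.ne) (le_of_lt hx))
    have := hm hv.le (Set.mem_Iic.2 le_rfl) hv
    simpa only [h0, mul_zero] using this
  · have hm : StrictMonoOn (fun v => Real.exp (-a * v) * expSum l v) (Set.Ici 0) := by
      refine strictMonoOn_of_deriv_pos (convex_Ici 0) hc.continuousOn fun x hx => ?_
      rw [interior_Ici] at hx
      rw [hd]
      exact mul_pos (Real.exp_pos _) (pos_of_mul_pos_right (h x (ne_of_gt hx)) (le_of_lt hx))
    have := hm (Set.mem_Ici.2 le_rfl) hv.le hv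
    simpa only [h0, mul_zero] using this

/-- The eight-term exponential sum that governs the sign of the derivative of the period at the
turning points. -/
noncomputable def turningList (s δ : ℝ) : List (ℝ × ℝ) :=
  [(s * (6 - 2 * δ ^ 2), 0), (s * (2 * δ ^ 2), 2), (-(s * (3 - δ)), 2 * δ),
    (-(s * (3 + δ)), -(2 * δ)), (-(s * (δ * (3 + δ))), δ - 1), (s * (δ * (3 - δ)), -1 - δ),
    (s * (δ * (1 + δ)), δ - 3), (-(s * (δ * (1 - δ))), -3 - δ)]

/-- The sum and its first four reductions all vanish at 0. Five alternating reductions remove the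
exponents -3-δ, -1-δ, 0, 2δ and 2. -/
lemma turningList_pos {s δ : ℝ} (hδ : 0 < δ) (hδ3 : δ < 3) (hs : 0 < s * (1 - δ)) {v : ℝ}
    (hv : v ≠ 0) : 0 < v * expSum (turningList s δ) v := by
  refine expSum_mul_self_pos_of_step_pos (a := -3 - δ) ?_ (fun v hv => ?_) hv
  · simp [turningList]; ring
  refine expSum_pos_of_mul_self_step_pos (a := -1 - δ) ?_ (fun v hv => ?_) hv
  · simp [turningList]; ring
  refine expSum_mul_self_pos_of_step_pos (a := 0) ?_ (fun v hv => ?_) hv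
  · simp [turningList]; ring
  refine expSum_pos_of_mul_self_step_pos (a := 2 * δ) ?_ (fun v hv => ?_) hv
  · simp [turningList]; ring
  refine expSum_mul_self_pos_of_step_pos (a := 2) ?_ (fun v hv => ?_) hv
  · simp [turningList]; ring
  -- Only the exponents -2δ, δ-1 and δ-3 remain, and each coefficient is s(1-δ) times positive
  -- factors.
  have h3 : 0 < 3 - δ := by linarith
  have h5 : 0 < 5 - δ := by linarith
  have e1 : 0 < s * (1 - δ) * ((3 + δ) * (3 - δ) * (2 * δ) * (4 * δ) * (2 * δ + 2))
      * Real.exp (-(2 * δ) * v) := by positivity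
  have e2 : 0 < s * (1 - δ) * ((δ * (3 + δ)) * (2 + 2 * δ) * (2 * δ) * (1 + δ) * (3 - δ))
      * Real.exp ((δ - 1) * v) := by positivity
  have e3 : 0 < s * (1 - δ) * ((δ * (1 + δ)) * (2 * δ) * 2 * (3 - δ) * (3 + δ) * (5 - δ))
      * Real.exp ((δ - 3) * v) := by positivity
  refine (add_pos (add_pos e1 e2) e3).trans_eq ?_
  simp [turningList]
  ring

/-! ### Integrals depending on a parameter. -/

open MeasureTheory Set in
/-- Continuity of a parametric integral over a compact interval. -/
lemma continuousOn_intervalIntegral {X : Type*} [TopologicalSpace X] [FirstCountableTopology X]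
    {U : Set X} {a b : ℝ} (hab : a ≤ b) {f : X → ℝ → ℝ}
    (hf : ContinuousOn (Function.uncurry f) (U ×ˢ Icc a b)) :
    ContinuousOn (fun x => ∫ t in a..b, f x t) U := by
  rw [continuousOn_iff_continuous_domRestrict]
  -- Clamping t to [a, b] makes the integrand continuous for all real t without changing the
  -- integral.
  have hc : Continuous (Function.uncurry fun (u : U) (t : ℝ) => f u (projIcc a b hab t)) := by
    have : Continuous fun q : U × ℝ =>
        (((q.1 : X), ((projIcc a b hab q.2 : Icc a b) : ℝ)) : X × ℝ) :=
      (continuous_subtype_val.comp continuous_fst).prodMk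
        (continuous_subtype_val.comp (continuous_projIcc.comp continuous_snd))
    exact hf.comp_continuous this fun q => ⟨q.1.2, (projIcc a b hab q.2).2⟩
  refine (intervalIntegral.continuous_parametric_intervalIntegral_of_continuous'
    (μ := volume) hc a b).congr ?_
  intro u
  simp only [domRestrict_apply]
  refine intervalIntegral.integral_congr fun t ht => ?_
  rw [uIcc_of_le hab] at ht
  simp only [projIcc_of_mem hab ht]

open MeasureTheory Set Filter Topology in
/-- Differentiation under the integral sign over a compact interval. -/
lemma hasDerivAt_intervalIntegral {U : Set ℝ} (hU : IsOpen U) {a b : ℝ} (hab : a ≤ b)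
    {f f' : ℝ → ℝ → ℝ}
    (hf : ∀ x ∈ U, ContinuousOn (f x) (Icc a b))
    (hf' : ContinuousOn (Function.uncurry f') (U ×ˢ Icc a b))
    (hd : ∀ x ∈ U, ∀ t ∈ Icc a b, HasDerivAt (fun x => f x t) (f' x t) x) {x : ℝ} (hx : x ∈ U) :
    HasDerivAt (fun x => ∫ t in a..b, f x t) (∫ t in a..b, f' x t) x := by
  obtain ⟨ε, hε, hεU⟩ := Metric.isOpen_iff.1 hU x hx
  set s := Metric.closedBall x (ε / 2)
  have hsU : s ⊆ U := (Metric.closedBall_subset_ball (by linarith)).trans hεU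
  -- Continuity on a compact product gives a constant dominating function.
  have hK : IsCompact (s ×ˢ Icc a b) := (isCompact_closedBall _ _).prod isCompact_Icc
  obtain ⟨C, hC⟩ := hK.exists_bound_of_continuousOn (hf'.mono (prod_mono hsU Subset.rfl))
  have hsub : uIoc a b ⊆ Icc a b := by rw [uIoc_of_le hab]; exact Ioc_subset_Icc_self
  have hcu : ∀ y ∈ U, ContinuousOn (f y) (uIoc a b) := fun y hy => (hf y hy).mono hsub
  have hcu' : ContinuousOn (f' x) (uIoc a b) :=
    hf'.comp (f := fun t => (x, t)) (by fun_prop) fun t ht => ⟨hx, hsub ht⟩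
  refine (intervalIntegral.hasDerivAt_integral_of_dominated_loc_of_deriv_le (F' := f')
    (bound := fun _ => C)
    (Metric.closedBall_mem_nhds x (half_pos hε)) ?_ ?_ ?_ ?_ ?_ ?_).2
  · filter_upwards [hU.mem_nhds hx] with y hy
    exact (hcu y hy).aestronglyMeasurable measurableSet_uIoc
  · exact ContinuousOn.intervalIntegrable (by rw [uIcc_of_le hab]; exact hf x hx)
  · exact hcu'.aestronglyMeasurable measurableSet_uIoc
  · exact Eventually.of_forall fun t ht y hy => hC (y, t) ⟨hy, hsub ht⟩
  · exact intervalIntegrable_const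
  · exact Eventually.of_forall fun t ht y hy => hd y (hsU hy) t (hsub ht)

/-! ### Divided differences of powers at the turning points. -/

/-- The convex combination of `exp (-z)`, `exp z` and `cosh z + y * sinh z` in the
Hermite–Genocchi formula for a second divided difference. -/
noncomputable def simplexPoint (z y t r : ℝ) : ℝ := Real.exp (-z) + t * Real.sinh z * (2 + r * (y - 1))

/-- The second divided difference of `x ^ ν` at the points `exp (-z)`, `exp z` and
`cosh z + y * sinh z`, by the Hermite–Genocchi formula. -/
noncomputable def divDiff (ν z y : ℝ) : ℝ :=
  ∫ t in (0 : ℝ)..1, ∫ r in (0 : ℝ)..1, ν * (ν - 1) * t * simplexPoint z y t r ^ (ν - 2)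

/-- The derivative of `divDiff ν z y` in `z`. -/
noncomputable def divDiffDeriv (ν z y : ℝ) : ℝ :=
  ∫ t in (0 : ℝ)..1, ∫ r in (0 : ℝ)..1, ν * (ν - 1) * t *
    ((-Real.exp (-z) + t * Real.cosh z * (2 + r * (y - 1))) * (ν - 2)
      * simplexPoint z y t r ^ (ν - 2 - 1))

lemma simplexPoint_pos {z y t r : ℝ} (hy : y ∈ Set.Icc (-1 : ℝ) 1) (ht : t ∈ Set.Icc (0 : ℝ) 1)
    (hr : r ∈ Set.Icc (0 : ℝ) 1) : 0 < simplexPoint z y t r := by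
  obtain ⟨hy1, hy2⟩ := hy
  obtain ⟨ht1, ht2⟩ := ht
  obtain ⟨hr1, hr2⟩ := hr
  -- The weight of e^z when the point is written as a convex combination of e^(-z) and e^z alone.
  set w := t * (2 + r * (y - 1)) / 2 with hw
  have h0 : 0 ≤ 2 + r * (y - 1) := by nlinarith
  have h1 : 2 + r * (y - 1) ≤ 2 := by nlinarith
  have hw0 : 0 ≤ w := by positivity
  have hw1 : w ≤ 1 := by rw [hw]; nlinarith
  have e : simplexPoint z y t r = (1 - w) * Real.exp (-z) + w * Real.exp z := by
    rw [simplexPoint, Real.sinh_eq, hw]; ring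
  rw [e]
  rcases hw0.eq_or_lt with h | h
  · rw [← h]; simpa using Real.exp_pos _
  · have := Real.exp_pos z
    have := Real.exp_pos (-z)
    have : 0 ≤ 1 - w := by linarith
    positivity

lemma continuousOn_double_integral {φ : ((ℝ × ℝ) × ℝ) × ℝ → ℝ}
    (hφ : ContinuousOn φ (((Set.univ ×ˢ Set.Icc (-1 : ℝ) 1) ×ˢ Set.Icc (0 : ℝ) 1) ×ˢ
      Set.Icc (0 : ℝ) 1)) :
    ContinuousOn (fun q : ℝ × ℝ => ∫ t in (0 : ℝ)..1, ∫ r in (0 : ℝ)..1, φ ((q, t), r))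
      (Set.univ ×ˢ Set.Icc (-1 : ℝ) 1) :=
  continuousOn_intervalIntegral (f := fun q t => ∫ r in (0 : ℝ)..1, φ ((q, t), r)) zero_le_one
    (continuousOn_intervalIntegral (f := fun q r => φ (q, r)) zero_le_one hφ)

lemma continuousOn_divDiff (ν : ℝ) :
    ContinuousOn (fun q : ℝ × ℝ => divDiff ν q.1 q.2) (Set.univ ×ˢ Set.Icc (-1 : ℝ) 1) := by
  refine continuousOn_double_integral
    (φ := fun q => ν * (ν - 1) * q.1.2 * simplexPoint q.1.1.1 q.1.1.2 q.1.2 q.2 ^ (ν - 2)) ?_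
  refine ContinuousOn.mul (by fun_prop) (ContinuousOn.rpow_const ?_ fun q hq => Or.inl
    (simplexPoint_pos hq.1.1.2 hq.1.2 hq.2).ne')
  unfold simplexPoint
  fun_prop

lemma continuousOn_divDiffDeriv (ν : ℝ) :
    ContinuousOn (fun q : ℝ × ℝ => divDiffDeriv ν q.1 q.2) (Set.univ ×ˢ Set.Icc (-1 : ℝ) 1) := by
  refine continuousOn_double_integral
    (φ := fun q => ν * (ν - 1) * q.1.2 *
    ((-Real.exp (-q.1.1.1) + q.1.2 * Real.cosh q.1.1.1 * (2 + q.2 * (q.1.1.2 - 1))) * (ν - 2)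
      * simplexPoint q.1.1.1 q.1.1.2 q.1.2 q.2 ^ (ν - 2 - 1))) ?_
  refine ContinuousOn.mul (by fun_prop) (ContinuousOn.mul (by fun_prop)
    (ContinuousOn.rpow_const ?_ fun q hq => Or.inl
    (simplexPoint_pos hq.1.1.2 hq.1.2 hq.2).ne'))
  unfold simplexPoint
  fun_prop

lemma hasDerivAt_simplexPoint (z y t r : ℝ) : HasDerivAt (fun z => simplexPoint z y t r)
    (-Real.exp (-z) + t * Real.cosh z * (2 + r * (y - 1))) z := by
  have h1 : HasDerivAt (fun z => Real.exp (-z)) (Real.exp (-z) * -1) z :=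
    ((hasDerivAt_id z).neg).exp
  have h2 : HasDerivAt (fun z => t * Real.sinh z * (2 + r * (y - 1)))
      (t * Real.cosh z * (2 + r * (y - 1))) z :=
    ((Real.hasDerivAt_sinh z).const_mul t).mul_const _
  exact (h1.add h2).congr_deriv (by ring)

lemma hasDerivAt_divDiff (ν z : ℝ) {y : ℝ} (hy : y ∈ Set.Icc (-1 : ℝ) 1) :
    HasDerivAt (fun z => divDiff ν z y) (divDiffDeriv ν z y) z := by
  have hP : ∀ z : ℝ, ∀ t ∈ Set.Icc (0 : ℝ) 1, ∀ r ∈ Set.Icc (0 : ℝ) 1,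
      simplexPoint z y t r ≠ 0 := fun z t ht r hr => (simplexPoint_pos hy ht hr).ne'
  have c1 : ContinuousOn (fun q : (ℝ × ℝ) × ℝ => ν * (ν - 1) * q.1.2 *
      simplexPoint q.1.1 y q.1.2 q.2 ^ (ν - 2))
      ((Set.univ ×ˢ Set.Icc (0 : ℝ) 1) ×ˢ Set.Icc (0 : ℝ) 1) := by
    refine ContinuousOn.mul (by fun_prop) (ContinuousOn.rpow_const ?_ fun q hq => Or.inl
      (hP _ _ hq.1.2 _ hq.2))
    unfold simplexPoint
    fun_prop
  have c2 : ContinuousOn (fun q : (ℝ × ℝ) × ℝ => ν * (ν - 1) * q.1.2 *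
      ((-Real.exp (-q.1.1) + q.1.2 * Real.cosh q.1.1 * (2 + q.2 * (y - 1))) * (ν - 2)
        * simplexPoint q.1.1 y q.1.2 q.2 ^ (ν - 2 - 1)))
      ((Set.univ ×ˢ Set.Icc (0 : ℝ) 1) ×ˢ Set.Icc (0 : ℝ) 1) := by
    refine ContinuousOn.mul (by fun_prop) (ContinuousOn.mul (by fun_prop)
      (ContinuousOn.rpow_const ?_ fun q hq => Or.inl (hP _ _ hq.1.2 _ hq.2)))
    unfold simplexPoint
    fun_prop
  have i1 := continuousOn_intervalIntegral (f := fun (q : ℝ × ℝ) r => ν * (ν - 1) * q.2 *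
      simplexPoint q.1 y q.2 r ^ (ν - 2)) zero_le_one c1
  have i2 := continuousOn_intervalIntegral (f := fun (q : ℝ × ℝ) r => ν * (ν - 1) * q.2 *
      ((-Real.exp (-q.1) + q.2 * Real.cosh q.1 * (2 + r * (y - 1))) * (ν - 2)
        * simplexPoint q.1 y q.2 r ^ (ν - 2 - 1))) zero_le_one c2
  refine hasDerivAt_intervalIntegral
    (f := fun z t => ∫ r in (0 : ℝ)..1, ν * (ν - 1) * t * simplexPoint z y t r ^ (ν - 2))
    (f' := fun z t => ∫ r in (0 : ℝ)..1, ν * (ν - 1) * t *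
      ((-Real.exp (-z) + t * Real.cosh z * (2 + r * (y - 1))) * (ν - 2)
        * simplexPoint z y t r ^ (ν - 2 - 1))) isOpen_univ zero_le_one (fun x _ => ?_) i2
    (fun x _ t ht => ?_) (Set.mem_univ z)
  · exact i1.comp (f := fun t => (x, t)) (by fun_prop) fun t ht => ⟨Set.mem_univ _, ht⟩
  · refine hasDerivAt_intervalIntegral
      (f := fun z r => ν * (ν - 1) * t * simplexPoint z y t r ^ (ν - 2))
      (f' := fun z r => ν * (ν - 1) * t *
        ((-Real.exp (-z) + t * Real.cosh z * (2 + r * (y - 1))) * (ν - 2)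
          * simplexPoint z y t r ^ (ν - 2 - 1))) isOpen_univ zero_le_one (fun x _ => ?_) ?_
      (fun x _ r hr => ?_) (Set.mem_univ x)
    · exact c1.comp (f := fun r => ((x, t), r)) (by fun_prop)
        fun r hr => ⟨⟨Set.mem_univ _, ht⟩, hr⟩
    · exact c2.comp (f := fun q : ℝ × ℝ => ((q.1, t), q.2)) (by fun_prop)
        fun q hq => ⟨⟨Set.mem_univ _, ht⟩, hq.2⟩
    · exact ((hasDerivAt_simplexPoint x y t r).rpow_const
        (Or.inl (hP x t ht r hr))).const_mul _

/-- Two applications of the fundamental theorem of calculus, first in r and then in t. The recursion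
for divided differences is kept free of denominators so that it also covers coinciding points (y =
±1 or z = 0), while the integral form supplies continuity and differentiability there. -/
lemma divDiff_mul (ν z : ℝ) {y : ℝ} (hy : y ∈ Set.Icc (-1 : ℝ) 1) :
    ((y - 1) * Real.sinh z) * ((y + 1) * Real.sinh z) * (2 * Real.sinh z) * divDiff ν z y
      = 2 * Real.sinh z * ((Real.cosh z + y * Real.sinh z) ^ ν - Real.exp (-z) ^ ν)
        - (y + 1) * Real.sinh z * (Real.exp z ^ ν - Real.exp (-z) ^ ν) := by
  have hder : ∀ (ν a w t : ℝ), a + t * w ≠ 0 →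
      HasDerivAt (fun t => (a + t * w) ^ ν) (w * ν * (a + t * w) ^ (ν - 1)) t := by
    intro ν a w t h
    have h1 : HasDerivAt (fun t => a + t * w) w t := by
      simpa using ((hasDerivAt_id t).mul_const w).const_add a
    exact h1.rpow_const (Or.inl h)
  have hftc : ∀ (ν a w : ℝ), (∀ t ∈ Set.Icc (0 : ℝ) 1, a + t * w ≠ 0) →
      ∫ t in (0 : ℝ)..1, w * ν * (a + t * w) ^ (ν - 1) = (a + w) ^ ν - a ^ ν := by
    intro ν a w h
    rw [intervalIntegral.integral_eq_sub_of_hasDerivAt (f := fun t => (a + t * w) ^ ν)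
      (fun t ht => hder ν a w t (h t (by rwa [Set.uIcc_of_le zero_le_one] at ht)))]
    · simp
    · refine ContinuousOn.intervalIntegrable ?_
      rw [Set.uIcc_of_le zero_le_one]
      exact ContinuousOn.mul (by fun_prop) (ContinuousOn.rpow_const (by fun_prop)
        fun t ht => Or.inl (h t ht))
  set s := Real.sinh z with hs
  set a := Real.exp (-z) with ha
  have eb : Real.exp z = a + 2 * s := by rw [hs, ha, Real.sinh_eq]; ring
  have ex : Real.cosh z + y * s = a + (y + 1) * s := by
    rw [hs, ha, Real.sinh_eq, Real.cosh_eq]; ring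
  have hpos : ∀ t ∈ Set.Icc (0 : ℝ) 1, ∀ r ∈ Set.Icc (0 : ℝ) 1,
      a + t * s * (2 + r * (y - 1)) ≠ 0 := fun t ht r hr => (simplexPoint_pos hy ht hr).ne'
  have one_mem : (1 : ℝ) ∈ Set.Icc (0 : ℝ) 1 := by simp
  have zero_mem : (0 : ℝ) ∈ Set.Icc (0 : ℝ) 1 := by simp
  have inner : ∀ t ∈ Set.Icc (0 : ℝ) 1,
      (y - 1) * s * ∫ r in (0 : ℝ)..1, ν * (ν - 1) * t * simplexPoint z y t r ^ (ν - 2)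
        = ν * (a + t * ((y + 1) * s)) ^ (ν - 1) - ν * (a + t * (2 * s)) ^ (ν - 1) := by
    intro t ht
    have := hftc (ν - 1) (a + t * (2 * s)) (t * s * (y - 1)) (fun r hr => by
      have := hpos t ht r hr
      contrapose! this
      linear_combination this)
    rw [show a + t * ((y + 1) * s) = a + t * (2 * s) + t * s * (y - 1) by ring, ← mul_sub, ← this,
      ← intervalIntegral.integral_const_mul, ← intervalIntegral.integral_const_mul]
    refine intervalIntegral.integral_congr fun r _ => ?_
    simp only [simplexPoint, ← hs, ← ha]
    rw [show a + t * s * (2 + r * (y - 1)) = a + t * (2 * s) + r * (t * s * (y - 1)) by ring,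
      show ν - 2 = ν - 1 - 1 by ring]
    ring
  have hx : ∀ t ∈ Set.Icc (0 : ℝ) 1, a + t * ((y + 1) * s) ≠ 0 := fun t ht => by
    have := hpos t ht 1 one_mem
    contrapose! this
    linear_combination this
  have hb : ∀ t ∈ Set.Icc (0 : ℝ) 1, a + t * (2 * s) ≠ 0 := fun t ht => by
    have := hpos t ht 0 zero_mem
    contrapose! this
    linear_combination this
  have int1 : ∀ w, (∀ t ∈ Set.Icc (0 : ℝ) 1, a + t * w ≠ 0) → IntervalIntegrable
      (fun t => ν * (a + t * w) ^ (ν - 1)) MeasureTheory.volume 0 1 := by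
    intro w hw
    refine ContinuousOn.intervalIntegrable ?_
    rw [Set.uIcc_of_le zero_le_one]
    exact ContinuousOn.mul (by fun_prop) (ContinuousOn.rpow_const (by fun_prop)
      fun t ht => Or.inl (hw t ht))
  have outer : (y - 1) * s * divDiff ν z y
      = (∫ t in (0 : ℝ)..1, ν * (a + t * ((y + 1) * s)) ^ (ν - 1))
        - ∫ t in (0 : ℝ)..1, ν * (a + t * (2 * s)) ^ (ν - 1) := by
    rw [← intervalIntegral.integral_sub (int1 _ hx) (int1 _ hb), divDiff,
      ← intervalIntegral.integral_const_mul]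
    refine intervalIntegral.integral_congr fun t ht => ?_
    rw [Set.uIcc_of_le zero_le_one] at ht
    exact inner t ht
  have k1 : (y + 1) * s * ∫ t in (0 : ℝ)..1, ν * (a + t * ((y + 1) * s)) ^ (ν - 1)
      = (a + (y + 1) * s) ^ ν - a ^ ν := by
    rw [← hftc ν a _ hx, ← intervalIntegral.integral_const_mul]
    exact intervalIntegral.integral_congr fun t _ => by ring
  have k2 : 2 * s * ∫ t in (0 : ℝ)..1, ν * (a + t * (2 * s)) ^ (ν - 1)
      = (a + 2 * s) ^ ν - a ^ ν := by
    rw [← hftc ν a _ hb, ← intervalIntegral.integral_const_mul]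
    exact intervalIntegral.integral_congr fun t _ => by ring
  rw [eb, ex]
  linear_combination (y + 1) * s * (2 * s) * outer + 2 * s * k1 - (y + 1) * s * k2

/-! ### The radicand, its quotient by the turning-point factors, and the derivative in z. -/

/-- The coefficient of `x ^ ((1 + δ) / 2)` in `radicand δ z x`. -/
noncomputable def radCoeff (δ z : ℝ) : ℝ :=
  Real.sinh ((3 + δ) / 2 * z) / (2 * Real.sinh (δ * z))

/-- The derivative of `radCoeff δ z` in `z`. -/
noncomputable def radCoeffDeriv (δ z : ℝ) : ℝ :=
  ((3 + δ) / 2 * Real.cosh ((3 + δ) / 2 * z) * Real.sinh (δ * z)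
    - δ * Real.sinh ((3 + δ) / 2 * z) * Real.cosh (δ * z)) / (2 * Real.sinh (δ * z) ^ 2)

/-- The combination of `x ^ 2`, `x ^ ((1 + δ) / 2)` and `x ^ ((1 - δ) / 2)` that vanishes at
`exp z` and `exp (-z)`, with `-1 / 2` as the coefficient of `x ^ 2`. -/
noncomputable def radicand (δ z x : ℝ) : ℝ :=
  -x ^ 2 / 2 + radCoeff δ z * x ^ ((1 + δ) / 2) + radCoeff (-δ) z * x ^ ((1 - δ) / 2)

/-- The quotient of `radicand δ z x` by `(x - exp (-z)) * (exp z - x)` at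
`x = cosh z + y * sinh z`. -/
noncomputable def radQuot (δ z y : ℝ) : ℝ :=
  1 / 2 - radCoeff δ z * divDiff ((1 + δ) / 2) z y - radCoeff (-δ) z * divDiff ((1 - δ) / 2) z y

/-- The derivative of `radQuot δ z y` in `z`. -/
noncomputable def radQuotDeriv (δ z y : ℝ) : ℝ :=
  -(radCoeffDeriv δ z * divDiff ((1 + δ) / 2) z y
      + radCoeff δ z * divDiffDeriv ((1 + δ) / 2) z y)
    - (radCoeffDeriv (-δ) z * divDiff ((1 - δ) / 2) z y
      + radCoeff (-δ) z * divDiffDeriv ((1 - δ) / 2) z y)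

/-- The two power terms trade places. This is the duality (2-α)(2-α') = 4, and it reduces sign
questions to δ > 0. -/
lemma radQuot_neg (δ z y : ℝ) : radQuot (-δ) z y = radQuot δ z y := by
  simp only [radQuot, neg_neg, sub_neg_eq_add, ← sub_eq_add_neg]
  ring

lemma radQuotDeriv_neg (δ z y : ℝ) : radQuotDeriv (-δ) z y = radQuotDeriv δ z y := by
  simp only [radQuotDeriv, neg_neg, sub_neg_eq_add, ← sub_eq_add_neg]
  ring

lemma sinh_mul_ne_zero {δ z : ℝ} (hδ : δ ≠ 0) (hz : z ≠ 0) : Real.sinh (δ * z) ≠ 0 := by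
  rw [Ne, Real.sinh_eq_zero]
  exact mul_ne_zero hδ hz

lemma hasDerivAt_radCoeff {δ z : ℝ} (hδ : δ ≠ 0) (hz : z ≠ 0) :
    HasDerivAt (radCoeff δ) (radCoeffDeriv δ z) z := by
  have h := sinh_mul_ne_zero hδ hz
  have hs : ∀ a : ℝ, HasDerivAt (fun z => Real.sinh (a * z)) (Real.cosh (a * z) * a) z := by
    intro a
    have h1 : HasDerivAt (fun z => a * z) a z := by simpa using (hasDerivAt_id z).const_mul a
    exact (Real.hasDerivAt_sinh _).comp z h1
  refine ((hs ((3 + δ) / 2)).div ((hs δ).const_mul 2) (mul_ne_zero two_ne_zero h)).congr_deriv ?_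
  rw [radCoeffDeriv]
  field_simp

/-- Evenness in z transfers each fact at the turning point e^z to e^(-z). -/
lemma radCoeff_even (δ z : ℝ) : radCoeff δ (-z) = radCoeff δ z := by
  simp only [radCoeff, mul_neg, Real.sinh_neg, neg_div_neg_eq]

lemma radCoeffDeriv_odd (δ z : ℝ) : radCoeffDeriv δ (-z) = -radCoeffDeriv δ z := by
  simp only [radCoeffDeriv, mul_neg, Real.sinh_neg, Real.cosh_neg]
  ring

/-- The exponents and coefficients of `sinh z ^ 3 * (1 - y ^ 2) * radQuotDeriv δ z y` as an
exponential sum in `log x`. -/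
noncomputable def radDerivList (δ z : ℝ) : List (ℝ × ℝ) :=
  [(1, 1), (Real.sinh z * radCoeffDeriv δ z - (3 - δ) / 2 * Real.cosh z * radCoeff δ z,
      (1 + δ) / 2),
    (Real.sinh z * radCoeffDeriv (-δ) z - (3 + δ) / 2 * Real.cosh z * radCoeff (-δ) z,
      (1 - δ) / 2),
    (-(radCoeff δ z * ((1 + δ) / 2)), (1 + δ) / 2 - 1),
    (-(radCoeff (-δ) z * ((1 - δ) / 2)), (1 - δ) / 2 - 1)]

lemma radDerivList_even (δ z : ℝ) : radDerivList δ (-z) = radDerivList δ z := by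
  simp only [radDerivList, radCoeff_even, radCoeffDeriv_odd, Real.sinh_neg, Real.cosh_neg,
    neg_mul_neg]

/-- Every exponential below is a Laurent monomial in e^(z/2) and e^(δz/2), which turns the
hyperbolic identities into rational identities in two independent variables. -/
lemma exp_half_mul (δ z : ℝ) (i j : ℤ) {μ : ℝ} (h : μ = (i + j * δ) / 2 * z) :
    Real.exp μ = Real.exp (z / 2) ^ i * Real.exp (δ * z / 2) ^ j := by
  rw [← Real.rpow_intCast, ← Real.rpow_intCast, ← Real.exp_mul, ← Real.exp_mul, ← Real.exp_add, h]
  congr 1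
  ring

lemma radicand_exp {δ z : ℝ} (hδ : δ ≠ 0) (hz : z ≠ 0) : radicand δ z (Real.exp z) = 0 := by
  have h := sinh_mul_ne_zero hδ hz
  have e1 : Real.exp z ^ ((1 + δ) / 2) = Real.exp ((1 + δ) / 2 * z) := by
    rw [← Real.exp_mul, mul_comm]
  have e2 : Real.exp z ^ ((1 - δ) / 2) = Real.exp ((1 - δ) / 2 * z) := by
    rw [← Real.exp_mul, mul_comm]
  have key : Real.sinh ((3 + δ) / 2 * z) * Real.exp ((1 + δ) / 2 * z)
      - Real.sinh ((3 - δ) / 2 * z) * Real.exp ((1 - δ) / 2 * z)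
        = Real.exp z ^ 2 * Real.sinh (δ * z) := by
    simp only [Real.sinh_eq]
    rw [exp_half_mul δ z 3 1 (μ := (3 + δ) / 2 * z) (by push_cast; ring),
      exp_half_mul δ z (-3) (-1) (μ := -((3 + δ) / 2 * z)) (by push_cast; ring),
      exp_half_mul δ z 1 1 (μ := (1 + δ) / 2 * z) (by push_cast; ring),
      exp_half_mul δ z 1 (-1) (μ := (1 - δ) / 2 * z) (by push_cast; ring),
      exp_half_mul δ z 3 (-1) (μ := (3 - δ) / 2 * z) (by push_cast; ring),
      exp_half_mul δ z (-3) 1 (μ := -((3 - δ) / 2 * z)) (by push_cast; ring),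
      exp_half_mul δ z 2 0 (μ := z) (by push_cast; ring),
      exp_half_mul δ z 0 2 (μ := δ * z) (by push_cast; ring),
      exp_half_mul δ z 0 (-2) (μ := -(δ * z)) (by push_cast; ring)]
    have hu := (Real.exp_pos (z / 2)).ne'
    have hw := (Real.exp_pos (δ * z / 2)).ne'
    field_simp
    ring
  rw [radicand, e1, e2, radCoeff, radCoeff, ← sub_eq_add_neg, neg_mul, Real.sinh_neg]
  generalize Real.sinh ((3 + δ) / 2 * z) = s₁ at *
  generalize Real.sinh ((3 - δ) / 2 * z) = s₂ at *
  generalize Real.exp ((1 + δ) / 2 * z) = x₁ at *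
  generalize Real.exp ((1 - δ) / 2 * z) = x₂ at *
  generalize Real.exp z = x at *
  generalize Real.sinh (δ * z) = s at *
  field_simp
  linear_combination key

lemma radicand_exp_neg {δ z : ℝ} (hδ : δ ≠ 0) (hz : z ≠ 0) :
    radicand δ z (Real.exp (-z)) = 0 := by
  have := radicand_exp hδ (neg_ne_zero.2 hz)
  rwa [radicand, radCoeff_even, radCoeff_even] at this

/-- This zero is the one that the factor 1 - y² in `radQuotDeriv_mul` predicts at y = 1. -/
lemma expSum_radDerivList {δ z : ℝ} (hδ : δ ≠ 0) (hz : z ≠ 0) :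
    expSum (radDerivList δ z) z = 0 := by
  have h := sinh_mul_ne_zero hδ hz
  simp only [radDerivList, expSum_cons, expSum_nil, radCoeff, radCoeffDeriv, neg_mul,
    Real.sinh_neg, Real.cosh_neg, ← sub_eq_add_neg]
  rw [Real.sinh_eq (δ * z)] at h ⊢
  simp only [Real.sinh_eq, Real.cosh_eq]
  rw [exp_half_mul δ z 0 2 (μ := δ * z) (by push_cast; ring),
      exp_half_mul δ z 0 (-2) (μ := -(δ * z)) (by push_cast; ring)] at *
  rw [exp_half_mul δ z 3 1 (μ := (3 + δ) / 2 * z) (by push_cast; ring),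
      exp_half_mul δ z (-3) (-1) (μ := -((3 + δ) / 2 * z)) (by push_cast; ring),
      exp_half_mul δ z 1 1 (μ := (1 + δ) / 2 * z) (by push_cast; ring),
      exp_half_mul δ z 1 (-1) (μ := (1 - δ) / 2 * z) (by push_cast; ring),
      exp_half_mul δ z (-1) 1 (μ := ((1 + δ) / 2 - 1) * z) (by push_cast; ring),
      exp_half_mul δ z (-1) (-1) (μ := ((1 - δ) / 2 - 1) * z) (by push_cast; ring),
      exp_half_mul δ z 3 (-1) (μ := (3 - δ) / 2 * z) (by push_cast; ring),
      exp_half_mul δ z (-3) 1 (μ := -((3 - δ) / 2 * z)) (by push_cast; ring),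
      exp_half_mul δ z 2 0 (μ := 1 * z) (by push_cast; ring),
      exp_half_mul δ z 2 0 (μ := z) (by push_cast; ring),
      exp_half_mul δ z (-2) 0 (μ := -z) (by push_cast; ring)]
  have hu := (Real.exp_pos (z / 2)).ne'
  have hw := (Real.exp_pos (δ * z / 2)).ne'
  generalize Real.exp (z / 2) = u at *
  generalize Real.exp (δ * z / 2) = w at *
  -- The denominator sinh(δz) in terms of w = e^(δz/2), up to a power of w.
  have h' : w ^ 4 - 1 ≠ 0 := by
    contrapose! h
    field_simp
    linear_combination h
  field_simp at h ⊢
  ring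

/-- At the turning point the argument equals the parameter z, so the slope becomes a function of z
alone. Clearing sinh² (δz) leaves the eight-term sum, whose sign is known from `turningList_pos`. -/
lemma expSum_step_radDerivList {δ z : ℝ} (hδ : δ ≠ 0) (hz : z ≠ 0) :
    expSum (expSumStep 0 (radDerivList δ z)) z
      = -(Real.exp z * expSum (turningList 1 δ) z) / (16 * Real.sinh (δ * z) ^ 2) := by
  have h := sinh_mul_ne_zero hδ hz
  simp only [radDerivList, turningList, expSumStep_cons, expSumStep_nil, expSum_cons, expSum_nil,
    radCoeff, radCoeffDeriv, neg_mul, Real.sinh_neg, Real.cosh_neg, ← sub_eq_add_neg]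
  rw [Real.sinh_eq (δ * z)] at h ⊢
  simp only [Real.sinh_eq, Real.cosh_eq]
  rw [exp_half_mul δ z 0 2 (μ := δ * z) (by push_cast; ring),
      exp_half_mul δ z 0 (-2) (μ := -(δ * z)) (by push_cast; ring)] at *
  rw [exp_half_mul δ z 3 1 (μ := (3 + δ) / 2 * z) (by push_cast; ring),
      exp_half_mul δ z (-3) (-1) (μ := -((3 + δ) / 2 * z)) (by push_cast; ring),
      exp_half_mul δ z 1 1 (μ := (1 + δ) / 2 * z) (by push_cast; ring),
      exp_half_mul δ z 1 (-1) (μ := (1 - δ) / 2 * z) (by push_cast; ring),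
      exp_half_mul δ z (-1) 1 (μ := ((1 + δ) / 2 - 1) * z) (by push_cast; ring),
      exp_half_mul δ z (-1) (-1) (μ := ((1 - δ) / 2 - 1) * z) (by push_cast; ring),
      exp_half_mul δ z 3 (-1) (μ := (3 - δ) / 2 * z) (by push_cast; ring),
      exp_half_mul δ z (-3) 1 (μ := -((3 - δ) / 2 * z)) (by push_cast; ring),
      exp_half_mul δ z 2 0 (μ := 1 * z) (by push_cast; ring),
      exp_half_mul δ z 2 0 (μ := z) (by push_cast; ring),
      exp_half_mul δ z (-2) 0 (μ := -z) (by push_cast; ring),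
      exp_half_mul δ z 0 0 (μ := 0 * z) (by push_cast; ring),
      exp_half_mul δ z 4 0 (μ := 2 * z) (by push_cast; ring),
      exp_half_mul δ z 0 4 (μ := 2 * δ * z) (by push_cast; ring),
      exp_half_mul δ z 0 (-4) (μ := -(2 * δ * z)) (by push_cast; ring),
      exp_half_mul δ z (-2) 2 (μ := (δ - 1) * z) (by push_cast; ring),
      exp_half_mul δ z (-2) (-2) (μ := (-1 - δ) * z) (by push_cast; ring),
      exp_half_mul δ z (-6) 2 (μ := (δ - 3) * z) (by push_cast; ring),
      exp_half_mul δ z (-6) (-2) (μ := (-3 - δ) * z) (by push_cast; ring)]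
  have hu := (Real.exp_pos (z / 2)).ne'
  have hw := (Real.exp_pos (δ * z / 2)).ne'
  generalize Real.exp (z / 2) = u at *
  generalize Real.exp (δ * z / 2) = w at *
  have h' : w ^ 4 - 1 ≠ 0 := by
    contrapose! h
    field_simp
    linear_combination h
  field_simp at h ⊢
  ring

lemma expSum_radDerivList_neg {δ z : ℝ} (hδ : δ ≠ 0) (hz : z ≠ 0) :
    expSum (radDerivList δ z) (-z) = 0 := by
  rw [← radDerivList_even]
  exact expSum_radDerivList hδ (neg_ne_zero.2 hz)

lemma expSum_step_radDerivList_neg {δ z : ℝ} (hδ : δ ≠ 0) (hz : z ≠ 0) :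
    expSum (expSumStep 0 (radDerivList δ z)) (-z)
      = -(Real.exp (-z) * expSum (turningList 1 δ) (-z)) / (16 * Real.sinh (δ * z) ^ 2) := by
  rw [← radDerivList_even, expSum_step_radDerivList hδ (neg_ne_zero.2 hz), mul_neg, Real.sinh_neg,
    neg_sq]

lemma cosh_add_mul_sinh_pos {y z : ℝ} (hy : y ∈ Set.Icc (-1 : ℝ) 1) :
    0 < Real.cosh z + y * Real.sinh z := by
  have e : Real.cosh z + y * Real.sinh z
      = (1 - y) / 2 * Real.exp (-z) + (1 + y) / 2 * Real.exp z := by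
    rw [Real.cosh_eq, Real.sinh_eq]; ring
  rw [e]
  have h1 := Real.exp_pos z
  have h2 := Real.exp_pos (-z)
  have h3 : 0 ≤ (1 - y) / 2 := by linarith [hy.2]
  rcases hy.1.eq_or_lt with h | h
  · rw [← h]; norm_num; exact h2
  · have h4 : 0 < (1 + y) / 2 := by linarith
    positivity

/-- A function vanishing at a = e^(-z) and b = e^z is (x-a)(x-b) times its second divided difference
at a, b, x. That of x² is 1, and (x-a)(b-x) = sinh² z (1-y²). -/
lemma radQuot_mul {δ z y : ℝ} (hδ : δ ≠ 0) (hz : z ≠ 0) (hy : y ∈ Set.Icc (-1 : ℝ) 1) :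
    Real.sinh z ^ 2 * (1 - y ^ 2) * radQuot δ z y
      = radicand δ z (Real.cosh z + y * Real.sinh z) := by
  have hs : Real.sinh z ≠ 0 := by simpa using sinh_mul_ne_zero one_ne_zero hz
  have h1 := divDiff_mul ((1 + δ) / 2) z hy
  have h2 := divDiff_mul ((1 - δ) / 2) z hy
  have h3 := radicand_exp hδ hz
  have h4 := radicand_exp_neg hδ hz
  rw [radicand] at h3 h4 ⊢
  rw [radQuot]
  have eb : Real.exp z = Real.cosh z + Real.sinh z := (Real.cosh_add_sinh z).symm
  have ea : Real.exp (-z) = Real.cosh z - Real.sinh z := (Real.cosh_sub_sinh z).symm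
  refine mul_left_cancel₀ (mul_ne_zero two_ne_zero hs) ?_
  have e3 : Real.exp z ^ 2 = (Real.cosh z + Real.sinh z) ^ 2 := by rw [eb]
  have e4 : Real.exp (-z) ^ 2 = (Real.cosh z - Real.sinh z) ^ 2 := by rw [ea]
  linear_combination radCoeff δ z * h1 + radCoeff (-δ) z * h2 - (y + 1) * Real.sinh z * h3
    + (y - 1) * Real.sinh z * h4 - (y + 1) * Real.sinh z / 2 * e3
    + (y - 1) * Real.sinh z / 2 * e4

lemma hasDerivAt_radQuot {δ z y : ℝ} (hδ : δ ≠ 0) (hz : z ≠ 0) (hy : y ∈ Set.Icc (-1 : ℝ) 1) :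
    HasDerivAt (fun z => radQuot δ z y) (radQuotDeriv δ z y) z := by
  have h1 := (hasDerivAt_radCoeff hδ hz).mul (hasDerivAt_divDiff ((1 + δ) / 2) z hy)
  have h2 := (hasDerivAt_radCoeff (neg_ne_zero.2 hδ) hz).mul
    (hasDerivAt_divDiff ((1 - δ) / 2) z hy)
  refine ((h1.const_sub (1 / 2)).sub h2).congr_deriv ?_
  rw [radQuotDeriv]

lemma continuousOn_radCoeff {δ : ℝ} (hδ : δ ≠ 0) : ContinuousOn (radCoeff δ) (Set.Ioi 0) :=
  fun _ hz => (hasDerivAt_radCoeff hδ (ne_of_gt hz)).continuousAt.continuousWithinAt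

lemma continuousOn_radCoeffDeriv {δ : ℝ} (hδ : δ ≠ 0) :
    ContinuousOn (radCoeffDeriv δ) (Set.Ioi 0) := by
  unfold radCoeffDeriv
  refine ContinuousOn.div ?_ ?_ fun z hz =>
    mul_ne_zero two_ne_zero (pow_ne_zero 2 (sinh_mul_ne_zero hδ (ne_of_gt hz)))
  · exact Continuous.continuousOn (by fun_prop)
  · exact Continuous.continuousOn (by fun_prop)

lemma continuousOn_radQuot {δ : ℝ} (hδ : δ ≠ 0) :
    ContinuousOn (fun q : ℝ × ℝ => radQuot δ q.1 q.2) (Set.Ioi 0 ×ˢ Set.Icc (-1 : ℝ) 1) := by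
  have c : ∀ {g : ℝ → ℝ}, ContinuousOn g (Set.Ioi 0) →
      ContinuousOn (fun q : ℝ × ℝ => g q.1) (Set.Ioi 0 ×ˢ Set.Icc (-1 : ℝ) 1) :=
    fun h => h.comp continuousOn_fst fun q hq => hq.1
  have d : ∀ {g : ℝ × ℝ → ℝ}, ContinuousOn g (Set.univ ×ˢ Set.Icc (-1 : ℝ) 1) →
      ContinuousOn g (Set.Ioi 0 ×ˢ Set.Icc (-1 : ℝ) 1) :=
    fun h => h.mono (Set.prod_mono (Set.subset_univ _) Set.Subset.rfl)
  exact (continuousOn_const.sub ((c (continuousOn_radCoeff hδ)).mul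
    (d (continuousOn_divDiff _)))).sub ((c (continuousOn_radCoeff (neg_ne_zero.2 hδ))).mul
    (d (continuousOn_divDiff _)))

lemma continuousOn_radQuotDeriv {δ : ℝ} (hδ : δ ≠ 0) :
    ContinuousOn (fun q : ℝ × ℝ => radQuotDeriv δ q.1 q.2)
      (Set.Ioi 0 ×ˢ Set.Icc (-1 : ℝ) 1) := by
  have c : ∀ {g : ℝ → ℝ}, ContinuousOn g (Set.Ioi 0) →
      ContinuousOn (fun q : ℝ × ℝ => g q.1) (Set.Ioi 0 ×ˢ Set.Icc (-1 : ℝ) 1) :=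
    fun h => h.comp continuousOn_fst fun q hq => hq.1
  have d : ∀ {g : ℝ × ℝ → ℝ}, ContinuousOn g (Set.univ ×ˢ Set.Icc (-1 : ℝ) 1) →
      ContinuousOn g (Set.Ioi 0 ×ˢ Set.Icc (-1 : ℝ) 1) :=
    fun h => h.mono (Set.prod_mono (Set.subset_univ _) Set.Subset.rfl)
  have hδ' := neg_ne_zero.2 hδ
  exact (((c (continuousOn_radCoeffDeriv hδ)).mul (d (continuousOn_divDiff _))).add
    ((c (continuousOn_radCoeff hδ)).mul (d (continuousOn_divDiffDeriv _)))).neg.sub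
    (((c (continuousOn_radCoeffDeriv hδ')).mul (d (continuousOn_divDiff _))).add
    ((c (continuousOn_radCoeff hδ')).mul (d (continuousOn_divDiffDeriv _))))

-- Differentiate `radQuot_mul` in z at fixed y, multiply by sinh z, and eliminate Q by `radQuot_mul`
-- itself. The x² terms cancel, which is why only five exponents remain.
open Topology Filter in
lemma radQuotDeriv_mul {δ z y : ℝ} (hδ : δ ≠ 0) (hz : 0 < z) (hy : y ∈ Set.Icc (-1 : ℝ) 1) :
    Real.sinh z ^ 3 * (1 - y ^ 2) * radQuotDeriv δ z y
      = expSum (radDerivList δ z) (Real.log (Real.cosh z + y * Real.sinh z)) := by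
  set x := Real.cosh z + y * Real.sinh z with hx
  have hx0 : 0 < x := cosh_add_mul_sinh_pos hy
  have dx : HasDerivAt (fun z => Real.cosh z + y * Real.sinh z)
      (Real.sinh z + y * Real.cosh z) z :=
    (Real.hasDerivAt_cosh z).add ((Real.hasDerivAt_sinh z).const_mul y)
  have d1 : HasDerivAt (fun z => Real.sinh z ^ 2 * (1 - y ^ 2) * radQuot δ z y)
      (2 * Real.sinh z * Real.cosh z * (1 - y ^ 2) * radQuot δ z y
        + Real.sinh z ^ 2 * (1 - y ^ 2) * radQuotDeriv δ z y) z := by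
    refine ((((Real.hasDerivAt_sinh z).pow 2).mul_const (1 - y ^ 2)).mul
      (hasDerivAt_radQuot hδ hz.ne' hy)).congr_deriv ?_
    simp
  have d2 : HasDerivAt (fun z => radicand δ z (Real.cosh z + y * Real.sinh z))
      (-(x * (Real.sinh z + y * Real.cosh z))
        + (radCoeffDeriv δ z * x ^ ((1 + δ) / 2) + radCoeff δ z *
          ((Real.sinh z + y * Real.cosh z) * ((1 + δ) / 2) * x ^ ((1 + δ) / 2 - 1)))
        + (radCoeffDeriv (-δ) z * x ^ ((1 - δ) / 2) + radCoeff (-δ) z *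
          ((Real.sinh z + y * Real.cosh z) * ((1 - δ) / 2) * x ^ ((1 - δ) / 2 - 1)))) z := by
    have a1 := (dx.pow 2).neg.div_const 2
    have a2 := (hasDerivAt_radCoeff hδ hz.ne').mul
      (dx.rpow_const (p := (1 + δ) / 2) (Or.inl hx0.ne'))
    have a3 := (hasDerivAt_radCoeff (neg_ne_zero.2 hδ) hz.ne').mul
      (dx.rpow_const (p := (1 - δ) / 2) (Or.inl hx0.ne'))
    refine ((a1.add a2).add a3).congr_deriv ?_
    simp only [← hx]
    push_cast
    ring
  have heq : (fun z => Real.sinh z ^ 2 * (1 - y ^ 2) * radQuot δ z y)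
      =ᶠ[𝓝 z] fun z => radicand δ z (Real.cosh z + y * Real.sinh z) := by
    filter_upwards [eventually_gt_nhds hz] with w hw
    exact radQuot_mul hδ hw.ne' hy
  have h := d1.unique (d2.congr_of_eventuallyEq heq)
  have h0 := radQuot_mul hδ hz.ne' hy
  rw [← hx, radicand] at h0
  have hp : ∀ ν : ℝ, Real.exp (ν * Real.log x) = x ^ ν := fun ν => by
    rw [Real.rpow_def_of_pos hx0, mul_comm]
  simp only [radDerivList, expSum_cons, expSum_nil, hp, Real.rpow_one]
  have hm : ∀ ν : ℝ, x ^ ν = x * x ^ (ν - 1) := fun ν => by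
    rw [Real.rpow_sub_one hx0.ne']; field_simp
  rw [hm ((1 + δ) / 2), hm ((1 - δ) / 2)] at h h0 ⊢
  have hcs : Real.cosh z ^ 2 = Real.sinh z ^ 2 + 1 := Real.cosh_sq z
  -- This expresses sinh z times ∂x/∂z through x, so that y disappears.
  have hxx : Real.sinh z * (Real.sinh z + y * Real.cosh z) = Real.cosh z * x - 1 := by
    rw [hx]; linear_combination -hcs
  linear_combination Real.sinh z * h - 2 * Real.cosh z * h0
    + (-x + radCoeff δ z * ((1 + δ) / 2) * x ^ ((1 + δ) / 2 - 1)
      + radCoeff (-δ) z * ((1 - δ) / 2) * x ^ ((1 - δ) / 2 - 1)) * hxx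

/-! ### The function x coth x and the logarithmic derivatives of the coefficients. -/

/-- The even function `x * coth x`. -/
noncomputable def mulCoth (x : ℝ) : ℝ := x * Real.cosh x / Real.sinh x

lemma mulCoth_neg (x : ℝ) : mulCoth (-x) = mulCoth x := by
  simp [mulCoth]

lemma mulCoth_abs (x : ℝ) : mulCoth |x| = mulCoth x := by
  rcases abs_choice x with h | h <;> rw [h]
  exact mulCoth_neg x

lemma hasDerivAt_mulCoth {x : ℝ} (hx : 0 < x) :
    HasDerivAt mulCoth ((Real.cosh x * Real.sinh x - x) / Real.sinh x ^ 2) x := by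
  have hs := (Real.sinh_pos_iff.2 hx).ne'
  refine (((hasDerivAt_id x).mul (Real.hasDerivAt_cosh x)).div (Real.hasDerivAt_sinh x)
    hs).congr_deriv ?_
  simp only [id, Pi.mul_apply]
  congr 1
  linear_combination -x * Real.cosh_sq x

lemma strictMonoOn_mulCoth : StrictMonoOn mulCoth (Set.Ioi 0) := by
  refine strictMonoOn_of_deriv_pos (convex_Ioi 0)
    (fun x hx => (hasDerivAt_mulCoth hx).continuousAt.continuousWithinAt) fun x hx => ?_
  rw [interior_Ioi] at hx
  rw [(hasDerivAt_mulCoth hx).deriv]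
  have h1 := Real.self_lt_sinh_iff.2 hx
  have h2 := Real.one_lt_cosh.2 (ne_of_gt hx)
  have h3 : 0 < x := hx
  have : 0 < Real.sinh x := h3.trans h1
  refine div_pos ?_ (by positivity)
  nlinarith

/-- That x coth x has slope below 1 amounts to sinh x · e^(-x) < x, that is, 1 - 2x < e^(-2x). -/
lemma strictAntiOn_mulCoth_sub_id : StrictAntiOn (fun x => mulCoth x - x) (Set.Ioi 0) := by
  refine strictAntiOn_of_deriv_neg (convex_Ioi 0) (fun x hx =>
    ((hasDerivAt_mulCoth hx).sub (hasDerivAt_id x)).continuousAt.continuousWithinAt) fun x hx => ?_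
  rw [interior_Ioi] at hx
  have hd := ((hasDerivAt_mulCoth hx).sub (hasDerivAt_id x)).deriv
  simp only [Pi.sub_def, id] at hd
  rw [hd, sub_neg]
  have h1 : 0 < Real.sinh x := Real.sinh_pos_iff.2 hx
  rw [div_lt_one (by positivity)]
  have h2 : -(2 * x) + 1 < Real.exp (-(2 * x)) :=
    Real.add_one_lt_exp (by have : 0 < x := hx; linarith)
  have h3 : Real.exp (-(2 * x)) = Real.exp (-x) * Real.exp (-x) := by
    rw [← Real.exp_add]; congr 1; ring
  have h4 : Real.exp x * Real.exp (-x) = 1 := by rw [← Real.exp_add]; simp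
  rw [Real.sinh_eq, Real.cosh_eq]
  nlinarith

lemma radCoeff_pos {δ z : ℝ} (hδ : 0 < δ) (hz : 0 < z) : 0 < radCoeff δ z := by
  have h1 : 0 < Real.sinh ((3 + δ) / 2 * z) := Real.sinh_pos_iff.2 (by positivity)
  have h2 : 0 < Real.sinh (δ * z) := Real.sinh_pos_iff.2 (by positivity)
  rw [radCoeff]
  positivity

lemma radCoeff_neg_of_neg {δ z : ℝ} (hδ : δ < 0) (hδ3 : -3 < δ) (hz : 0 < z) :
    radCoeff δ z < 0 := by
  have h1 : 0 < Real.sinh ((3 + δ) / 2 * z) :=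
    Real.sinh_pos_iff.2 (mul_pos (by linarith) hz)
  have h2 : Real.sinh (δ * z) < 0 := Real.sinh_neg_iff.2 (mul_neg_of_neg_of_pos hδ hz)
  rw [radCoeff]
  exact div_neg_of_pos_of_neg h1 (by linarith)

lemma radCoeff_ne_zero {δ z : ℝ} (hδ : δ ≠ 0) (hδ3 : -3 < δ) (hz : 0 < z) :
    radCoeff δ z ≠ 0 := by
  rcases lt_or_gt_of_ne hδ with h | h
  · exact (radCoeff_neg_of_neg h hδ3 hz).ne
  · exact (radCoeff_pos h hz).ne'

/-- Logarithmic differentiation of a quotient of hyperbolic sines. Comparisons of coefficients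
thereby become monotonicity of x coth x. -/
lemma radCoeffDeriv_eq {δ z : ℝ} (hδ : δ ≠ 0) (hδ3 : -3 < δ) (hz : 0 < z) :
    z * radCoeffDeriv δ z
      = radCoeff δ z * (mulCoth ((3 + δ) / 2 * z) - mulCoth (δ * z)) := by
  have h1 := sinh_mul_ne_zero hδ hz.ne'
  have h2 := sinh_mul_ne_zero (δ := (3 + δ) / 2) (by linarith) hz.ne'
  rw [radCoeffDeriv, radCoeff, mulCoth, mulCoth]
  generalize Real.sinh (δ * z) = s at *
  generalize Real.sinh ((3 + δ) / 2 * z) = s' at *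
  field_simp

/-! ### The sign of ∂_z Q between the turning points. -/

open Filter Topology

lemma tendsto_exp_neg_mul_expSum_atTop {a : ℝ} {l : List (ℝ × ℝ)} (h : ∀ q ∈ l, q.2 < a) :
    Tendsto (fun v => Real.exp (-a * v) * expSum l v) atTop (𝓝 0) := by
  induction l with
  | nil => simp
  | cons q l ih =>
    have h1 : Tendsto (fun v => q.1 * Real.exp ((q.2 - a) * v)) atTop (𝓝 (q.1 * 0)) := by
      refine (Real.tendsto_exp_atBot.comp ?_).const_mul _
      exact tendsto_id.const_mul_atTop_of_neg (by linarith [h q (by simp)])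
    have h2 := h1.add (ih fun r hr => h r (by simp [hr]))
    rw [mul_zero, add_zero] at h2
    refine h2.congr fun v => ?_
    rw [expSum_cons, sub_mul, sub_eq_add_neg, Real.exp_add, neg_mul]
    ring

/-- The term with the largest exponent decides the sign near +∞. -/
lemma exists_gt_mul_pos_of_dominant {f : ℝ → ℝ} {a c : ℝ} {l : List (ℝ × ℝ)} (hc : 0 < c)
    (h : ∀ q ∈ l, q.2 < a) (hf : ∀ v, f v = c * Real.exp (a * v) + expSum l v) (z : ℝ) :
    ∃ v, z < v ∧ 0 < f v := by
  have h1 := (tendsto_exp_neg_mul_expSum_atTop h).const_add c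
  rw [add_zero] at h1
  obtain ⟨v, hv, hv'⟩ := ((h1.eventually_const_lt hc).and (eventually_gt_atTop z)).exists
  refine ⟨v, hv', ?_⟩
  rw [← mul_pos_iff_of_pos_left (Real.exp_pos (-a * v))]
  refine hv.trans_eq ?_
  rw [hf, mul_add, mul_left_comm, ← Real.exp_add]
  simp

lemma exists_lt_mul_pos_of_dominant {f : ℝ → ℝ} {a c : ℝ} {l : List (ℝ × ℝ)} (hc : 0 < c)
    (h : ∀ q ∈ l, a < q.2) (hf : ∀ v, f v = c * Real.exp (a * v) + expSum l v) (z : ℝ) :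
    ∃ v, v < z ∧ 0 < f v := by
  obtain ⟨v, hv, hv'⟩ := exists_gt_mul_pos_of_dominant (f := fun v => f (-v)) (a := -a) (c := c)
    (l := l.map fun q => (q.1, -q.2)) hc
    (fun q hq => by
      obtain ⟨r, hr, rfl⟩ := List.mem_map.1 hq
      exact neg_lt_neg (h r hr))
    (fun v => by
      rw [hf, mul_neg, ← neg_mul]
      congr 1
      simp [expSum, List.map_map, Function.comp_def]) (-z)
  exact ⟨-v, by linarith, hv'⟩

/-- A function that is positive far out on both sides, vanishes at `±z` with derivatives of the
signs `+` and `-`, and has no more than four zeros, is positive between `-z` and `z`. -/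
lemma pos_of_at_most_four_zeros {f f' : ℝ → ℝ} (hf : ∀ v, HasDerivAt f (f' v) v) {z : ℝ}
    (h1 : f (-z) = 0) (h2 : f z = 0) (h3 : 0 < f' (-z)) (h4 : f' z < 0)
    (h5 : ∃ v, v < -z ∧ 0 < f v) (h6 : ∃ v, z < v ∧ 0 < f v)
    (h7 : ∀ v : Fin 5 → ℝ, StrictMono v → ¬ ∀ j, f (v j) = 0) {c : ℝ} (hc1 : -z < c)
    (hc2 : c < z) : 0 < f c := by
  by_contra! hc
  have hcont : Continuous f := continuous_iff_continuousAt.2 fun v => (hf v).continuousAt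
  have s1 := eventually_nhdsWithin_sign_eq_of_deriv_pos (by rw [(hf (-z)).deriv]; exact h3) h1
  have s2 := eventually_nhdsWithin_sign_eq_of_deriv_neg (by rw [(hf z).deriv]; exact h4) h2
  obtain ⟨p, hp, hfp⟩ := h5
  obtain ⟨q, hq, hfq⟩ := h6
  obtain ⟨x1, hx1, hx1a, hx1b⟩ := (((s1.filter_mono nhdsWithin_le_nhds).and
    (Ioo_mem_nhdsLT hp)) : ∀ᶠ x in 𝓝[<] (-z), _).exists
  obtain ⟨x2, hx2, hx2a, hx2b⟩ := (((s1.filter_mono nhdsWithin_le_nhds).and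
    (Ioo_mem_nhdsGT hc1)) : ∀ᶠ x in 𝓝[>] (-z), _).exists
  obtain ⟨x3, hx3, hx3a, hx3b⟩ := (((s2.filter_mono nhdsWithin_le_nhds).and
    (Ioo_mem_nhdsGT hq)) : ∀ᶠ x in 𝓝[>] z, _).exists
  rw [sign_neg (by linarith : x1 - -z < 0), sign_eq_neg_one_iff] at hx1
  rw [sign_pos (by linarith : 0 < x2 - -z), sign_eq_one_iff] at hx2
  rw [sign_neg (by linarith : z - x3 < 0), sign_eq_neg_one_iff] at hx3
  -- The slopes make f negative just outside ±z and positive just right of -z. This gives a zero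
  -- beyond each of ±z, and f(c) ≤ 0 would give one in (-z, c]; with ±z there would be five.
  obtain ⟨y1, hy1, hy1'⟩ := intermediate_value_Icc' hx1a.le hcont.continuousOn
    (Set.mem_Icc.2 ⟨hx1.le, hfp.le⟩)
  obtain ⟨y2, hy2, hy2'⟩ := intermediate_value_Icc' hx2b.le hcont.continuousOn
    (Set.mem_Icc.2 ⟨hc, hx2.le⟩)
  obtain ⟨y3, hy3, hy3'⟩ := intermediate_value_Icc hx3b.le hcont.continuousOn
    (Set.mem_Icc.2 ⟨hx3.le, hfq.le⟩)
  refine h7 ![y1, -z, y2, z, y3] ?_ ?_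
  · rw [Fin.strictMono_iff_lt_succ]
    intro i
    have a1 : y1 < -z := hy1.2.trans_lt hx1b
    have a2 : -z < y2 := hx2a.trans_le hy2.1
    have a3 : y2 < z := hy2.2.trans_lt hc2
    have a4 : z < y3 := hx3a.trans_le hy3.1
    fin_cases i <;> simpa
  · intro j
    fin_cases j <;> simpa

/-- Multiplying by s, the sign of 1-δ, makes the sum positive far out on both sides, rising at -z
and falling at z, so the count of four zeros applies. -/
lemma expSum_radDerivList_pos {s δ z : ℝ} (hs : s = 1 ∨ s = -1) (hδ : 0 < δ) (hδ3 : δ < 3)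
    (hsδ : 0 < s * (1 - δ)) (hz : 0 < z) {c : ℝ} (hc1 : -z < c) (hc2 : c < z) :
    0 < s * expSum (radDerivList δ z) c := by
  have hs0 : s ≠ 0 := by rcases hs with h | h <;> rw [h] <;> norm_num
  have hδ1 : δ ≠ 1 := by rintro rfl; simp at hsδ
  have hss : ∀ v, expSum (turningList s δ) v = s * expSum (turningList 1 δ) v := by
    intro v
    simp only [turningList, expSum_cons, expSum_nil]
    ring
  have hA : radCoeff (-δ) z < 0 := radCoeff_neg_of_neg (by linarith) (by linarith) hz
  have hB : 0 < radCoeff δ z := radCoeff_pos hδ hz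
  have hder : ∀ v, HasDerivAt (fun v => s * expSum (radDerivList δ z) v)
      (s * expSum (expSumStep 0 (radDerivList δ z)) v) v := fun v =>
    ((hasDerivAt_expSum 0 _ v).const_mul s).congr_deriv (by ring)
  have hsh : 0 < Real.sinh (δ * z) := Real.sinh_pos_iff.2 (by positivity)
  refine pos_of_at_most_four_zeros hder ?_ ?_ ?_ ?_ ?_ ?_ ?_ hc1 hc2
  · rw [expSum_radDerivList_neg hδ.ne' hz.ne', mul_zero]
  · rw [expSum_radDerivList hδ.ne' hz.ne', mul_zero]
  · have h := turningList_pos hδ hδ3 hsδ (neg_ne_zero.2 hz.ne')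
    have h' := neg_pos.2 (neg_of_mul_pos_right h (by linarith))
    rw [hss] at h'
    rw [expSum_step_radDerivList_neg hδ.ne' hz.ne']
    have : 0 < Real.exp (-z) * (-(s * expSum (turningList 1 δ) (-z)))
        / (16 * Real.sinh (δ * z) ^ 2) := by positivity
    refine this.trans_eq ?_
    ring
  · have h := pos_of_mul_pos_right (turningList_pos hδ hδ3 hsδ hz.ne') hz.le
    rw [hss] at h
    rw [expSum_step_radDerivList hδ.ne' hz.ne']
    have : 0 < Real.exp z * (s * expSum (turningList 1 δ) z)
        / (16 * Real.sinh (δ * z) ^ 2) := by positivity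
    refine neg_pos.1 (this.trans_eq ?_)
    ring
  -- The smallest exponent dominates on the left for all δ in (0, 3).
  · refine exists_lt_mul_pos_of_dominant (a := (1 - δ) / 2 - 1)
      (c := -radCoeff (-δ) z * (s * (1 - δ) / 2))
      (l := [(s, 1), (s * (Real.sinh z * radCoeffDeriv δ z
        - (3 - δ) / 2 * Real.cosh z * radCoeff δ z), (1 + δ) / 2),
        (s * (Real.sinh z * radCoeffDeriv (-δ) z
        - (3 + δ) / 2 * Real.cosh z * radCoeff (-δ) z), (1 - δ) / 2),
        (-(s * (radCoeff δ z * ((1 + δ) / 2))), (1 + δ) / 2 - 1)]) ?_ ?_ ?_ _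
    · exact mul_pos (neg_pos.2 hA) (by linarith)
    · intro q hq
      simp only [List.mem_cons, List.not_mem_nil, or_false] at hq
      rcases hq with rfl | rfl | rfl | rfl <;> simp only <;> linarith
    · intro v
      simp only [radDerivList, expSum_cons, expSum_nil]
      ring
  -- On the right the largest exponent is 1 when δ < 1, and (1+δ)/2 when δ > 1.
  · rcases hs with rfl | rfl
    · refine exists_gt_mul_pos_of_dominant (a := 1) (c := 1) (l := (radDerivList δ z).tail)
        one_pos ?_ ?_ _
      · intro q hq
        simp only [radDerivList, List.tail_cons, List.mem_cons, List.not_mem_nil, or_false] at hq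
        rcases hq with rfl | rfl | rfl | rfl <;> simp only <;> linarith
      · intro v
        simp only [radDerivList, List.tail_cons, expSum_cons, expSum_nil]
        ring
    · refine exists_gt_mul_pos_of_dominant (a := (1 + δ) / 2)
        (c := -(Real.sinh z * radCoeffDeriv δ z - (3 - δ) / 2 * Real.cosh z * radCoeff δ z))
        (l := [(-1, 1), (-(Real.sinh z * radCoeffDeriv (-δ) z
          - (3 + δ) / 2 * Real.cosh z * radCoeff (-δ) z), (1 - δ) / 2),
          (radCoeff δ z * ((1 + δ) / 2), (1 + δ) / 2 - 1),
          (radCoeff (-δ) z * ((1 - δ) / 2), (1 - δ) / 2 - 1)]) ?_ ?_ ?_ _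
      -- Negativity of the leading coefficient: by the two monotonicities of x coth x, 0 < B' <
      -- (3-δ)/2 · B with B = `radCoeff δ z`, and sinh z < cosh z.
      · have p1 : 0 < δ * z := by positivity
        have p2 : δ * z < (3 + δ) / 2 * z := by nlinarith
        have m1 := strictMonoOn_mulCoth p1 (p1.trans p2) p2
        have m2 := strictAntiOn_mulCoth_sub_id p1 (p1.trans p2) p2
        have e := radCoeffDeriv_eq hδ.ne' (by linarith) hz
        have hC0 : 0 < z * radCoeffDeriv δ z := by rw [e]; exact mul_pos hB (by linarith)
        have hC : z * radCoeffDeriv δ z < z * ((3 - δ) / 2 * radCoeff δ z) := by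
          rw [e]
          simp only at m2
          nlinarith
        have hC0' := pos_of_mul_pos_right hC0 hz.le
        have hC' := lt_of_mul_lt_mul_left hC hz.le
        have := Real.sinh_lt_cosh (x := z)
        have := Real.cosh_pos z
        nlinarith
      · intro q hq
        simp only [List.mem_cons, List.not_mem_nil, or_false] at hq
        rcases hq with rfl | rfl | rfl | rfl <;> simp only <;> linarith
      · intro v
        simp only [radDerivList, expSum_cons, expSum_nil]
        ring
  -- Five zeros would annihilate every coefficient, but that of e^v is 1. The five exponents are
  -- distinct because δ ≠ 1.
  · intro v hv h0
    refine one_ne_zero (α := ℝ) (coeff_eq_zero_of_expSum_zeros 5 (radDerivList δ z) rfl ?_ v hv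
      (fun j => (mul_eq_zero.1 (h0 j)).resolve_left hs0) (1, 1) (by simp [radDerivList]))
    simp only [radDerivList, List.map_cons, List.map_nil, List.nodup_cons, List.mem_cons,
      List.not_mem_nil, or_false, not_or, List.nodup_nil, and_true, not_false_eq_true]
    refine ⟨⟨?_, ?_, ?_, ?_⟩, ⟨?_, ?_, ?_⟩, ⟨?_, ?_⟩, ?_⟩ <;> intro h <;>
      exact hδ1 (by linarith)

/-- The sign of the derivative of `radQuot` in `z`. -/
lemma radQuotDeriv_pos {s δ z y : ℝ} (hs : s = 1 ∨ s = -1) (hδ : δ ≠ 0) (hδ3 : |δ| < 3)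
    (hsδ : 0 < s * (1 - |δ|)) (hz : 0 < z) (hy : y ∈ Set.Ioo (-1 : ℝ) 1) :
    0 < s * radQuotDeriv δ z y := by
  have key : ∀ δ : ℝ, 0 < δ → δ < 3 → 0 < s * (1 - δ) → 0 < s * radQuotDeriv δ z y := by
    intro δ hδ hδ3 hsδ
    have hy' := Set.Ioo_subset_Icc_self hy
    have hsh := Real.sinh_pos_iff.2 hz
    have hx := cosh_add_mul_sinh_pos (z := z) hy'
    have h1 : -z < Real.log (Real.cosh z + y * Real.sinh z) := by
      rw [Real.lt_log_iff_exp_lt hx, ← Real.cosh_sub_sinh]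
      nlinarith [hy.1]
    have h2 : Real.log (Real.cosh z + y * Real.sinh z) < z := by
      rw [Real.log_lt_iff_lt_exp hx, ← Real.cosh_add_sinh]
      nlinarith [hy.2]
    have h := expSum_radDerivList_pos hs hδ hδ3 hsδ hz h1 h2
    rw [← radQuotDeriv_mul hδ.ne' hz hy'] at h
    have hp : 0 < Real.sinh z ^ 3 * (1 - y ^ 2) :=
      mul_pos (by positivity) (by nlinarith [hy.1, hy.2])
    refine pos_of_mul_pos_right (b := s * radQuotDeriv δ z y) (h.trans_eq ?_) hp.le
    ring
  rcases lt_or_gt_of_ne hδ with h | h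
  · rw [abs_of_neg h] at hδ3 hsδ
    rw [← radQuotDeriv_neg]
    exact key _ (neg_pos.2 h) hδ3 hsδ
  · rw [abs_of_pos h] at hδ3 hsδ
    exact key _ h hδ3 hsδ

/-! ### Positivity of the quotient Q up to the turning points. -/

/-- The difference quotient at c is G itself, so continuity of G is enough. It recovers the endpoint
values of Q from the slope of the radicand. -/
lemma hasDerivWithinAt_sub_mul {G : ℝ → ℝ} {s : Set ℝ} {c : ℝ} (hG : ContinuousWithinAt G s c) :
    HasDerivWithinAt (fun y => (y - c) * G y) (G c) s c := by
  rw [hasDerivWithinAt_iff_tendsto_slope]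
  refine (hG.mono Set.sdiff_subset).tendsto.congr' ?_
  filter_upwards [self_mem_nhdsWithin] with y hy
  have : y - c ≠ 0 := sub_ne_zero.2 hy.2
  rw [slope_def_field]
  field_simp
  ring

/-- The exponents and coefficients of `radicand δ z x` as an exponential sum in `log x`. -/
noncomputable def radList (δ z : ℝ) : List (ℝ × ℝ) :=
  [(-(1 / 2), 2), (radCoeff δ z, (1 + δ) / 2), (radCoeff (-δ) z, (1 - δ) / 2)]

lemma expSum_radList (δ z v : ℝ) : expSum (radList δ z) v = radicand δ z (Real.exp v) := by
  have h : ∀ ν : ℝ, Real.exp v ^ ν = Real.exp (ν * v) := fun ν => by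
    rw [← Real.exp_mul, mul_comm]
  have h2 : Real.exp v ^ 2 = Real.exp (2 * v) := by
    rw [← h 2]; norm_num
  simp only [radList, radicand, expSum_cons, expSum_nil, h, h2]
  ring

/-- After division by e^(σv), σ = (1-δ)/2, the constant term drops out of the derivative. The two
terms left change sign exactly once, from + to -, at a point v₀ supplied by Rolle. The divided
function rises from 0 at -z and falls back to 0 at z. -/
lemma radList_signs {δ z : ℝ} (hδ : 0 < δ) (hδ3 : δ < 3) (hz : 0 < z) :
    0 < expSum (expSumStep 0 (radList δ z)) (-z) ∧
    expSum (expSumStep 0 (radList δ z)) z < 0 ∧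
    ∀ v ∈ Set.Ioo (-z) z, 0 < expSum (radList δ z) v := by
  set σ := (1 - δ) / 2 with hσ
  set k : ℝ → ℝ := fun v => Real.exp (-σ * v) * expSum (radList δ z) v with hk
  set D : ℝ → ℝ := expSum (expSumStep σ (radList δ z)) with hD
  have hkd : ∀ v, HasDerivAt k (Real.exp (-σ * v) * D v) v := hasDerivAt_exp_mul_expSum σ _
  have hkc : Continuous k := continuous_iff_continuousAt.2 fun v => (hkd v).continuousAt
  have z1 : expSum (radList δ z) (-z) = 0 := by
    rw [expSum_radList, radicand_exp_neg hδ.ne' hz.ne']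
  have z2 : expSum (radList δ z) z = 0 := by rw [expSum_radList, radicand_exp hδ.ne' hz.ne']
  have k1 : k (-z) = 0 := by simp only [hk, z1, mul_zero]
  have k2 : k z = 0 := by simp only [hk, z2, mul_zero]
  obtain ⟨v₀, hv₀, hv₀'⟩ := exists_hasDerivAt_eq_zero (by linarith : -z < z) hkc.continuousOn
    (k1.trans k2.symm) (fun v _ => hkd v)
  replace hv₀' : D v₀ = 0 := (mul_eq_zero.1 hv₀').resolve_left (Real.exp_pos _).ne'
  have hDe : ∀ v, D v = Real.exp ((1 + δ) / 2 * v)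
      * (radCoeff δ z * δ - (3 + δ) / 4 * Real.exp ((3 - δ) / 2 * v)) := by
    intro v
    have e : Real.exp (2 * v) = Real.exp ((1 + δ) / 2 * v) * Real.exp ((3 - δ) / 2 * v) := by
      rw [← Real.exp_add]; congr 1; ring
    simp only [hD, hσ, radList, expSumStep_cons, expSumStep_nil, expSum_cons, expSum_nil, e]
    ring
  have h0 : radCoeff δ z * δ = (3 + δ) / 4 * Real.exp ((3 - δ) / 2 * v₀) := by
    rw [hDe] at hv₀'
    linarith [(mul_eq_zero.1 hv₀').resolve_left (Real.exp_pos _).ne']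
  have hDpos : ∀ v, v < v₀ → 0 < D v := by
    intro v hv
    rw [hDe, h0, ← mul_sub]
    refine mul_pos (Real.exp_pos _) (mul_pos (by linarith) (sub_pos.2 (Real.exp_lt_exp.2 ?_)))
    exact mul_lt_mul_of_pos_left hv (by linarith)
  have hDneg : ∀ v, v₀ < v → D v < 0 := by
    intro v hv
    rw [hDe, h0, ← mul_sub]
    refine mul_neg_of_pos_of_neg (Real.exp_pos _)
      (mul_neg_of_pos_of_neg (by linarith) (sub_neg.2 (Real.exp_lt_exp.2 ?_)))
    exact mul_lt_mul_of_pos_left hv (by linarith)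
  have hstep : ∀ v, expSum (radList δ z) v = 0 →
      expSum (expSumStep 0 (radList δ z)) v = D v := by
    intro v hv
    have := ((hasDerivAt_expSum 0 (radList δ z) v).unique (hasDerivAt_expSum σ (radList δ z) v))
    rw [hv] at this
    simpa using this
  refine ⟨by rw [hstep _ z1]; exact hDpos _ hv₀.1, by rw [hstep _ z2]; exact hDneg _ hv₀.2,
    fun v hv => ?_⟩
  suffices 0 < k v from pos_of_mul_pos_right this (Real.exp_pos _).le
  rcases le_or_gt v v₀ with h | h
  · have hm : StrictMonoOn k (Set.Iic v₀) := by
      refine strictMonoOn_of_deriv_pos (convex_Iic _) hkc.continuousOn fun x hx => ?_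
      rw [interior_Iic] at hx
      rw [(hkd x).deriv]
      exact mul_pos (Real.exp_pos _) (hDpos x hx)
    rw [← k1]
    exact hm hv₀.1.le h hv.1
  · have hm : StrictAntiOn k (Set.Ici v₀) := by
      refine strictAntiOn_of_deriv_neg (convex_Ici _) hkc.continuousOn fun x hx => ?_
      rw [interior_Ici] at hx
      rw [(hkd x).deriv]
      exact mul_neg_of_pos_of_neg (Real.exp_pos _) (hDneg x hx)
    rw [← k2]
    exact hm h.le hv₀.2.le hv.2

/-- Inside (-1, 1) this is positivity of the radicand. At y = ±1 both sides of `radQuot_mul` are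
differentiated in y, and the nonzero slopes of the radicand at its simple zeros give the value of Q.
-/
lemma radQuot_pos {δ z y : ℝ} (hδ : δ ≠ 0) (hδ3 : |δ| < 3) (hz : 0 < z)
    (hy : y ∈ Set.Icc (-1 : ℝ) 1) : 0 < radQuot δ z y := by
  have key : ∀ δ : ℝ, 0 < δ → δ < 3 → 0 < radQuot δ z y := by
    intro δ hδ hδ3
    obtain ⟨s1, s2, s3⟩ := radList_signs hδ hδ3 hz
    have hsh := Real.sinh_pos_iff.2 hz
    have hcont : ContinuousOn (radQuot δ z) (Set.Icc (-1 : ℝ) 1) :=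
      (continuousOn_radQuot hδ.ne').comp (f := fun y => (z, y)) (by fun_prop)
        fun y hy => ⟨hz, hy⟩
    have heq : ∀ y ∈ Set.Icc (-1 : ℝ) 1, Real.sinh z ^ 2 * (1 - y ^ 2) * radQuot δ z y
        = expSum (radList δ z) (Real.log (Real.cosh z + y * Real.sinh z)) := by
      intro y hy
      rw [radQuot_mul hδ.ne' hz.ne' hy, expSum_radList, Real.exp_log (cosh_add_mul_sinh_pos hy)]
    have hder : ∀ y ∈ Set.Icc (-1 : ℝ) 1, HasDerivWithinAt
        (fun y => Real.sinh z ^ 2 * (1 - y ^ 2) * radQuot δ z y)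
        (expSum (expSumStep 0 (radList δ z)) (Real.log (Real.cosh z + y * Real.sinh z))
          * (Real.sinh z / (Real.cosh z + y * Real.sinh z))) (Set.Icc (-1) 1) y := by
      intro y hy
      have h1 : HasDerivAt (fun y => Real.cosh z + y * Real.sinh z) (Real.sinh z) y := by
        simpa using ((hasDerivAt_id y).mul_const (Real.sinh z)).const_add (Real.cosh z)
      have h2 := (hasDerivAt_expSum 0 (radList δ z) _).comp y
        (h1.log (cosh_add_mul_sinh_pos hy).ne')
      rw [zero_mul, add_zero] at h2
      exact h2.hasDerivWithinAt.congr_of_mem (fun y hy => heq y hy) hy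
    have hu : ∀ y ∈ Set.Icc (-1 : ℝ) 1, UniqueDiffWithinAt ℝ (Set.Icc (-1 : ℝ) 1) y :=
      uniqueDiffOn_Icc (by norm_num)
    have m1 : (-1 : ℝ) ∈ Set.Icc (-1 : ℝ) 1 := by norm_num
    have m2 : (1 : ℝ) ∈ Set.Icc (-1 : ℝ) 1 := by norm_num
    rcases hy.1.eq_or_lt with h | h
    · rw [← h]
      have h1 := hasDerivWithinAt_sub_mul (c := -1) (s := Set.Icc (-1) 1)
        (G := fun y => Real.sinh z ^ 2 * (1 - y) * radQuot δ z y)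
        (ContinuousOn.mul (by fun_prop) hcont _ m1)
      have h2 := (hu _ m1).eq_deriv _ ((hder _ m1).congr_of_mem (fun y _ => by ring) m1) h1
      rw [show Real.cosh z + -1 * Real.sinh z = Real.exp (-z) by
        rw [← Real.cosh_sub_sinh]; ring, Real.log_exp] at h2
      have h3 : 0 < Real.sinh z ^ 2 * (1 - -1) * radQuot δ z (-1) := by
        rw [← h2]
        exact mul_pos s1 (div_pos hsh (Real.exp_pos _))
      exact pos_of_mul_pos_right h3 (by positivity)
    rcases hy.2.eq_or_lt with h' | h'
    · rw [h']
      have h1 := hasDerivWithinAt_sub_mul (c := 1) (s := Set.Icc (-1) 1)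
        (G := fun y => -(Real.sinh z ^ 2 * (1 + y) * radQuot δ z y))
        (ContinuousOn.mul (by fun_prop) hcont _ m2).neg
      have h2 := (hu _ m2).eq_deriv _ ((hder _ m2).congr_of_mem (fun y _ => by ring) m2) h1
      rw [show Real.cosh z + 1 * Real.sinh z = Real.exp z by
        rw [← Real.cosh_add_sinh]; ring, Real.log_exp] at h2
      have h3 : 0 < Real.sinh z ^ 2 * (1 + 1) * radQuot δ z 1 := by
        rw [← neg_neg (Real.sinh z ^ 2 * (1 + 1) * radQuot δ z 1), ← h2, neg_pos]
        exact mul_neg_of_neg_of_pos s2 (div_pos hsh (Real.exp_pos _))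
      exact pos_of_mul_pos_right h3 (by positivity)
    have hx := cosh_add_mul_sinh_pos (z := z) hy
    have h1 : -z < Real.log (Real.cosh z + y * Real.sinh z) := by
      rw [Real.lt_log_iff_exp_lt hx, ← Real.cosh_sub_sinh]
      nlinarith
    have h2 : Real.log (Real.cosh z + y * Real.sinh z) < z := by
      rw [Real.log_lt_iff_lt_exp hx, ← Real.cosh_add_sinh]
      nlinarith
    have h3 := s3 _ ⟨h1, h2⟩
    rw [← heq y hy] at h3
    exact pos_of_mul_pos_right h3 (mul_nonneg (by positivity) (by nlinarith))
  rcases lt_or_gt_of_ne hδ with h | h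
  · rw [abs_of_neg h] at hδ3
    rw [← radQuot_neg]
    exact key _ (neg_pos.2 h) hδ3
  · rw [abs_of_pos h] at hδ3
    exact key _ h hδ3

/-! ### The regularized integrals for the period and the apsidal angle. -/

/-- The integral of `h z (sin φ)` over `[-π / 2, π / 2]`. -/
noncomputable def sinIntegral (h : ℝ → ℝ → ℝ) (z : ℝ) : ℝ :=
  ∫ φ in (-(Real.pi / 2))..(Real.pi / 2), h z (Real.sin φ)

lemma neg_pi_half_le : -(Real.pi / 2) ≤ Real.pi / 2 := by linarith [Real.pi_pos]

lemma sinIntegral_continuousOn {h : ℝ → ℝ → ℝ}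
    (hc : ContinuousOn (fun q : ℝ × ℝ => h q.1 q.2) (Set.Ioi 0 ×ˢ Set.Icc (-1 : ℝ) 1)) :
    ContinuousOn (sinIntegral h) (Set.Ioi 0) :=
  continuousOn_intervalIntegral (f := fun z φ => h z (Real.sin φ)) neg_pi_half_le
    (hc.comp (f := fun q : ℝ × ℝ => (q.1, Real.sin q.2)) (by fun_prop)
      fun q hq => ⟨hq.1, Real.sin_mem_Icc q.2⟩)

lemma hasDerivAt_sinIntegral {h h' : ℝ → ℝ → ℝ}
    (hc : ContinuousOn (fun q : ℝ × ℝ => h q.1 q.2) (Set.Ioi 0 ×ˢ Set.Icc (-1 : ℝ) 1))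
    (hc' : ContinuousOn (fun q : ℝ × ℝ => h' q.1 q.2) (Set.Ioi 0 ×ˢ Set.Icc (-1 : ℝ) 1))
    (hd : ∀ z, 0 < z → ∀ y ∈ Set.Icc (-1 : ℝ) 1, HasDerivAt (fun z => h z y) (h' z y) z)
    {z : ℝ} (hz : 0 < z) : HasDerivAt (sinIntegral h) (sinIntegral h' z) z := by
  refine hasDerivAt_intervalIntegral (f := fun z φ => h z (Real.sin φ))
    (f' := fun z φ => h' z (Real.sin φ)) isOpen_Ioi neg_pi_half_le (fun x hx => ?_) ?_
    (fun x hx φ _ => hd x hx _ (Real.sin_mem_Icc φ)) hz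
  · exact hc.comp (f := fun φ => (x, Real.sin φ)) (by fun_prop)
      fun φ _ => ⟨hx, Real.sin_mem_Icc φ⟩
  · exact hc'.comp (f := fun q : ℝ × ℝ => (q.1, Real.sin q.2)) (by fun_prop)
      fun q hq => ⟨hq.1, Real.sin_mem_Icc q.2⟩

lemma sinIntegral_pos {h : ℝ → ℝ → ℝ} {z : ℝ} (hz : 0 < z)
    (hc : ContinuousOn (fun q : ℝ × ℝ => h q.1 q.2) (Set.Ioi 0 ×ˢ Set.Icc (-1 : ℝ) 1))
    (hpos : ∀ y ∈ Set.Ioo (-1 : ℝ) 1, 0 < h z y) : 0 < sinIntegral h z := by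
  refine intervalIntegral.intervalIntegral_pos_of_pos_on ?_ (fun φ hφ => ?_)
    (by linarith [Real.pi_pos])
  · exact (hc.comp (f := fun φ => (z, Real.sin φ)) (by fun_prop)
      fun φ _ => ⟨hz, Real.sin_mem_Icc φ⟩).intervalIntegrable
  · have h1 := Real.strictMonoOn_sin (Set.left_mem_Icc.2 neg_pi_half_le)
      (Set.Ioo_subset_Icc_self hφ) hφ.1
    have h2 := Real.strictMonoOn_sin (Set.Ioo_subset_Icc_self hφ)
      (Set.right_mem_Icc.2 neg_pi_half_le) hφ.2
    rw [Real.sin_neg, Real.sin_pi_div_two] at h1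
    rw [Real.sin_pi_div_two] at h2
    exact hpos _ ⟨h1, h2⟩

/-- The integrand of the apsidal angle, up to a constant. -/
noncomputable def angleIntegrand (δ z y : ℝ) : ℝ := (√(radQuot δ z y))⁻¹

/-- The derivative of `angleIntegrand δ z y` in `z`. -/
noncomputable def angleIntegrandDeriv (δ z y : ℝ) : ℝ :=
  -(radQuotDeriv δ z y / (2 * √(radQuot δ z y))) / √(radQuot δ z y) ^ 2

/-- The integrand of the radial period, up to a factor that does not depend on `y`. -/
noncomputable def timeIntegrand (δ z y : ℝ) : ℝ :=
  (Real.cosh z + y * Real.sinh z) ^ (-((3 + δ) / 2)) * angleIntegrand δ z y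

/-- The derivative of `timeIntegrand δ z y` in `z`. -/
noncomputable def timeIntegrandDeriv (δ z y : ℝ) : ℝ :=
  (Real.sinh z + y * Real.cosh z) * (-((3 + δ) / 2))
      * (Real.cosh z + y * Real.sinh z) ^ (-((3 + δ) / 2) - 1) * angleIntegrand δ z y
    + (Real.cosh z + y * Real.sinh z) ^ (-((3 + δ) / 2)) * angleIntegrandDeriv δ z y

lemma continuousOn_angleIntegrand {δ : ℝ} (hδ : δ ≠ 0) (hδ3 : |δ| < 3) :
    ContinuousOn (fun q : ℝ × ℝ => angleIntegrand δ q.1 q.2)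
      (Set.Ioi 0 ×ˢ Set.Icc (-1 : ℝ) 1) :=
  (continuousOn_radQuot hδ).sqrt.inv₀ fun _ hq =>
    (Real.sqrt_pos.2 (radQuot_pos hδ hδ3 hq.1 hq.2)).ne'

lemma continuousOn_angleIntegrandDeriv {δ : ℝ} (hδ : δ ≠ 0) (hδ3 : |δ| < 3) :
    ContinuousOn (fun q : ℝ × ℝ => angleIntegrandDeriv δ q.1 q.2)
      (Set.Ioi 0 ×ˢ Set.Icc (-1 : ℝ) 1) := by
  have h := fun q (hq : q ∈ Set.Ioi (0 : ℝ) ×ˢ Set.Icc (-1 : ℝ) 1) =>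
    (Real.sqrt_pos.2 (radQuot_pos hδ hδ3 hq.1 hq.2)).ne'
  exact ((continuousOn_radQuotDeriv hδ).div (continuousOn_const.mul (continuousOn_radQuot hδ).sqrt)
    fun q hq => mul_ne_zero two_ne_zero (h q hq)).neg.div ((continuousOn_radQuot hδ).sqrt.pow 2)
    fun q hq => pow_ne_zero 2 (h q hq)

lemma hasDerivAt_angleIntegrand {δ z y : ℝ} (hδ : δ ≠ 0) (hδ3 : |δ| < 3) (hz : 0 < z)
    (hy : y ∈ Set.Icc (-1 : ℝ) 1) :
    HasDerivAt (fun z => angleIntegrand δ z y) (angleIntegrandDeriv δ z y) z := by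
  have h := radQuot_pos hδ hδ3 hz hy
  exact ((hasDerivAt_radQuot hδ hz.ne' hy).sqrt h.ne').inv (Real.sqrt_pos.2 h).ne'

lemma continuousOn_rpow_cosh_add (ν : ℝ) :
    ContinuousOn (fun q : ℝ × ℝ => (Real.cosh q.1 + q.2 * Real.sinh q.1) ^ ν)
      (Set.Ioi 0 ×ˢ Set.Icc (-1 : ℝ) 1) :=
  ContinuousOn.rpow_const (by fun_prop) fun _ hq => Or.inl (cosh_add_mul_sinh_pos hq.2).ne'

lemma continuousOn_timeIntegrand {δ : ℝ} (hδ : δ ≠ 0) (hδ3 : |δ| < 3) :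
    ContinuousOn (fun q : ℝ × ℝ => timeIntegrand δ q.1 q.2)
      (Set.Ioi 0 ×ˢ Set.Icc (-1 : ℝ) 1) :=
  (continuousOn_rpow_cosh_add _).mul (continuousOn_angleIntegrand hδ hδ3)

lemma continuousOn_timeIntegrandDeriv {δ : ℝ} (hδ : δ ≠ 0) (hδ3 : |δ| < 3) :
    ContinuousOn (fun q : ℝ × ℝ => timeIntegrandDeriv δ q.1 q.2)
      (Set.Ioi 0 ×ˢ Set.Icc (-1 : ℝ) 1) := by
  refine ContinuousOn.add (ContinuousOn.mul (ContinuousOn.mul ?_ (continuousOn_rpow_cosh_add _))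
    (continuousOn_angleIntegrand hδ hδ3))
    ((continuousOn_rpow_cosh_add _).mul (continuousOn_angleIntegrandDeriv hδ hδ3))
  exact Continuous.continuousOn (by fun_prop)

lemma hasDerivAt_timeIntegrand {δ z y : ℝ} (hδ : δ ≠ 0) (hδ3 : |δ| < 3) (hz : 0 < z)
    (hy : y ∈ Set.Icc (-1 : ℝ) 1) :
    HasDerivAt (fun z => timeIntegrand δ z y) (timeIntegrandDeriv δ z y) z :=
  (((Real.hasDerivAt_cosh z).add ((Real.hasDerivAt_sinh z).const_mul y)).rpow_const
    (Or.inl (cosh_add_mul_sinh_pos hy).ne')).mul (hasDerivAt_angleIntegrand hδ hδ3 hz hy)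

lemma sinIntegral_angleIntegrand_pos {δ z : ℝ} (hδ : δ ≠ 0) (hδ3 : |δ| < 3) (hz : 0 < z) :
    0 < sinIntegral (angleIntegrand δ) z :=
  sinIntegral_pos hz (continuousOn_angleIntegrand hδ hδ3) fun _ hy =>
    inv_pos.2 (Real.sqrt_pos.2 (radQuot_pos hδ hδ3 hz (Set.Ioo_subset_Icc_self hy)))

lemma sinIntegral_timeIntegrand_pos {δ z : ℝ} (hδ : δ ≠ 0) (hδ3 : |δ| < 3) (hz : 0 < z) :
    0 < sinIntegral (timeIntegrand δ) z :=
  sinIntegral_pos hz (continuousOn_timeIntegrand hδ hδ3) fun _ hy =>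
    mul_pos (Real.rpow_pos_of_pos (cosh_add_mul_sinh_pos (Set.Ioo_subset_Icc_self hy)) _)
    (inv_pos.2 (Real.sqrt_pos.2 (radQuot_pos hδ hδ3 hz (Set.Ioo_subset_Icc_self hy))))

/-- The sign of the derivative of the apsidal angle in the orbit parameter. -/
lemma sinIntegral_angleIntegrandDeriv_neg {s δ z : ℝ} (hs : s = 1 ∨ s = -1) (hδ : δ ≠ 0)
    (hδ3 : |δ| < 3) (hsδ : 0 < s * (1 - |δ|)) (hz : 0 < z) :
    s * sinIntegral (angleIntegrandDeriv δ) z < 0 := by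
  have h := sinIntegral_pos (h := fun z y => -s * angleIntegrandDeriv δ z y) hz
    (continuousOn_const.mul (continuousOn_angleIntegrandDeriv hδ hδ3)) fun y hy => ?_
  · have e : sinIntegral (fun z y => -s * angleIntegrandDeriv δ z y) z
        = -s * sinIntegral (angleIntegrandDeriv δ) z := by
      simp only [sinIntegral, intervalIntegral.integral_const_mul]
    rw [e] at h
    linarith
  · have h1 := radQuotDeriv_pos hs hδ hδ3 hsδ hz hy
    have h2 := Real.sqrt_pos.2 (radQuot_pos hδ hδ3 hz (Set.Ioo_subset_Icc_self hy))
    have h3 : 0 < s * radQuotDeriv δ z y / (2 * √(radQuot δ z y)) / √(radQuot δ z y) ^ 2 := by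
      positivity
    refine h3.trans_eq ?_
    rw [angleIntegrandDeriv]
    ring

/-! ### The parameter δ, the length scale and the energy as functions of z. -/

/-- The parameter `δ` that belongs to the exponent `α`. -/
noncomputable def angleParam (α : ℝ) : ℝ := 3 * α / (4 - α)

lemma angleParam_ne_zero {α : ℝ} (hα : α < 2) (hα0 : α ≠ 0) : angleParam α ≠ 0 :=
  div_ne_zero (mul_ne_zero three_ne_zero hα0) (by linarith)

lemma abs_angleParam_lt {α : ℝ} (hα : α < 2) : |angleParam α| < 3 := by
  have h : 0 < 4 - α := by linarith
  rw [angleParam, abs_lt, lt_div_iff₀ h, div_lt_iff₀ h]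
  constructor <;> linarith

lemma angleParam_pos_iff {α : ℝ} (hα : α < 2) : 0 < angleParam α ↔ 0 < α := by
  have h : 0 < 4 - α := by linarith
  rw [angleParam, div_pos_iff_of_pos_right h]
  simp

/-- The bounds δ = 1 and δ = -1 are the Kepler potential and the harmonic oscillator, where Θ is
constant. -/
lemma abs_angleParam_lt_one_iff {α : ℝ} (hα : α < 2) :
    |angleParam α| < 1 ↔ -2 < α ∧ α < 1 := by
  have h : 0 < 4 - α := by linarith
  rw [angleParam, abs_lt, lt_div_iff₀ h, div_lt_iff₀ h]
  constructor <;> rintro ⟨h1, h2⟩ <;> constructor <;> linarith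

lemma one_lt_abs_angleParam_iff {α : ℝ} (hα : α < 2) :
    1 < |angleParam α| ↔ α < -2 ∨ 1 < α := by
  have h : 0 < 4 - α := by linarith
  rw [angleParam, lt_abs, ← neg_div, lt_div_iff₀ h, lt_div_iff₀ h]
  constructor <;> rintro (h | h)
  · right; linarith
  · left; linarith
  · right; linarith
  · left; linarith

lemma mul_radCoeff_pos {α z : ℝ} (hα : α < 2) (hα0 : α ≠ 0) (hz : 0 < z) :
    0 < α * radCoeff (angleParam α) z := by
  have h3 := abs_lt.1 (abs_angleParam_lt hα)
  rcases lt_or_gt_of_ne hα0 with h | h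
  · have : angleParam α < 0 := lt_of_le_of_ne (not_lt.1 fun h' =>
      absurd ((angleParam_pos_iff hα).1 h') (by linarith)) (angleParam_ne_zero hα hα0)
    exact mul_pos_of_neg_of_neg h (radCoeff_neg_of_neg this h3.1 hz)
  · exact mul_pos h (radCoeff_pos ((angleParam_pos_iff hα).2 h) hz)

/-- The square of the length scale of the orbits with the orbit parameter `z` and `L = 1`. -/
noncomputable def sqScale (α κ z : ℝ) : ℝ :=
  (α * radCoeff (angleParam α) z / κ) ^ (2 / (2 - α))

/-- The energy of the orbits with the orbit parameter `z` and `L = 1`. -/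
noncomputable def orbitEnergy (α κ z : ℝ) : ℝ := radCoeff (-angleParam α) z / sqScale α κ z

/-- The derivative of `sqScale α κ z` in `z`. -/
noncomputable def sqScaleDeriv (α κ z : ℝ) : ℝ :=
  α * radCoeffDeriv (angleParam α) z / κ * (2 / (2 - α)) *
    (α * radCoeff (angleParam α) z / κ) ^ (2 / (2 - α) - 1)

/-- The derivative of `orbitEnergy α κ z` in `z`. -/
noncomputable def orbitEnergyDeriv (α κ z : ℝ) : ℝ :=
  (radCoeffDeriv (-angleParam α) z * sqScale α κ z
    - radCoeff (-angleParam α) z * sqScaleDeriv α κ z) / sqScale α κ z ^ 2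

lemma sqScale_pos {α κ z : ℝ} (hα : α < 2) (hα0 : α ≠ 0) (hκ : 0 < κ) (hz : 0 < z) :
    0 < sqScale α κ z :=
  Real.rpow_pos_of_pos (div_pos (mul_radCoeff_pos hα hα0 hz) hκ) _

lemma hasDerivAt_sqScale {α κ z : ℝ} (hα : α < 2) (hα0 : α ≠ 0) (hκ : 0 < κ) (hz : 0 < z) :
    HasDerivAt (sqScale α κ) (sqScaleDeriv α κ z) z :=
  (((hasDerivAt_radCoeff (angleParam_ne_zero hα hα0) hz.ne').const_mul α).div_const κ).rpow_const
    (Or.inl (div_pos (mul_radCoeff_pos hα hα0 hz) hκ).ne')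

lemma hasDerivAt_orbitEnergy {α κ z : ℝ} (hα : α < 2) (hα0 : α ≠ 0) (hκ : 0 < κ) (hz : 0 < z) :
    HasDerivAt (orbitEnergy α κ) (orbitEnergyDeriv α κ z) z :=
  (hasDerivAt_radCoeff (neg_ne_zero.2 (angleParam_ne_zero hα hα0)) hz.ne').div
    (hasDerivAt_sqScale hα hα0 hκ hz) (sqScale_pos hα hα0 hκ hz).ne'

lemma continuousOn_sqScaleDeriv {α κ : ℝ} (hα : α < 2) (hα0 : α ≠ 0) (hκ : 0 < κ) :
    ContinuousOn (sqScaleDeriv α κ) (Set.Ioi 0) := by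
  have hδ := angleParam_ne_zero hα hα0
  exact (((continuousOn_const.mul (continuousOn_radCoeffDeriv hδ)).div_const κ).mul
    continuousOn_const).mul (ContinuousOn.rpow_const
    ((continuousOn_const.mul (continuousOn_radCoeff hδ)).div_const κ)
    fun z hz => Or.inl (div_pos (mul_radCoeff_pos hα hα0 hz) hκ).ne')

lemma continuousOn_sqScale {α κ : ℝ} (hα : α < 2) (hα0 : α ≠ 0) (hκ : 0 < κ) :
    ContinuousOn (sqScale α κ) (Set.Ioi 0) :=
  fun _ hz => (hasDerivAt_sqScale hα hα0 hκ hz).continuousAt.continuousWithinAt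

lemma continuousOn_orbitEnergyDeriv {α κ : ℝ} (hα : α < 2) (hα0 : α ≠ 0) (hκ : 0 < κ) :
    ContinuousOn (orbitEnergyDeriv α κ) (Set.Ioi 0) := by
  have hδ := neg_ne_zero.2 (angleParam_ne_zero hα hα0)
  have hs := continuousOn_sqScale hα hα0 hκ
  exact (((continuousOn_radCoeffDeriv hδ).mul hs).sub ((continuousOn_radCoeff hδ).mul
    (continuousOn_sqScaleDeriv hα hα0 hκ))).div (hs.pow 2)
    fun z hz => pow_ne_zero 2 (sqScale_pos hα hα0 hκ hz).ne'

/-- Write m(x) = x coth x and 2/(2-α) = (3+δ)/(3-δ). Logarithmic differentiation reduces the sign to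
that of `radCoeff (-δ) z`, which is opposite to δ, times (3-δ)(m((3-δ)z/2) - m(δz)) -
(3+δ)(m((3+δ)z/2) - m(δz)). Monotonicity of m on (0, ∞) and evenness give the bracket the same sign.
-/
lemma orbitEnergyDeriv_pos {α κ z : ℝ} (hα : α < 2) (hα0 : α ≠ 0) (hκ : 0 < κ) (hz : 0 < z) :
    0 < orbitEnergyDeriv α κ z := by
  have hδ := angleParam_ne_zero hα hα0
  obtain ⟨h3, h3'⟩ := abs_lt.1 (abs_angleParam_lt hα)
  have hc := sqScale_pos hα hα0 hκ hz
  have hC := radCoeff_ne_zero hδ h3 hz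
  have hr := mul_radCoeff_pos hα hα0 hz
  have e1 : sqScaleDeriv α κ z = 2 / (2 - α) * (radCoeffDeriv (angleParam α) z
      / radCoeff (angleParam α) z) * sqScale α κ z := by
    rw [sqScaleDeriv, sqScale, Real.rpow_sub_one (div_pos hr hκ).ne']
    field_simp
  have e2 : 2 / (2 - α) = (3 + angleParam α) / (3 - angleParam α) := by
    have : 4 - α ≠ 0 := by linarith
    have : 2 - α ≠ 0 := by linarith
    have h4 : 3 - angleParam α ≠ 0 := by linarith
    rw [div_eq_div_iff this h4, angleParam]
    field_simp
    ring
  have e3 : orbitEnergyDeriv α κ z = (radCoeffDeriv (-angleParam α) z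
      - radCoeff (-angleParam α) z * (2 / (2 - α) * (radCoeffDeriv (angleParam α) z
      / radCoeff (angleParam α) z))) / sqScale α κ z := by
    rw [orbitEnergyDeriv, e1]
    field_simp
  rw [e3, e2]
  refine div_pos ?_ hc
  generalize angleParam α = δ at *
  have d1 := radCoeffDeriv_eq hδ h3 hz
  have d2 := radCoeffDeriv_eq (δ := -δ) (neg_ne_zero.2 hδ) (by linarith) hz
  rw [neg_mul δ z, mulCoth_neg, ← sub_eq_add_neg] at d2
  have hm : 0 < 3 - δ := by linarith
  have hn : 0 < 3 + δ := by linarith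
  have d1' : radCoeffDeriv δ z / radCoeff δ z
      = (mulCoth ((3 + δ) / 2 * z) - mulCoth (δ * z)) / z := by
    rw [div_eq_div_iff hC hz.ne']
    linarith
  have d2' : radCoeffDeriv (-δ) z
      = radCoeff (-δ) z * (mulCoth ((3 - δ) / 2 * z) - mulCoth (δ * z)) / z := by
    rw [eq_div_iff hz.ne']
    linarith
  rw [d1', d2']
  have e : radCoeff (-δ) z * (mulCoth ((3 - δ) / 2 * z) - mulCoth (δ * z)) / z
      - radCoeff (-δ) z * ((3 + δ) / (3 - δ) *
        ((mulCoth ((3 + δ) / 2 * z) - mulCoth (δ * z)) / z))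
      = radCoeff (-δ) z * ((3 - δ) * (mulCoth ((3 - δ) / 2 * z) - mulCoth (δ * z))
        - (3 + δ) * (mulCoth ((3 + δ) / 2 * z) - mulCoth (δ * z))) / ((3 - δ) * z) := by
    field_simp
  rw [e]
  refine div_pos ?_ (by positivity)
  have p1 : (3 - δ) / 2 * z ∈ Set.Ioi (0 : ℝ) := Set.mem_Ioi.2 (by positivity)
  have p2 : (3 + δ) / 2 * z ∈ Set.Ioi (0 : ℝ) := Set.mem_Ioi.2 (by positivity)
  have p3 : |δ * z| ∈ Set.Ioi (0 : ℝ) := abs_pos.2 (mul_ne_zero hδ hz.ne')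
  rw [← mulCoth_abs (δ * z)]
  rw [abs_mul, abs_of_pos hz] at *
  rcases lt_or_gt_of_ne hδ with h | h
  · rw [abs_of_neg h] at *
    have q1 := strictMonoOn_mulCoth p3 p1 (by nlinarith)
    have q2 := strictMonoOn_mulCoth p2 p1 (by nlinarith)
    refine mul_pos (radCoeff_pos (neg_pos.2 h) hz) ?_
    nlinarith
  · rw [abs_of_pos h] at *
    have q1 := strictMonoOn_mulCoth p3 p2 (by nlinarith)
    have q2 := strictMonoOn_mulCoth p1 p2 (by nlinarith)
    refine mul_pos_of_neg_of_neg (radCoeff_neg_of_neg (neg_neg_iff_pos.2 h) (by linarith) hz) ?_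
    nlinarith

/-! ### The effective potential, its level sets and the domain. -/

lemma homPotential_eq (α κ : ℝ) {r : ℝ} (hr : 0 < r) :
    homPotential α κ r = κ / α * r ^ (-α) := by
  rw [homPotential, Real.rpow_neg hr.le]
  field_simp

lemma contDiffOn_homPotential {α : ℝ} (κ : ℝ) (n : WithTop ℕ∞) :
    ContDiffOn ℝ n (homPotential α κ) (Set.Ioi 0) := by
  refine ContDiffOn.congr (f := fun r => κ / α * r ^ (-α)) ?_ fun r hr => homPotential_eq α κ hr
  exact contDiffOn_const.mul (contDiffOn_id.rpow_const_of_ne fun r hr => ne_of_gt hr)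

lemma hasDerivAt_effPotential {α κ : ℝ} (hα0 : α ≠ 0) (L : ℝ) {r : ℝ} (hr : 0 < r) :
    HasDerivAt (effPotential (homPotential α κ) L)
      ((κ * r ^ (2 - α) - L ^ 2) / r ^ 3) r := by
  have h1 : HasDerivAt (fun r : ℝ => L ^ 2 / (2 * r ^ 2)) (-(L ^ 2 / r ^ 3)) r := by
    refine ((hasDerivAt_const r (L ^ 2)).div (((hasDerivAt_id r).pow 2).const_mul 2)
      (by simp; positivity)).congr_deriv ?_
    simp only [id, Pi.pow_apply]
    field_simp
    push_cast
    ring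
  have h2 : HasDerivAt (fun r : ℝ => κ / α * r ^ (-α)) (κ / α * (-α * r ^ (-α - 1))) r :=
    (Real.hasDerivAt_rpow_const (Or.inl hr.ne')).const_mul _
  have h3 : HasDerivAt (homPotential α κ) (κ / α * (-α * r ^ (-α - 1))) r :=
    h2.congr_of_eventuallyEq (by
      filter_upwards [eventually_gt_nhds hr] with x hx using homPotential_eq α κ hx)
  refine (h1.sub h3).congr_deriv ?_
  have e : r ^ (2 - α) = r ^ (-α - 1) * r ^ 3 := by
    rw [← Real.rpow_natCast r 3, ← Real.rpow_add hr]
    congr 1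
    push_cast
    ring
  rw [e]
  field_simp
  ring

lemma homRadius_pos (α : ℝ) {κ L : ℝ} (hκ : 0 < κ) (hL : 0 < L) : 0 < homRadius α κ L :=
  Real.rpow_pos_of_pos (by positivity) _

lemma homRadius_rpow {α κ L : ℝ} (hα : α < 2) (hκ : 0 < κ) :
    homRadius α κ L ^ (2 - α) = L ^ 2 / κ := by
  rw [homRadius, ← Real.rpow_mul (by positivity), one_div_mul_cancel (by linarith), Real.rpow_one]

lemma deriv_effPotential_neg {α κ L r : ℝ} (hα : α < 2) (hα0 : α ≠ 0) (hκ : 0 < κ)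
    (hr : r ∈ Set.Ioo 0 (homRadius α κ L)) :
    deriv (effPotential (homPotential α κ) L) r < 0 := by
  rw [(hasDerivAt_effPotential hα0 L hr.1).deriv]
  have h := Real.rpow_lt_rpow hr.1.le hr.2 (by linarith : 0 < 2 - α)
  rw [homRadius_rpow hα hκ, lt_div_iff₀ hκ] at h
  exact div_neg_of_neg_of_pos (by linarith) (pow_pos hr.1 3)

lemma deriv_effPotential_pos {α κ L r : ℝ} (hα : α < 2) (hα0 : α ≠ 0) (hκ : 0 < κ) (hL : 0 < L)
    (hr : r ∈ Set.Ioi (homRadius α κ L)) :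
    0 < deriv (effPotential (homPotential α κ) L) r := by
  have h0 := homRadius_pos α hκ hL
  have hr0 : 0 < r := h0.trans hr
  rw [(hasDerivAt_effPotential hα0 L hr0).deriv]
  have h := Real.rpow_lt_rpow h0.le hr (by linarith : 0 < 2 - α)
  rw [homRadius_rpow hα hκ, div_lt_iff₀ hκ] at h
  exact div_pos (by linarith) (pow_pos hr0 3)

lemma strictAntiOn_effPotential {α κ L : ℝ} (hα : α < 2) (hα0 : α ≠ 0) (hκ : 0 < κ) :
    StrictAntiOn (effPotential (homPotential α κ) L) (Set.Ioc 0 (homRadius α κ L)) := by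
  refine strictAntiOn_of_deriv_neg (convex_Ioc _ _) (fun r hr =>
    (hasDerivAt_effPotential hα0 L hr.1).continuousAt.continuousWithinAt) fun r hr => ?_
  rw [interior_Ioc] at hr
  exact deriv_effPotential_neg hα hα0 hκ hr

lemma strictMonoOn_effPotential {α κ L : ℝ} (hα : α < 2) (hα0 : α ≠ 0) (hκ : 0 < κ)
    (hL : 0 < L) :
    StrictMonoOn (effPotential (homPotential α κ) L) (Set.Ici (homRadius α κ L)) := by
  refine strictMonoOn_of_deriv_pos (convex_Ici _) (fun r hr => (hasDerivAt_effPotential hα0 L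
    ((homRadius_pos α hκ hL).trans_le hr)).continuousAt.continuousWithinAt) fun r hr => ?_
  rw [interior_Ici] at hr
  exact deriv_effPotential_pos hα hα0 hκ hL hr

/-- Two radii at the same level of the effective potential are the apsidal radii. -/
lemma apsidalRadii_eq_pair {α κ H L r₁ r₂ : ℝ} (hα : α < 2) (hα0 : α ≠ 0) (hκ : 0 < κ)
    (hL : 0 < L) (h1 : r₁ ∈ apsidalRadii (homPotential α κ) H L)
    (h2 : r₂ ∈ apsidalRadii (homPotential α κ) H L) (h12 : r₁ < r₂) :
    apsidalRadii (homPotential α κ) H L = {r₁, r₂} ∧ rMinus (homPotential α κ) H L = r₁ ∧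
      rPlus (homPotential α κ) H L = r₂ ∧ r₁ < homRadius α κ L ∧ homRadius α κ L < r₂ := by
  have ha := strictAntiOn_effPotential (L := L) hα hα0 hκ
  have hm := strictMonoOn_effPotential hα hα0 hκ hL
  have hl : r₁ < homRadius α κ L := by
    by_contra! h
    have := hm h (h.trans h12.le) h12
    rw [h1.2, h2.2] at this
    exact this.false
  have hr : homRadius α κ L < r₂ := by
    by_contra! h
    have := ha ⟨h1.1, h12.le.trans h⟩ ⟨h2.1, h⟩ h12
    rw [h1.2, h2.2] at this
    exact this.false
  have e : apsidalRadii (homPotential α κ) H L = {r₁, r₂} := by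
    ext r
    simp only [Set.mem_insert_iff, Set.mem_singleton_iff]
    constructor
    · intro h
      rcases le_or_gt r (homRadius α κ L) with h' | h'
      · exact Or.inl (ha.injOn ⟨h.1, h'⟩ ⟨h1.1, hl.le⟩ (h.2.trans h1.2.symm))
      · exact Or.inr (hm.injOn (Set.mem_Ici.2 h'.le) (Set.mem_Ici.2 hr.le)
          (h.2.trans h2.2.symm))
    · rintro (rfl | rfl) <;> assumption
  refine ⟨e, ?_, ?_, hl, hr⟩
  · rw [rMinus, e, csInf_pair, min_eq_left h12.le]
  · rw [rPlus, e, csSup_pair, max_eq_right h12.le]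

lemma effPotential_homRadius {α κ L : ℝ} (hα : α < 2) (hα0 : α ≠ 0) (hκ : 0 < κ) (hL : 0 < L) :
    effPotential (homPotential α κ) L (homRadius α κ L)
      = -((2 - α) / (2 * α) * κ ^ (2 / (2 - α)) * L ^ (-(2 * α / (2 - α)))) := by
  have h0 := homRadius_pos α hκ hL
  have hk : 2 - α ≠ 0 := by linarith
  have h1 : homRadius α κ L ^ (-α) = L ^ 2 / κ / homRadius α κ L ^ 2 := by
    rw [eq_div_iff (by positivity), ← homRadius_rpow hα hκ, ← Real.rpow_natCast _ 2,
      ← Real.rpow_add h0]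
    congr 1
    push_cast
    ring
  have h2 : L ^ 2 / homRadius α κ L ^ 2 = κ ^ (2 / (2 - α)) * L ^ (-(2 * α / (2 - α))) := by
    have e1 : homRadius α κ L ^ 2 = (L ^ 2) ^ (2 / (2 - α)) / κ ^ (2 / (2 - α)) := by
      rw [homRadius, ← Real.rpow_natCast _ 2, ← Real.rpow_mul (by positivity),
        ← Real.div_rpow (by positivity) hκ.le]
      congr 1
      push_cast
      ring
    have e2 : L ^ (-(2 * α / (2 - α))) = L ^ 2 / (L ^ 2) ^ (2 / (2 - α)) := by
      rw [← Real.rpow_natCast L 2, ← Real.rpow_mul hL.le, ← Real.rpow_sub hL]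
      congr 1
      push_cast
      field_simp
      ring
    rw [e1, e2]
    field_simp
  rw [effPotential, homPotential_eq α κ h0, h1, mul_assoc _ (κ ^ _), ← h2]
  field_simp
  ring

lemma isOpen_homDomain {α κ : ℝ} (hα : α < 2) (hα0 : α ≠ 0) (hκ : 0 < κ) :
    IsOpen (homDomain α κ) := by
  have hU : IsOpen {p : ℝ × ℝ | 0 < p.2} := isOpen_lt continuous_const continuous_snd
  have hc : ContinuousOn (fun p : ℝ × ℝ => p.1 - -((2 - α) / (2 * α) * κ ^ (2 / (2 - α))
      * p.2 ^ (-(2 * α / (2 - α))))) {p : ℝ × ℝ | 0 < p.2} := by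
    refine continuousOn_fst.sub (ContinuousOn.neg (continuousOn_const.mul ?_))
    exact ContinuousOn.rpow_const continuousOn_snd fun p hp => Or.inl (ne_of_gt hp)
  have h1 := hc.isOpen_inter_preimage hU isOpen_Ioi (t := Set.Ioi 0)
  have h2 : IsOpen {p : ℝ × ℝ | 0 < α → p.1 < 0} := by
    by_cases h : 0 < α
    · simpa only [h, true_imp_iff] using isOpen_lt continuous_fst continuous_const
    · simp [h]
  convert h1.inter h2 using 1
  ext p
  simp only [homDomain, Set.mem_ofPred_eq, Set.mem_inter_iff, Set.mem_preimage, Set.mem_Ioi,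
    sub_pos, and_assoc]
  refine and_congr_right fun hp => ?_
  rw [effPotential_homRadius hα hα0 hκ hp]

lemma homDomain_nonempty {α κ : ℝ} (hα : α < 2) (hα0 : α ≠ 0) (hκ : 0 < κ) :
    (homDomain α κ).Nonempty := by
  set w := effPotential (homPotential α κ) 1 (homRadius α κ 1) with hw
  rcases lt_or_gt_of_ne hα0 with h | h
  · exact ⟨(w + 1, 1), one_pos, lt_add_one w, fun h' => absurd h' (by linarith)⟩
  · have hw0 : w < 0 := by
      rw [hw, effPotential_homRadius hα hα0 hκ one_pos, neg_lt_zero]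
      have : 0 < 2 - α := by linarith
      positivity
    exact ⟨(w / 2, 1), one_pos, by simp only [← hw]; linarith, fun _ => by simp only; linarith⟩

/-- Since α < 2, r² (W - H) extends continuously to r = 0 with value L²/2 > 0. -/
lemma exists_near_zero_lt_effPotential {α κ : ℝ} (hα : α < 2) {L : ℝ} (H : ℝ)
    (hL : 0 < L) {r₀ : ℝ} (hr₀ : 0 < r₀) :
    ∃ r, 0 < r ∧ r < r₀ ∧ H < effPotential (homPotential α κ) L r := by
  have h1 : Tendsto (fun r : ℝ => L ^ 2 / 2 - κ / α * r ^ (2 - α) - H * r ^ 2) (𝓝[>] 0)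
      (𝓝 (L ^ 2 / 2 - κ / α * 0 ^ (2 - α) - H * 0 ^ 2)) := by
    refine Tendsto.mono_left (Continuous.tendsto ?_ 0) nhdsWithin_le_nhds
    have : Continuous fun r : ℝ => r ^ (2 - α) :=
      Real.continuous_rpow_const (by linarith)
    fun_prop
  rw [Real.zero_rpow (by linarith)] at h1
  have h2 : 0 < L ^ 2 / 2 - κ / α * 0 - H * 0 ^ 2 := by
    rw [mul_zero, zero_pow two_ne_zero, mul_zero, sub_zero, sub_zero]
    positivity
  obtain ⟨r, hr, hr1, hr2⟩ := ((h1.eventually_const_lt h2).and (Ioo_mem_nhdsGT hr₀)).exists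
  refine ⟨r, hr1, hr2, ?_⟩
  have e : L ^ 2 / 2 - κ / α * r ^ (2 - α) - H * r ^ 2
      = (effPotential (homPotential α κ) L r - H) * r ^ 2 := by
    rw [effPotential, homPotential_eq α κ hr1, show 2 - α = -α + (2 : ℕ) by push_cast; ring,
      Real.rpow_add hr1, Real.rpow_natCast]
    field_simp
  rw [e] at hr
  exact sub_pos.1 (pos_of_mul_pos_left hr (by positivity))

lemma exists_far_lt_effPotential {α κ : ℝ} (hα0 : α ≠ 0) (hκ : 0 < κ) (L : ℝ) {H : ℝ}
    (hH : 0 < α → H < 0) {r₀ : ℝ} (hr₀ : 0 < r₀) :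
    ∃ r, r₀ < r ∧ H < effPotential (homPotential α κ) L r := by
  rcases lt_or_gt_of_ne hα0 with h | h
  · have h1 : Tendsto (fun r : ℝ => -(κ / α) * r ^ (-α)) atTop atTop :=
      (tendsto_rpow_atTop (neg_pos.2 h)).const_mul_atTop
        (neg_pos.2 (div_neg_of_pos_of_neg hκ h))
    obtain ⟨r, hr1, hr2⟩ := ((h1.eventually_gt_atTop H).and (eventually_gt_atTop r₀)).exists
    refine ⟨r, hr2, ?_⟩
    rw [effPotential, homPotential_eq α κ (hr₀.trans hr2)]
    have : 0 ≤ L ^ 2 / (2 * r ^ 2) := by positivity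
    linarith
  · have h1 : Tendsto (fun r : ℝ => -(κ / α * r ^ (-α))) atTop (𝓝 (-(κ / α * 0))) :=
      ((tendsto_rpow_neg_atTop h).const_mul _).neg
    rw [mul_zero, neg_zero] at h1
    obtain ⟨r, hr1, hr2⟩ := ((h1.eventually_const_lt (hH h)).and
      (eventually_gt_atTop r₀)).exists
    refine ⟨r, hr2, ?_⟩
    rw [effPotential, homPotential_eq α κ (hr₀.trans hr2)]
    have : 0 ≤ L ^ 2 / (2 * r ^ 2) := by positivity
    linarith

lemma exists_apsidalRadii {α κ H L : ℝ} (hα : α < 2) (hα0 : α ≠ 0) (hκ : 0 < κ)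
    (h : (H, L) ∈ homDomain α κ) : ∃ r₁ r₂, r₁ < r₂ ∧
      r₁ ∈ apsidalRadii (homPotential α κ) H L ∧ r₂ ∈ apsidalRadii (homPotential α κ) H L := by
  obtain ⟨hL, hH, hH0⟩ := h
  simp only at hL hH hH0
  have h0 := homRadius_pos α hκ hL
  obtain ⟨a, ha0, ha, haH⟩ := exists_near_zero_lt_effPotential (κ := κ) hα H hL h0
  obtain ⟨b, hb, hbH⟩ := exists_far_lt_effPotential hα0 hκ L hH0 h0
  have hc : ContinuousOn (effPotential (homPotential α κ) L) (Set.Ioi 0) := fun r hr =>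
    (hasDerivAt_effPotential hα0 L hr).continuousAt.continuousWithinAt
  obtain ⟨r₁, h1, h1'⟩ := intermediate_value_Icc' ha.le
    (hc.mono fun r hr => ha0.trans_le hr.1) ⟨hH.le, haH.le⟩
  obtain ⟨r₂, h2, h2'⟩ := intermediate_value_Icc hb.le
    (hc.mono fun r hr => h0.trans_le hr.1) ⟨hH.le, hbH.le⟩
  refine ⟨r₁, r₂, lt_of_le_of_ne (h1.2.trans h2.1) ?_, ⟨ha0.trans_le h1.1, h1'⟩,
    ⟨h0.trans_le h2.1, h2'⟩⟩
  rintro rfl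
  rw [← le_antisymm h1.2 h2.1] at hH
  exact hH.ne h1'

lemma mem_homDomain_of_apsidalRadii {α κ H L r₁ r₂ : ℝ} (hα : α < 2) (hα0 : α ≠ 0) (hκ : 0 < κ)
    (hL : 0 < L) (h12 : r₁ < r₂) (h1 : r₁ ∈ apsidalRadii (homPotential α κ) H L)
    (h2 : r₂ ∈ apsidalRadii (homPotential α κ) H L) : (H, L) ∈ homDomain α κ := by
  obtain ⟨-, -, -, hl, hr⟩ := apsidalRadii_eq_pair hα hα0 hκ hL h1 h2 h12
  have hm := strictMonoOn_effPotential hα hα0 hκ hL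
  refine ⟨hL, ?_, fun h => ?_⟩
  · have := hm (Set.mem_Ici.2 le_rfl) (Set.mem_Ici.2 hr.le) hr
    rwa [h2.2] at this
  · simp only
    -- For α > 0: r₂ > r₀ gives L² < κ r₂^(2-α), so the centrifugal term is below κ r₂^(-α)/2, which
    -- is less than V(r₂) because α < 2.
    rw [← h2.2, effPotential, homPotential_eq α κ h2.1, sub_neg]
    have h3 := Real.rpow_lt_rpow (homRadius_pos α hκ hL).le hr (by linarith : 0 < 2 - α)
    rw [homRadius_rpow hα hκ, div_lt_iff₀ hκ] at h3
    have e : r₂ ^ (2 - α) = r₂ ^ (-α) * r₂ ^ 2 := by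
      rw [← Real.rpow_natCast r₂ 2, ← Real.rpow_add h2.1]
      congr 1
      push_cast
      ring
    have hr2 := h2.1
    rw [e] at h3
    rw [div_mul_eq_mul_div, div_lt_div_iff₀ (by positivity) h]
    have : 0 < L ^ 2 := by positivity
    nlinarith

lemma mem_homDomain_iff {α κ : ℝ} (hα : α < 2) (hα0 : α ≠ 0) (hκ : 0 < κ) (H L : ℝ) :
    (H, L) ∈ homDomain α κ ↔ 0 < L ∧ (apsidalRadii (homPotential α κ) H L).encard = 2 := by
  constructor
  · intro h
    obtain ⟨r₁, r₂, h12, h1, h2⟩ := exists_apsidalRadii hα hα0 hκ h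
    refine ⟨h.1, ?_⟩
    rw [(apsidalRadii_eq_pair hα hα0 hκ h.1 h1 h2 h12).1, Set.encard_pair h12.ne]
  · rintro ⟨hL, h⟩
    obtain ⟨x, y, hxy, e⟩ := Set.encard_eq_two.1 h
    have hx : x ∈ apsidalRadii (homPotential α κ) H L := by rw [e]; simp
    have hy : y ∈ apsidalRadii (homPotential α κ) H L := by rw [e]; simp
    rcases lt_or_gt_of_ne hxy with h | h
    · exact mem_homDomain_of_apsidalRadii hα hα0 hκ hL h hx hy
    · exact mem_homDomain_of_apsidalRadii hα hα0 hκ hL h hy hx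

/-! ### The substitution r = c x^(-p). -/

/-- The radius at the angle `φ` of the parametrization of an orbit by `x = cosh z + sin φ sinh z`,
where the radius is `c * x ^ (-p)`. -/
noncomputable def orbitRadius (p c z φ : ℝ) : ℝ :=
  c * (Real.cosh z + Real.sin φ * Real.sinh z) ^ (-p)

lemma hasDerivAt_orbitRadius (p c z φ : ℝ) : HasDerivAt (orbitRadius p c z)
    (-(c * (p * (Real.cos φ * Real.sinh z) *
      (Real.cosh z + Real.sin φ * Real.sinh z) ^ (-p - 1)))) φ := by
  have h1 : HasDerivAt (fun φ => Real.cosh z + Real.sin φ * Real.sinh z)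
      (Real.cos φ * Real.sinh z) φ :=
    ((Real.hasDerivAt_sin φ).mul_const _).const_add _
  refine ((h1.rpow_const (Or.inl (cosh_add_mul_sinh_pos (Real.sin_mem_Icc φ)).ne')).const_mul
    c).congr_deriv ?_
  ring

section ChangeOfVariables

variable {p c z : ℝ}

lemma strictAntiOn_orbitRadius (hp : 0 < p) (hc : 0 < c) (hz : 0 < z) :
    StrictAntiOn (orbitRadius p c z) (Set.Icc (-(Real.pi / 2)) (Real.pi / 2)) := by
  intro φ hφ ψ hψ h
  have h1 := Real.strictMonoOn_sin hφ hψ h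
  have h2 := Real.sinh_pos_iff.2 hz
  refine mul_lt_mul_of_pos_left (Real.rpow_lt_rpow_of_neg
    (cosh_add_mul_sinh_pos (Real.sin_mem_Icc φ)) ?_ (neg_lt_zero.2 hp)) hc
  nlinarith

lemma orbitRadius_neg_pi_half : orbitRadius p c z (-(Real.pi / 2)) = c * Real.exp (p * z) := by
  rw [orbitRadius, Real.sin_neg, Real.sin_pi_div_two, neg_one_mul, ← sub_eq_add_neg,
    Real.cosh_sub_sinh, ← Real.exp_mul]
  congr 2
  ring

lemma orbitRadius_pi_half : orbitRadius p c z (Real.pi / 2) = c * Real.exp (-(p * z)) := by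
  rw [orbitRadius, Real.sin_pi_div_two, one_mul, Real.cosh_add_sinh, ← Real.exp_mul]
  congr 2
  ring

lemma image_orbitRadius (hp : 0 < p) (hc : 0 < c) (hz : 0 < z) :
    orbitRadius p c z '' Set.Ioo (-(Real.pi / 2)) (Real.pi / 2)
      = Set.Ioo (c * Real.exp (-(p * z))) (c * Real.exp (p * z)) := by
  have ha := strictAntiOn_orbitRadius hp hc hz
  rw [← orbitRadius_neg_pi_half, ← orbitRadius_pi_half]
  refine Set.Subset.antisymm ?_ (intermediate_value_Ioo' neg_pi_half_le fun φ _ =>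
    (hasDerivAt_orbitRadius p c z φ).continuousAt.continuousWithinAt)
  rintro _ ⟨φ, hφ, rfl⟩
  exact ⟨ha (Set.Ioo_subset_Icc_self hφ) (Set.right_mem_Icc.2 neg_pi_half_le) hφ.2,
    ha (Set.left_mem_Icc.2 neg_pi_half_le) (Set.Ioo_subset_Icc_self hφ) hφ.1⟩

open MeasureTheory in
/-- The substitution of `orbitRadius` in an integral between the apsidal radii. -/
lemma integral_orbitRadius (hp : 0 < p) (hc : 0 < c) (hz : 0 < z) {G : ℝ → ℝ} {K : ℝ}
    {h : ℝ → ℝ → ℝ}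
    (hh : ContinuousOn (fun q : ℝ × ℝ => h q.1 q.2) (Set.Ioi 0 ×ˢ Set.Icc (-1 : ℝ) 1))
    (hG : ∀ φ ∈ Set.Ioo (-(Real.pi / 2)) (Real.pi / 2),
      c * (p * (Real.cos φ * Real.sinh z) *
        (Real.cosh z + Real.sin φ * Real.sinh z) ^ (-p - 1)) * G (orbitRadius p c z φ)
        = K * h z (Real.sin φ)) :
    IntervalIntegrable G volume (c * Real.exp (-(p * z))) (c * Real.exp (p * z)) ∧
    ∫ r in (c * Real.exp (-(p * z)))..(c * Real.exp (p * z)), G r = K * sinIntegral h z := by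
  have hle : c * Real.exp (-(p * z)) ≤ c * Real.exp (p * z) := by
    refine mul_le_mul_of_nonneg_left (Real.exp_le_exp.2 ?_) hc.le
    have : 0 < p * z := mul_pos hp hz
    linarith
  set S := Set.Ioo (-(Real.pi / 2)) (Real.pi / 2) with hS
  set R' : ℝ → ℝ := fun φ => -(c * (p * (Real.cos φ * Real.sinh z) *
      (Real.cosh z + Real.sin φ * Real.sinh z) ^ (-p - 1))) with hR'
  have hd : ∀ φ ∈ S, HasDerivWithinAt (orbitRadius p c z) (R' φ) S φ := fun φ _ =>
    (hasDerivAt_orbitRadius p c z φ).hasDerivWithinAt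
  have hinj : Set.InjOn (orbitRadius p c z) S :=
    (strictAntiOn_orbitRadius hp hc hz).injOn.mono Set.Ioo_subset_Icc_self
  have heq : Set.EqOn (fun φ => |R' φ| • G (orbitRadius p c z φ))
      (fun φ => K * h z (Real.sin φ)) S := by
    intro φ hφ
    have h1 : 0 < c * (p * (Real.cos φ * Real.sinh z) *
        (Real.cosh z + Real.sin φ * Real.sinh z) ^ (-p - 1)) := by
      have h1 := Real.cos_pos_of_mem_Ioo hφ
      have h2 := Real.sinh_pos_iff.2 hz
      have h3 := Real.rpow_pos_of_pos (cosh_add_mul_sinh_pos (z := z) (Real.sin_mem_Icc φ))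
        (-p - 1)
      positivity
    simp only [hR', abs_neg, abs_of_pos h1, smul_eq_mul]
    exact hG φ hφ
  have hcont : ContinuousOn (fun φ => K * h z (Real.sin φ))
      (Set.uIcc (-(Real.pi / 2)) (Real.pi / 2)) :=
    continuousOn_const.mul (hh.comp (f := fun φ => (z, Real.sin φ)) (by fun_prop)
      fun φ _ => ⟨hz, Real.sin_mem_Icc φ⟩)
  constructor
  -- The integrand may be singular at the apsidal radii. Change of variables on the open interval
  -- carries integrability back from a continuous function of φ.
  · rw [intervalIntegrable_iff_integrableOn_Ioo_of_le hle, ← image_orbitRadius hp hc hz,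
      integrableOn_image_iff_integrableOn_abs_deriv_smul measurableSet_Ioo hd hinj,
      integrableOn_congr_fun heq measurableSet_Ioo,
      ← intervalIntegrable_iff_integrableOn_Ioo_of_le neg_pi_half_le]
    exact hcont.intervalIntegrable
  · rw [intervalIntegral.integral_of_le hle, integral_Ioc_eq_integral_Ioo,
      ← image_orbitRadius hp hc hz,
      integral_image_eq_integral_abs_deriv_smul measurableSet_Ioo hd hinj,
      setIntegral_congr_fun measurableSet_Ioo heq, ← integral_Ioc_eq_integral_Ioo,
      ← intervalIntegral.integral_of_le neg_pi_half_le, intervalIntegral.integral_const_mul,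
      sinIntegral]

end ChangeOfVariables

/-! ### Orbits: parameters, integrals and scaling. -/

/-- The orbit with the energy `H`, the angular momentum `L`, the orbit parameter `z` and the
length scale `c`. -/
structure OrbitData (α κ H L z c : ℝ) : Prop where
  L_pos : 0 < L
  z_pos : 0 < z
  c_pos : 0 < c
  scale_eq : κ * c ^ (2 - α) = α * L ^ 2 * radCoeff (angleParam α) z
  energy_eq : H * c ^ 2 = L ^ 2 * radCoeff (-angleParam α) z

/-- The exponent of the substitution `r = c * x ^ (-p)`. -/
noncomputable def radExponent (α : ℝ) : ℝ := 3 / (4 - α)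

lemma radExponent_pos {α : ℝ} (hα : α < 2) : 0 < radExponent α :=
  div_pos three_pos (by linarith)

lemma radExponent_mul {α : ℝ} : radExponent α * α = angleParam α := by
  rw [radExponent, angleParam]
  ring

lemma radExponent_eq {α : ℝ} (hα : α < 2) : radExponent α = (3 + angleParam α) / 4 := by
  have : 4 - α ≠ 0 := by linarith
  rw [radExponent, angleParam]
  field_simp
  ring

/-- With x^(2p-2) factored out, the centrifugal, potential and energy terms carry the exponents 2,
2-2p+pα and 2-2p. The choice of p makes the last two (1±δ)/2. -/
lemma sub_effPotential_rpow {α κ H L c a b : ℝ} (hα : α < 2) (hα0 : α ≠ 0) (hc : 0 < c)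
    (h1 : κ * c ^ (2 - α) = α * L ^ 2 * b) (h2 : H * c ^ 2 = L ^ 2 * a) {x : ℝ} (hx : 0 < x) :
    H - effPotential (homPotential α κ) L (c * x ^ (-radExponent α))
      = (L / c) ^ 2 * (x ^ (radExponent α - 1)) ^ 2 * (-x ^ 2 / 2
        + b * x ^ ((1 + angleParam α) / 2) + a * x ^ ((1 - angleParam α) / 2)) := by
  have hr : 0 < c * x ^ (-radExponent α) := mul_pos hc (Real.rpow_pos_of_pos hx _)
  set p := radExponent α with hp
  set X := x ^ p with hX
  have hX0 : 0 < X := Real.rpow_pos_of_pos hx _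
  have e1 : x ^ (-p) = X⁻¹ := Real.rpow_neg hx.le p
  have e2 : (c * X⁻¹) ^ (-α) = c ^ (-α) * x ^ angleParam α := by
    rw [Real.mul_rpow hc.le (inv_nonneg.2 hX0.le), ← e1, ← Real.rpow_mul hx.le,
      ← radExponent_mul, neg_mul_neg]
  have e3 : c ^ (2 - α) = c ^ (-α) * c ^ 2 := by
    rw [← Real.rpow_natCast c 2, ← Real.rpow_add hc]
    congr 1
    push_cast
    ring
  have e4 : x ^ (p - 1) = X / x := Real.rpow_sub_one hx.ne' p
  have hp' := radExponent_eq hα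
  rw [← hp] at hp'
  have e5 : x ^ ((1 - angleParam α) / 2) = x ^ 2 / X ^ 2 := by
    rw [hX, ← Real.rpow_natCast (x ^ p) 2, ← Real.rpow_mul hx.le, ← Real.rpow_natCast x 2,
      ← Real.rpow_sub hx, hp']
    congr 1
    push_cast
    ring
  have e6 : x ^ ((1 + angleParam α) / 2) = x ^ angleParam α * (x ^ 2 / X ^ 2) := by
    rw [← e5, ← Real.rpow_add hx]
    congr 1
    ring
  rw [e3] at h1
  rw [e1] at hr ⊢
  rw [effPotential, homPotential_eq α κ hr, e2, e4, e5, e6]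
  have hH : H = L ^ 2 * a / c ^ 2 := by
    rw [eq_div_iff (by positivity), h2]
  have hκ : κ / α * c ^ (-α) = L ^ 2 * b / c ^ 2 := by
    rw [div_mul_eq_mul_div, div_eq_div_iff hα0 (by positivity)]
    linarith
  rw [← mul_assoc (κ / α), hκ, hH]
  field_simp
  ring

/-- Every pair in the domain has an orbit. -/
lemma exists_orbitData {α κ H L : ℝ} (hα : α < 2) (hα0 : α ≠ 0) (hκ : 0 < κ)
    (h : (H, L) ∈ homDomain α κ) : ∃ z c, OrbitData α κ H L z c := by
  obtain ⟨r₁, r₂, h12, ⟨hr1, hW1⟩, ⟨hr2, hW2⟩⟩ := exists_apsidalRadii hα hα0 hκ h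
  have hL : 0 < L := h.1
  have hp := radExponent_pos hα
  have hδ := angleParam_ne_zero hα hα0
  set p := radExponent α with hp_def
  -- The geometric mean of the radii; z is then fixed by r₂/r₁ = e^(2pz).
  set c := Real.exp ((Real.log r₁ + Real.log r₂) / 2) with hc
  set z := (Real.log r₂ - Real.log r₁) / (2 * p) with hz_def
  have hc0 : 0 < c := Real.exp_pos _
  have hz : 0 < z := div_pos (sub_pos.2 (Real.log_lt_log hr1 h12)) (by positivity)
  have hpz : p * z = (Real.log r₂ - Real.log r₁) / 2 := by
    rw [hz_def]
    field_simp
  have e1 : r₁ = c * Real.exp z ^ (-p) := by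
    rw [← Real.exp_mul, hc, ← Real.exp_add, mul_neg, mul_comm z, hpz,
      ← Real.exp_log hr1, Real.log_exp]
    congr 1
    ring
  have e2 : r₂ = c * Real.exp (-z) ^ (-p) := by
    rw [← Real.exp_mul, hc, ← Real.exp_add, neg_mul_neg, mul_comm z, hpz,
      ← Real.exp_log hr2, Real.log_exp]
    congr 1
    ring
  set a := H * c ^ 2 / L ^ 2 with ha
  set b := κ * c ^ (2 - α) / (α * L ^ 2) with hb
  have h1 : κ * c ^ (2 - α) = α * L ^ 2 * b := by rw [hb]; field_simp
  have h2 : H * c ^ 2 = L ^ 2 * a := by rw [ha]; field_simp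
  have key : ∀ x : ℝ, 0 < x → effPotential (homPotential α κ) L (c * x ^ (-p)) = H →
      -x ^ 2 / 2 + b * x ^ ((1 + angleParam α) / 2) + a * x ^ ((1 - angleParam α) / 2) = 0 := by
    intro x hx hW
    have h3 := sub_effPotential_rpow hα hα0 hc0 h1 h2 hx
    rw [← hp_def, hW, sub_self] at h3
    have hX := Real.rpow_pos_of_pos hx (p - 1)
    exact (mul_eq_zero.1 h3.symm).resolve_left (by positivity)
  have k1 := key _ (Real.exp_pos z) (by rw [← e1]; exact hW1)
  have k2 := key _ (Real.exp_pos (-z)) (by rw [← e2]; exact hW2)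
  have m1 := radicand_exp hδ hz.ne'
  have m2 := radicand_exp_neg hδ hz.ne'
  rw [radicand] at m1 m2
  have hs : ∀ x : ℝ, 0 < x → x ^ ((1 + angleParam α) / 2)
      = x ^ ((1 - angleParam α) / 2) * x ^ angleParam α := by
    intro x hx
    rw [← Real.rpow_add hx]
    congr 1
    ring
  -- Comparison with `radicand` gives two homogeneous linear equations for the coefficient
  -- differences. They have only the zero solution, since e^(δz) ≠ e^(-δz).
  have n1 : (a - radCoeff (-angleParam α) z)
      + (b - radCoeff (angleParam α) z) * Real.exp z ^ angleParam α = 0 := by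
    have hX := Real.rpow_pos_of_pos (Real.exp_pos z) ((1 - angleParam α) / 2)
    rw [hs _ (Real.exp_pos z)] at k1 m1
    refine (mul_eq_zero.1 (?_ : Real.exp z ^ ((1 - angleParam α) / 2) * _ = 0)).resolve_left hX.ne'
    linear_combination k1 - m1
  have n2 : (a - radCoeff (-angleParam α) z)
      + (b - radCoeff (angleParam α) z) * Real.exp (-z) ^ angleParam α = 0 := by
    have hX := Real.rpow_pos_of_pos (Real.exp_pos (-z)) ((1 - angleParam α) / 2)
    rw [hs _ (Real.exp_pos (-z))] at k2 m2
    refine (mul_eq_zero.1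
      (?_ : Real.exp (-z) ^ ((1 - angleParam α) / 2) * _ = 0)).resolve_left hX.ne'
    linear_combination k2 - m2
  have hne : Real.exp z ^ angleParam α - Real.exp (-z) ^ angleParam α ≠ 0 := by
    rw [← Real.exp_mul, ← Real.exp_mul, sub_ne_zero, Real.exp_injective.ne_iff, neg_mul]
    have : z * angleParam α ≠ 0 := mul_ne_zero hz.ne' hδ
    contrapose! this
    linarith
  have hb' : b - radCoeff (angleParam α) z = 0 := by
    refine (mul_eq_zero.1 (?_ : _ * (Real.exp z ^ angleParam α
      - Real.exp (-z) ^ angleParam α) = 0)).resolve_right hne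
    linear_combination n1 - n2
  rw [hb', zero_mul, add_zero] at n1
  refine ⟨z, c, hL, hz, hc0, ?_, ?_⟩
  · rw [h1, sub_eq_zero.1 hb']
  · rw [h2, sub_eq_zero.1 n1]

namespace OrbitData

lemma sub_effPotential {α κ H L z c : ℝ} (hα : α < 2) (hα0 : α ≠ 0)
    (d : OrbitData α κ H L z c) {x : ℝ} (hx : 0 < x) :
    H - effPotential (homPotential α κ) L (c * x ^ (-radExponent α))
      = (L / c) ^ 2 * (x ^ (radExponent α - 1)) ^ 2 * radicand (angleParam α) z x :=
  sub_effPotential_rpow hα hα0 d.c_pos d.scale_eq d.energy_eq hx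

lemma mem_apsidalRadii {α κ H L z c : ℝ} (hα : α < 2) (hα0 : α ≠ 0) (d : OrbitData α κ H L z c) :
    c * Real.exp (-(radExponent α * z)) ∈ apsidalRadii (homPotential α κ) H L ∧
    c * Real.exp (radExponent α * z) ∈ apsidalRadii (homPotential α κ) H L := by
  have hδ := angleParam_ne_zero hα hα0
  have hz := d.z_pos.ne'
  have h1 : ∀ v, radicand (angleParam α) z (Real.exp v) = 0 →
      c * Real.exp (-(radExponent α * v)) ∈ apsidalRadii (homPotential α κ) H L := by
    intro v hv
    refine ⟨mul_pos d.c_pos (Real.exp_pos _), ?_⟩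
    have := d.sub_effPotential hα hα0 (Real.exp_pos v)
    rw [hv, mul_zero, ← Real.exp_mul, mul_neg, mul_comm v] at this
    linarith
  refine ⟨h1 z (radicand_exp hδ hz), ?_⟩
  have := h1 (-z) (radicand_exp_neg hδ hz)
  rwa [mul_neg, neg_neg] at this

lemma exp_lt {α κ H L z c : ℝ} (hα : α < 2) (d : OrbitData α κ H L z c) :
    c * Real.exp (-(radExponent α * z)) < c * Real.exp (radExponent α * z) := by
  refine mul_lt_mul_of_pos_left (Real.exp_lt_exp.2 ?_) d.c_pos
  have := mul_pos (radExponent_pos hα) d.z_pos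
  linarith

lemma sqrt_sub_effPotential {α κ H L z c φ : ℝ} (hα : α < 2) (hα0 : α ≠ 0)
    (d : OrbitData α κ H L z c) (hφ : φ ∈ Set.Ioo (-(Real.pi / 2)) (Real.pi / 2)) :
    √(H - effPotential (homPotential α κ) L (orbitRadius (radExponent α) c z φ))
      = L / c * (Real.cosh z + Real.sin φ * Real.sinh z) ^ (radExponent α - 1)
        * (Real.sinh z * Real.cos φ) * √(radQuot (angleParam α) z (Real.sin φ)) := by
  have hδ := angleParam_ne_zero hα hα0
  have hx := cosh_add_mul_sinh_pos (z := z) (Real.sin_mem_Icc φ)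
  have hL := d.L_pos
  have hc := d.c_pos
  have hs := Real.sinh_pos_iff.2 d.z_pos
  have hcos := Real.cos_pos_of_mem_Ioo hφ
  have hX := Real.rpow_pos_of_pos hx (radExponent α - 1)
  have h0 := radQuot_pos hδ (abs_angleParam_lt hα) d.z_pos (Real.sin_mem_Icc φ)
  rw [orbitRadius, d.sub_effPotential hα hα0 hx, ← radQuot_mul hδ d.z_pos.ne' (Real.sin_mem_Icc φ),
    ← Real.cos_sq' φ]
  rw [Real.sqrt_eq_iff_mul_self_eq (by positivity) (by positivity)]
  linear_combination -(L / c * (Real.cosh z + Real.sin φ * Real.sinh z) ^ (radExponent α - 1)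
    * (Real.sinh z * Real.cos φ)) ^ 2 * Real.mul_self_sqrt h0.le

/-- All powers of x and of c coming from dr, r² and the square root cancel, so the apsidal angle
depends on z alone. -/
lemma angle_integral {α κ H L z c : ℝ} (hα : α < 2) (hα0 : α ≠ 0) (d : OrbitData α κ H L z c) :
    IntervalIntegrable (fun r => 1 / (r ^ 2 * √(H - effPotential (homPotential α κ) L r)))
      MeasureTheory.volume (c * Real.exp (-(radExponent α * z)))
      (c * Real.exp (radExponent α * z)) ∧
    ∫ r in (c * Real.exp (-(radExponent α * z)))..(c * Real.exp (radExponent α * z)),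
      1 / (r ^ 2 * √(H - effPotential (homPotential α κ) L r))
      = radExponent α / L * sinIntegral (angleIntegrand (angleParam α)) z := by
  have hδ := angleParam_ne_zero hα hα0
  refine integral_orbitRadius (radExponent_pos hα) d.c_pos d.z_pos
    (continuousOn_angleIntegrand hδ (abs_angleParam_lt hα)) fun φ hφ => ?_
  rw [d.sqrt_sub_effPotential hα hα0 hφ, orbitRadius, angleIntegrand]
  have hx := cosh_add_mul_sinh_pos (z := z) (Real.sin_mem_Icc φ)
  have hL := d.L_pos
  have hc := d.c_pos
  have hs := Real.sinh_pos_iff.2 d.z_pos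
  have hcos := Real.cos_pos_of_mem_Ioo hφ
  have h0 := Real.sqrt_pos.2
    (radQuot_pos hδ (abs_angleParam_lt hα) d.z_pos (Real.sin_mem_Icc φ))
  generalize Real.cosh z + Real.sin φ * Real.sinh z = x at *
  rw [Real.rpow_sub_one hx.ne', Real.rpow_sub_one hx.ne', Real.rpow_neg hx.le]
  have hX := Real.rpow_pos_of_pos hx (radExponent α)
  field_simp

/-- Compared with the angle, a factor r² = c² x^(-2p) is left over, and 2p = (3+δ)/2. -/
lemma time_integral {α κ H L z c : ℝ} (hα : α < 2) (hα0 : α ≠ 0) (d : OrbitData α κ H L z c) :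
    IntervalIntegrable (fun r => 1 / √(H - effPotential (homPotential α κ) L r))
      MeasureTheory.volume (c * Real.exp (-(radExponent α * z)))
      (c * Real.exp (radExponent α * z)) ∧
    ∫ r in (c * Real.exp (-(radExponent α * z)))..(c * Real.exp (radExponent α * z)),
      1 / √(H - effPotential (homPotential α κ) L r)
      = radExponent α * c ^ 2 / L * sinIntegral (timeIntegrand (angleParam α)) z := by
  have hδ := angleParam_ne_zero hα hα0
  refine integral_orbitRadius (radExponent_pos hα) d.c_pos d.z_pos
    (continuousOn_timeIntegrand hδ (abs_angleParam_lt hα)) fun φ hφ => ?_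
  rw [d.sqrt_sub_effPotential hα hα0 hφ, timeIntegrand, angleIntegrand]
  have hx := cosh_add_mul_sinh_pos (z := z) (Real.sin_mem_Icc φ)
  have hL := d.L_pos
  have hc := d.c_pos
  have hs := Real.sinh_pos_iff.2 d.z_pos
  have hcos := Real.cos_pos_of_mem_Ioo hφ
  have h0 := Real.sqrt_pos.2
    (radQuot_pos hδ (abs_angleParam_lt hα) d.z_pos (Real.sin_mem_Icc φ))
  generalize Real.cosh z + Real.sin φ * Real.sinh z = x at *
  have hX := Real.rpow_pos_of_pos hx (radExponent α)
  have e : x ^ (-((3 + angleParam α) / 2)) = (x ^ radExponent α)⁻¹ ^ 2 := by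
    rw [← Real.rpow_neg hx.le, ← Real.rpow_natCast, ← Real.rpow_mul hx.le, radExponent_eq hα]
    congr 1
    push_cast
    ring
  rw [Real.rpow_sub_one hx.ne', Real.rpow_sub_one hx.ne', Real.rpow_neg hx.le, e]
  field_simp

/-- The apsidal radii of an orbit, its radial period and its apsidal angle. -/
lemma apsidal {α κ H L z c : ℝ} (hα : α < 2) (hα0 : α ≠ 0) (hκ : 0 < κ)
    (d : OrbitData α κ H L z c) :
    rMinus (homPotential α κ) H L = c * Real.exp (-(radExponent α * z)) ∧
    rPlus (homPotential α κ) H L = c * Real.exp (radExponent α * z) ∧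
    radialPeriod (homPotential α κ) H L = √2 * (radExponent α * c ^ 2 / L
      * sinIntegral (timeIntegrand (angleParam α)) z) ∧
    apsidalAngle (homPotential α κ) H L
      = √2 * radExponent α * sinIntegral (angleIntegrand (angleParam α)) z := by
  obtain ⟨h1, h2⟩ := d.mem_apsidalRadii hα hα0
  obtain ⟨-, h3, h4, -, -⟩ := apsidalRadii_eq_pair hα hα0 hκ d.L_pos h1 h2 (d.exp_lt hα)
  refine ⟨h3, h4, ?_, ?_⟩
  · rw [radialPeriod, h3, h4, (d.time_integral hα hα0).2]
  · rw [apsidalAngle, h3, h4, (d.angle_integral hα hα0).2]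
    have := d.L_pos.ne'
    field_simp

lemma mem_homDomain {α κ H L z c : ℝ} (hα : α < 2) (hα0 : α ≠ 0) (hκ : 0 < κ)
    (d : OrbitData α κ H L z c) : (H, L) ∈ homDomain α κ := by
  obtain ⟨h1, h2⟩ := d.mem_apsidalRadii hα hα0
  exact mem_homDomain_of_apsidalRadii hα hα0 hκ d.L_pos (d.exp_lt hα) h1 h2

lemma sq_scale {α κ H L z c : ℝ} (hα : α < 2) (hκ : 0 < κ)
    (d : OrbitData α κ H L z c) : c ^ 2 = sqScale α κ z * L ^ (4 / (2 - α)) := by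
  have hk : 2 - α ≠ 0 := by linarith
  have hL := d.L_pos
  have hc := d.c_pos
  have e1 : α * radCoeff (angleParam α) z / κ = c ^ (2 - α) / L ^ 2 := by
    rw [div_eq_div_iff hκ.ne' (by positivity)]
    linarith [d.scale_eq]
  have e2 : L ^ (4 / (2 - α)) = (L ^ 2) ^ (2 / (2 - α)) := by
    rw [← Real.rpow_natCast L 2, ← Real.rpow_mul hL.le]
    congr 1
    push_cast
    ring
  have e3 : c ^ 2 = (c ^ (2 - α)) ^ (2 / (2 - α)) := by
    rw [← Real.rpow_natCast c 2, ← Real.rpow_mul hc.le]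
    congr 1
    push_cast
    field_simp
  rw [sqScale, e1, e2, ← Real.mul_rpow (by positivity) (by positivity),
    div_mul_cancel₀ _ (by positivity), e3]

/-- Homogeneity: c² is proportional to L^(4/(2-α)), so H = L² `radCoeff (-δ) z` / c² scales as
L^(-2α/(2-α)) at fixed z. -/
lemma energy {α κ H L z c : ℝ} (hα : α < 2) (hα0 : α ≠ 0) (hκ : 0 < κ)
    (d : OrbitData α κ H L z c) : H * L ^ (2 * α / (2 - α)) = orbitEnergy α κ z := by
  have hk : 2 - α ≠ 0 := by linarith
  have hL := d.L_pos
  have h := d.energy_eq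
  have hs := sqScale_pos hα hα0 hκ d.z_pos
  have e : L ^ (4 / (2 - α)) = L ^ (2 * α / (2 - α)) * L ^ 2 := by
    rw [← Real.rpow_natCast L 2, ← Real.rpow_add hL]
    congr 1
    push_cast
    field_simp
    ring
  rw [d.sq_scale hα hκ, e] at h
  rw [orbitEnergy, eq_div_iff hs.ne']
  have hL2 : L ^ 2 ≠ 0 := by positivity
  refine mul_left_cancel₀ hL2 ?_
  linarith

end OrbitData

/-- The scale equation determines c. The resulting orbit has the same scaled energy as (H, L), hence
the energy H. -/
lemma exists_orbitData_of_energy {α κ H L z : ℝ} (hα : α < 2) (hα0 : α ≠ 0) (hκ : 0 < κ)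
    (hL : 0 < L) (hz : 0 < z) (h : H * L ^ (2 * α / (2 - α)) = orbitEnergy α κ z) :
    ∃ c, OrbitData α κ H L z c := by
  have hk : 2 - α ≠ 0 := by linarith
  have hr := mul_radCoeff_pos hα hα0 hz
  have hq : 0 < α * radCoeff (angleParam α) z * L ^ 2 / κ := by positivity
  have hc := Real.rpow_pos_of_pos hq (1 / (2 - α))
  have h1 : κ * ((α * radCoeff (angleParam α) z * L ^ 2 / κ) ^ (1 / (2 - α))) ^ (2 - α)
      = α * L ^ 2 * radCoeff (angleParam α) z := by
    rw [← Real.rpow_mul hq.le, one_div_mul_cancel hk, Real.rpow_one]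
    field_simp
  generalize (α * radCoeff (angleParam α) z * L ^ 2 / κ) ^ (1 / (2 - α)) = c at *
  have d : OrbitData α κ (L ^ 2 * radCoeff (-angleParam α) z / c ^ 2) L z c :=
    ⟨hL, hz, hc, h1, by field_simp⟩
  have h2 := d.energy hα hα0 hκ
  rw [← h] at h2
  have h3 := mul_right_cancel₀ (Real.rpow_pos_of_pos hL _).ne' h2
  rw [h3] at d
  exact ⟨c, d⟩

/-! ### The orbit parameter as a local C¹ function of the scaled energy. -/

lemma contDiffAt_one_of_hasDerivAt {f f' : ℝ → ℝ} {U : Set ℝ} (hU : IsOpen U)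
    (hf : ∀ x ∈ U, HasDerivAt f (f' x) x) (hf' : ContinuousOn f' U) {x : ℝ} (hx : x ∈ U) :
    ContDiffAt ℝ 1 f x := by
  have h : ContDiffOn ℝ (0 + 1) f U := by
    rw [contDiffOn_succ_iff_deriv_of_isOpen hU]
    refine ⟨fun x hx => (hf x hx).differentiableAt.differentiableWithinAt, by simp, ?_⟩
    rw [contDiffOn_zero]
    exact hf'.congr fun x hx => (hf x hx).deriv
  rw [zero_add] at h
  exact h.contDiffAt (hU.mem_nhds hx)

/-- A right inverse suffices: any z > 0 with the correct scaled energy yields T and Θ, so uniqueness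
of z is never needed. -/
lemma exists_local_right_inverse {f : ℝ → ℝ} {f' a : ℝ} (hf : ContDiffAt ℝ 1 f a)
    (hd : HasDerivAt f f' a) (hf' : f' ≠ 0) :
    ∃ g : ℝ → ℝ, ContDiffAt ℝ 1 g (f a) ∧ g (f a) = a ∧ HasDerivAt g f'⁻¹ (f a) ∧
      ∀ᶠ v in 𝓝 (f a), f (g v) = v := by
  have hs : HasStrictDerivAt f f' a := hf.hasStrictDerivAt' hd one_ne_zero
  refine ⟨hs.localInverse f f' a hf', ?_, ?_, (hs.to_localInverse hf').hasDerivAt,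
    hs.eventually_right_inverse hf'⟩
  · exact hf.to_localInverse
      (f' := ContinuousLinearEquiv.unitsEquivAut ℝ (Units.mk0 f' hf'))
      (hs.hasStrictFDerivAt_equiv hf').hasFDerivAt
      one_ne_zero
  · exact (hs.hasStrictFDerivAt_equiv hf').localInverse_apply_image

/-- The radial period of the orbits with the orbit parameter `z` and `L = 1`. -/
noncomputable def periodOfParam (α κ z : ℝ) : ℝ :=
  √2 * radExponent α * (sqScale α κ z * sinIntegral (timeIntegrand (angleParam α)) z)

/-- The apsidal angle of the orbits with the orbit parameter `z`. -/
noncomputable def angleOfParam (α z : ℝ) : ℝ :=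
  √2 * radExponent α * sinIntegral (angleIntegrand (angleParam α)) z

/-- The derivative of `angleOfParam α z` in `z`. -/
noncomputable def angleOfParamDeriv (α z : ℝ) : ℝ :=
  √2 * radExponent α * sinIntegral (angleIntegrandDeriv (angleParam α)) z

lemma apsidalAngle_eq {α κ H L z : ℝ} (hα : α < 2) (hα0 : α ≠ 0) (hκ : 0 < κ) (hL : 0 < L)
    (hz : 0 < z) (h : H * L ^ (2 * α / (2 - α)) = orbitEnergy α κ z) :
    apsidalAngle (homPotential α κ) H L = angleOfParam α z := by
  obtain ⟨c, d⟩ := exists_orbitData_of_energy hα hα0 hκ hL hz h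
  exact (d.apsidal hα hα0 hκ).2.2.2

lemma radialPeriod_eq {α κ H L z : ℝ} (hα : α < 2) (hα0 : α ≠ 0) (hκ : 0 < κ) (hL : 0 < L)
    (hz : 0 < z) (h : H * L ^ (2 * α / (2 - α)) = orbitEnergy α κ z) :
    radialPeriod (homPotential α κ) H L
      = periodOfParam α κ z * L ^ ((2 + α) / (2 - α)) := by
  obtain ⟨c, d⟩ := exists_orbitData_of_energy hα hα0 hκ hL hz h
  have hk : 2 - α ≠ 0 := by linarith
  have e : L ^ (4 / (2 - α)) = L ^ ((2 + α) / (2 - α)) * L := by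
    rw [← Real.rpow_add_one hL.ne']
    congr 1
    field_simp
    ring
  rw [(d.apsidal hα hα0 hκ).2.2.1, d.sq_scale hα hκ, e, periodOfParam]
  field_simp

/-! ### Regularity and partial derivatives of T and Θ. -/

section Regularity

variable {α κ z : ℝ}

lemma hasDerivAt_angleOfParam (hα : α < 2) (hα0 : α ≠ 0) (hz : 0 < z) :
    HasDerivAt (angleOfParam α) (angleOfParamDeriv α z) z := by
  have hδ := angleParam_ne_zero hα hα0
  have hδ3 := abs_angleParam_lt hα
  exact (hasDerivAt_sinIntegral (continuousOn_angleIntegrand hδ hδ3)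
    (continuousOn_angleIntegrandDeriv hδ hδ3)
    (fun z hz y hy => hasDerivAt_angleIntegrand hδ hδ3 hz hy) hz).const_mul _

lemma contDiffAt_angleOfParam (hα : α < 2) (hα0 : α ≠ 0) (hz : 0 < z) :
    ContDiffAt ℝ 1 (angleOfParam α) z := by
  refine contDiffAt_one_of_hasDerivAt isOpen_Ioi
    (fun z hz => hasDerivAt_angleOfParam hα hα0 hz) ?_ hz
  exact continuousOn_const.mul (sinIntegral_continuousOn
    (continuousOn_angleIntegrandDeriv (angleParam_ne_zero hα hα0) (abs_angleParam_lt hα)))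

lemma contDiffAt_orbitEnergy (hα : α < 2) (hα0 : α ≠ 0) (hκ : 0 < κ) (hz : 0 < z) :
    ContDiffAt ℝ 1 (orbitEnergy α κ) z :=
  contDiffAt_one_of_hasDerivAt isOpen_Ioi
    (fun _ hz => hasDerivAt_orbitEnergy hα hα0 hκ hz)
    (continuousOn_orbitEnergyDeriv hα hα0 hκ) hz

lemma contDiffAt_periodOfParam (hα : α < 2) (hα0 : α ≠ 0) (hκ : 0 < κ) (hz : 0 < z) :
    ContDiffAt ℝ 1 (periodOfParam α κ) z := by
  have hδ := angleParam_ne_zero hα hα0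
  have hδ3 := abs_angleParam_lt hα
  have h1 : ContDiffAt ℝ 1 (sqScale α κ) z := contDiffAt_one_of_hasDerivAt isOpen_Ioi
    (fun _ hz => hasDerivAt_sqScale hα hα0 hκ hz) (continuousOn_sqScaleDeriv hα hα0 hκ) hz
  have h2 : ContDiffAt ℝ 1 (sinIntegral (timeIntegrand (angleParam α))) z :=
    contDiffAt_one_of_hasDerivAt isOpen_Ioi
      (fun _ hz => hasDerivAt_sinIntegral (continuousOn_timeIntegrand hδ hδ3)
        (continuousOn_timeIntegrandDeriv hδ hδ3)
        (fun z hz y hy => hasDerivAt_timeIntegrand hδ hδ3 hz hy) hz)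
      (sinIntegral_continuousOn (continuousOn_timeIntegrandDeriv hδ hδ3)) hz
  exact contDiffAt_const.mul (h1.mul h2)

lemma contDiffAt_scaledEnergy {H L : ℝ} (hL : 0 < L) (γ : ℝ) :
    ContDiffAt ℝ 1 (fun p : ℝ × ℝ => p.1 * p.2 ^ γ) (H, L) :=
  contDiffAt_fst.mul (contDiffAt_snd.rpow_const_of_ne hL.ne')

/-- Near a point of the domain, `T` and `Θ` are functions of the orbit parameter, which is a
function of class `C¹` of the scaled energy. -/
lemma exists_local_param {H L : ℝ} (hα : α < 2) (hα0 : α ≠ 0) (hκ : 0 < κ)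
    (h : (H, L) ∈ homDomain α κ) : ∃ z, 0 < z ∧ H * L ^ (2 * α / (2 - α)) = orbitEnergy α κ z ∧
      ∃ g : ℝ → ℝ, ContDiffAt ℝ 1 g (H * L ^ (2 * α / (2 - α))) ∧
        g (H * L ^ (2 * α / (2 - α))) = z ∧
        HasDerivAt g (orbitEnergyDeriv α κ z)⁻¹ (H * L ^ (2 * α / (2 - α))) ∧
        (∀ᶠ p : ℝ × ℝ in 𝓝 (H, L), apsidalAngle (homPotential α κ) p.1 p.2
          = angleOfParam α (g (p.1 * p.2 ^ (2 * α / (2 - α))))) ∧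
        (∀ᶠ p : ℝ × ℝ in 𝓝 (H, L), radialPeriod (homPotential α κ) p.1 p.2
          = periodOfParam α κ (g (p.1 * p.2 ^ (2 * α / (2 - α))))
            * p.2 ^ ((2 + α) / (2 - α))) := by
  obtain ⟨z, c, d⟩ := exists_orbitData hα hα0 hκ h
  have hE := d.energy hα hα0 hκ
  obtain ⟨g, g1, g2, g3, g4⟩ := exists_local_right_inverse
    (contDiffAt_orbitEnergy hα hα0 hκ d.z_pos) (hasDerivAt_orbitEnergy hα hα0 hκ d.z_pos)
    (orbitEnergyDeriv_pos hα hα0 hκ d.z_pos).ne'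
  rw [← hE] at g1 g2 g3 g4
  have hc : ContinuousAt (fun p : ℝ × ℝ => p.1 * p.2 ^ (2 * α / (2 - α))) (H, L) :=
    (contDiffAt_scaledEnergy d.L_pos _).continuousAt
  have e1 := hc.eventually g4
  have e2 : ∀ᶠ p : ℝ × ℝ in 𝓝 (H, L), 0 < g (p.1 * p.2 ^ (2 * α / (2 - α))) :=
    hc.eventually (g1.continuousAt.eventually (by rw [g2]; exact eventually_gt_nhds d.z_pos))
  have e3 : ∀ᶠ p : ℝ × ℝ in 𝓝 (H, L), 0 < p.2 :=
    (continuousAt_snd (p := (H, L))).eventually (eventually_gt_nhds d.L_pos)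
  refine ⟨z, d.z_pos, hE, g, g1, g2, g3, ?_, ?_⟩
  · filter_upwards [e1, e2, e3] with p h1 h2 h3
    exact apsidalAngle_eq hα hα0 hκ h3 h2 h1.symm
  · filter_upwards [e1, e2, e3] with p h1 h2 h3
    exact radialPeriod_eq hα hα0 hκ h3 h2 h1.symm

lemma contDiffOn_apsidalAngle (hα : α < 2) (hα0 : α ≠ 0) (hκ : 0 < κ) :
    ContDiffOn ℝ 1 (fun p : ℝ × ℝ => apsidalAngle (homPotential α κ) p.1 p.2)
      (homDomain α κ) := by
  rintro ⟨H, L⟩ h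
  obtain ⟨z, hz, -, g, g1, g2, -, e, -⟩ := exists_local_param hα hα0 hκ h
  refine ContDiffAt.contDiffWithinAt (ContDiffAt.congr_of_eventuallyEq ?_ e)
  have h1 := g1.comp (H, L) (contDiffAt_scaledEnergy h.1 (2 * α / (2 - α)))
  refine ContDiffAt.comp (H, L) (g := angleOfParam α) ?_ h1
  simp only [g2]
  exact contDiffAt_angleOfParam hα hα0 hz

lemma contDiffOn_radialPeriod (hα : α < 2) (hα0 : α ≠ 0) (hκ : 0 < κ) :
    ContDiffOn ℝ 1 (fun p : ℝ × ℝ => radialPeriod (homPotential α κ) p.1 p.2)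
      (homDomain α κ) := by
  rintro ⟨H, L⟩ h
  obtain ⟨z, hz, -, g, g1, g2, -, -, e⟩ := exists_local_param hα hα0 hκ h
  refine ContDiffAt.contDiffWithinAt (ContDiffAt.congr_of_eventuallyEq ?_ e)
  have h1 := g1.comp (H, L) (contDiffAt_scaledEnergy h.1 (2 * α / (2 - α)))
  have hL : L ≠ 0 := ne_of_gt h.1
  refine ContDiffAt.mul ?_ (contDiffAt_snd.rpow_const_of_ne hL)
  refine ContDiffAt.comp (H, L) (g := periodOfParam α κ) ?_ h1
  simp only [g2]
  exact contDiffAt_periodOfParam hα hα0 hκ hz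

/-- The partial derivatives of `T` and `Θ` in terms of the orbit parameter. -/
lemma partial_derivatives {H L : ℝ} (hα : α < 2) (hα0 : α ≠ 0) (hκ : 0 < κ)
    (h : (H, L) ∈ homDomain α κ) : ∃ z, 0 < z ∧ ∃ q,
      partialH (apsidalAngle (homPotential α κ)) H L
        = angleOfParamDeriv α z / orbitEnergyDeriv α κ z * L ^ (2 * α / (2 - α)) ∧
      partialL (apsidalAngle (homPotential α κ)) H L
        = angleOfParamDeriv α z / orbitEnergyDeriv α κ z
          * (H * (2 * α / (2 - α) * L ^ (2 * α / (2 - α) - 1))) ∧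
      partialH (radialPeriod (homPotential α κ)) H L
        = q * L ^ (2 * α / (2 - α)) * L ^ ((2 + α) / (2 - α)) ∧
      partialL (radialPeriod (homPotential α κ)) H L
        = q * (H * (2 * α / (2 - α) * L ^ (2 * α / (2 - α) - 1))) * L ^ ((2 + α) / (2 - α))
          + (2 + α) / (2 - α) * L⁻¹ * radialPeriod (homPotential α κ) H L := by
  obtain ⟨z, hz, hE, g, -, g2, g3, e1, e2⟩ := exists_local_param hα hα0 hκ h
  have hL : 0 < L := h.1
  set γ := 2 * α / (2 - α) with hγ
  set β := (2 + α) / (2 - α) with hβ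
  have dA : HasDerivAt (angleOfParam α) (angleOfParamDeriv α z) (g (H * L ^ γ)) := by
    rw [g2]; exact hasDerivAt_angleOfParam hα hα0 hz
  have dP : HasDerivAt (periodOfParam α κ) (deriv (periodOfParam α κ) z) (g (H * L ^ γ)) := by
    rw [g2]
    exact ((contDiffAt_periodOfParam hα hα0 hκ hz).differentiableAt one_ne_zero).hasDerivAt
  have sH : HasDerivAt (fun h => h * L ^ γ) (L ^ γ) H := by
    simpa using (hasDerivAt_id H).mul_const (L ^ γ)
  have sL : HasDerivAt (fun l => H * l ^ γ) (H * (γ * L ^ (γ - 1))) L :=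
    (Real.hasDerivAt_rpow_const (Or.inl hL.ne')).const_mul H
  have cH : Tendsto (fun h => (h, L)) (𝓝 H) (𝓝 (H, L)) :=
    (Continuous.prodMk_left L).tendsto H
  have cL : Tendsto (fun l => (H, l)) (𝓝 L) (𝓝 (H, L)) :=
    (Continuous.prodMk_right H).tendsto L
  have aH : (fun h => apsidalAngle (homPotential α κ) h L)
      =ᶠ[𝓝 H] angleOfParam α ∘ (g ∘ fun h => h * L ^ γ) := cH.eventually e1
  have aL : (fun l => apsidalAngle (homPotential α κ) H l)
      =ᶠ[𝓝 L] angleOfParam α ∘ (g ∘ fun l => H * l ^ γ) := cL.eventually e1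
  have pH : (fun h => radialPeriod (homPotential α κ) h L)
      =ᶠ[𝓝 H] fun h => (periodOfParam α κ ∘ (g ∘ fun h => h * L ^ γ)) h * L ^ β :=
    cH.eventually e2
  have pL : (fun l => radialPeriod (homPotential α κ) H l)
      =ᶠ[𝓝 L] (periodOfParam α κ ∘ (g ∘ fun l => H * l ^ γ)) * fun l => l ^ β :=
    cL.eventually e2
  -- The derivative of the period factor with respect to the scaled energy. Its value is irrelevant,
  -- since it drops out of D.
  refine ⟨z, hz, deriv (periodOfParam α κ) z * (orbitEnergyDeriv α κ z)⁻¹, ?_, ?_, ?_, ?_⟩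
  · refine (((dA.comp H (g3.comp H sH)).congr_of_eventuallyEq aH).deriv).trans ?_
    ring
  · refine (((dA.comp L (g3.comp L sL)).congr_of_eventuallyEq aL).deriv).trans ?_
    ring
  · refine ((((dP.comp H (g3.comp H sH)).mul_const (L ^ β)).congr_of_eventuallyEq pH).deriv).trans
      ?_
    ring
  · refine ((((dP.comp L (g3.comp L sL)).mul (Real.hasDerivAt_rpow_const (p := β)
      (Or.inl hL.ne'))).congr_of_eventuallyEq pL).deriv).trans ?_
    rw [e2.self_of_nhds, Real.rpow_sub_one hL.ne' β]
    simp only [Function.comp_apply]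
    ring

/-! ### The nondegeneracy function, the signs, and commensurable orbits. -/

/-- Two functions of the same scaled energy have parallel gradients, so only the derivative of the
prefactor L^((2+α)/(2-α)) of T contributes. -/
lemma nondegeneracy_eq {H L : ℝ} (hα : α < 2) (hα0 : α ≠ 0) (hκ : 0 < κ)
    (h : (H, L) ∈ homDomain α κ) :
    nondegeneracy (homPotential α κ) H L
      = -((2 + α) / (2 - α)) * L⁻¹ * radialPeriod (homPotential α κ) H L
          * partialH (apsidalAngle (homPotential α κ)) H L := by
  obtain ⟨z, -, q, h1, h2, h3, h4⟩ := partial_derivatives hα hα0 hκ h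
  rw [nondegeneracy, h1, h2, h3, h4]
  ring

lemma radialPeriod_pos {H L : ℝ} (hα : α < 2) (hα0 : α ≠ 0) (hκ : 0 < κ)
    (h : (H, L) ∈ homDomain α κ) : 0 < radialPeriod (homPotential α κ) H L := by
  obtain ⟨z, c, d⟩ := exists_orbitData hα hα0 hκ h
  rw [(d.apsidal hα hα0 hκ).2.2.1]
  have h1 := sinIntegral_timeIntegrand_pos (angleParam_ne_zero hα hα0) (abs_angleParam_lt hα)
    d.z_pos
  have h2 := radExponent_pos hα
  have h3 := d.L_pos
  have h4 := d.c_pos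
  positivity

lemma angleOfParamDeriv_sign {s : ℝ} (hα : α < 2) (hα0 : α ≠ 0) (hs : s = 1 ∨ s = -1)
    (h : 0 < s * (1 - |angleParam α|)) (hz : 0 < z) : s * angleOfParamDeriv α z < 0 := by
  have h1 := sinIntegral_angleIntegrandDeriv_neg hs (angleParam_ne_zero hα hα0)
    (abs_angleParam_lt hα) h hz
  have h2 := radExponent_pos hα
  have h3 : 0 < √2 * radExponent α := by positivity
  rw [angleOfParamDeriv]
  nlinarith

lemma sign_choice (hα : α < 2) (h2 : α ≠ -2) (h1 : α ≠ 1) :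
    (-2 < α ∧ α < 1 ∧ 0 < 1 * (1 - |angleParam α|)) ∨
      ((α < -2 ∨ 1 < α) ∧ 0 < (-1) * (1 - |angleParam α|)) := by
  by_cases h : -2 < α ∧ α < 1
  · have := (abs_angleParam_lt_one_iff hα).2 h
    exact Or.inl ⟨h.1, h.2, by linarith⟩
  · have h' : α < -2 ∨ 1 < α := by
      rcases lt_or_gt_of_ne h2 with h3 | h3
      · exact Or.inl h3
      · exact Or.inr (lt_of_le_of_ne (not_lt.1 fun h4 => h ⟨h3, h4⟩) (Ne.symm h1))
    have := (one_lt_abs_angleParam_iff hα).2 h'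
    exact Or.inr ⟨h', by linarith⟩

/-- The sign of `∂_H Θ`, with `s = 1` for `-2 < α < 1` and `s = -1` outside of `[-2, 1]`. -/
lemma partialH_apsidalAngle_sign {H L s : ℝ} (hα : α < 2) (hα0 : α ≠ 0) (hκ : 0 < κ)
    (hs : s = 1 ∨ s = -1) (hsα : 0 < s * (1 - |angleParam α|)) (h : (H, L) ∈ homDomain α κ) :
    s * partialH (apsidalAngle (homPotential α κ)) H L < 0 ∧
      0 < s * partialL (apsidalAngle (homPotential α κ)) H L := by
  obtain ⟨z, hz, q, h1, h2, -, -⟩ := partial_derivatives hα hα0 hκ h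
  have hL : 0 < L := h.1
  have hE := orbitEnergyDeriv_pos hα hα0 hκ hz
  have hA := angleOfParamDeriv_sign hα hα0 hs hsα hz
  have hk : 0 < 2 - α := by linarith
  -- For α < 0 the minimum of W is positive; for α > 0 the domain requires H < 0. Since the scaled
  -- energy has L-derivative of the sign of Hα, ∂_L Θ and ∂_H Θ have opposite signs.
  have hH : H * α < 0 := by
    rcases lt_or_gt_of_ne hα0 with h0 | h0
    · refine mul_neg_of_pos_of_neg (lt_trans ?_ h.2.1) h0
      simp only
      rw [effPotential_homRadius hα hα0 hκ hL, neg_pos]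
      have h3 : (2 - α) / (2 * α) < 0 := div_neg_of_pos_of_neg hk (by linarith)
      have h4 := Real.rpow_pos_of_pos hκ (2 / (2 - α))
      have h5 := Real.rpow_pos_of_pos hL (-(2 * α / (2 - α)))
      exact mul_neg_of_neg_of_pos (mul_neg_of_neg_of_pos h3 h4) h5
    · exact mul_neg_of_neg_of_pos (h.2.2 h0) h0
  have p1 := Real.rpow_pos_of_pos hL (2 * α / (2 - α))
  have p2 := Real.rpow_pos_of_pos hL (2 * α / (2 - α) - 1)
  constructor
  · have : 0 < -(s * angleOfParamDeriv α z) / orbitEnergyDeriv α κ z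
        * L ^ (2 * α / (2 - α)) := mul_pos (div_pos (neg_pos.2 hA) hE) p1
    rw [h1]
    refine neg_pos.1 (this.trans_eq ?_)
    ring
  · have : 0 < -(s * angleOfParamDeriv α z) / orbitEnergyDeriv α κ z
        * (-(H * α) * 2 / (2 - α) * L ^ (2 * α / (2 - α) - 1)) :=
      mul_pos (div_pos (neg_pos.2 hA) hE)
        (mul_pos (div_pos (mul_pos (neg_pos.2 hH) two_pos) hk) p2)
    rw [h2]
    refine this.trans_eq ?_
    ring

/-- Pairs with a commensurable apsidal angle exist. -/
lemma exists_commensurable (hα : α < 2) (hα0 : α ≠ 0) (hκ : 0 < κ) (h2 : α ≠ -2) (h1 : α ≠ 1) :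
    ∃ H L : ℝ, (H, L) ∈ homDomain α κ ∧ ∃ n k : ℕ, 0 < n ∧ 0 < k ∧ n.Coprime k ∧
      apsidalAngle (homPotential α κ) H L = 2 * Real.pi * (k / n) := by
  have hpi := Real.pi_pos
  have hc : ContinuousOn (angleOfParam α) (Set.Icc 1 2) := fun z hz =>
    (hasDerivAt_angleOfParam hα hα0 (one_pos.trans_le hz.1)).continuousAt.continuousWithinAt
  have hpos : ∀ z : ℝ, 0 < z → 0 < angleOfParam α z := fun z hz =>
    mul_pos (mul_pos (by positivity) (radExponent_pos hα))
      (sinIntegral_angleIntegrand_pos (angleParam_ne_zero hα hα0) (abs_angleParam_lt hα) hz)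
  -- The endpoints 1 and 2 are arbitrary: by Rolle, equal values would contradict the strict sign of
  -- Θ'(z).
  have hne : angleOfParam α 1 ≠ angleOfParam α 2 := by
    intro he
    obtain ⟨z, hz, hz0⟩ := exists_hasDerivAt_eq_zero one_lt_two hc he
      fun z hz => hasDerivAt_angleOfParam hα hα0 (one_pos.trans hz.1)
    have hz' : 0 < z := one_pos.trans hz.1
    rcases sign_choice hα h2 h1 with h | h
    · have := angleOfParamDeriv_sign hα hα0 (Or.inl rfl) h.2.2 hz'
      rw [hz0] at this
      simp at this
    · have := angleOfParamDeriv_sign hα hα0 (Or.inr rfl) h.2 hz'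
      rw [hz0] at this
      simp at this
  obtain ⟨z, hz, q, hq⟩ : ∃ z, 0 < z ∧ ∃ q : ℚ, angleOfParam α z = 2 * Real.pi * q := by
    have hlt : min (angleOfParam α 1) (angleOfParam α 2) / (2 * Real.pi)
        < max (angleOfParam α 1) (angleOfParam α 2) / (2 * Real.pi) :=
      div_lt_div_of_pos_right (min_lt_max.2 hne) (by positivity)
    obtain ⟨q, hq1, hq2⟩ := exists_rat_btwn hlt
    rw [div_lt_iff₀ (by positivity)] at hq1
    rw [lt_div_iff₀ (by positivity)] at hq2
    have hmem : (q : ℝ) * (2 * Real.pi) ∈ Set.uIcc (angleOfParam α 1) (angleOfParam α 2) :=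
      ⟨hq1.le, hq2.le⟩
    obtain ⟨z, hz, hzq⟩ := intermediate_value_uIcc
      (by rwa [Set.uIcc_of_le one_le_two]) hmem
    rw [Set.uIcc_of_le one_le_two] at hz
    exact ⟨z, one_pos.trans_le hz.1, q, by rw [hzq]; ring⟩
  have hq0 : 0 < q := by
    have := hpos z hz
    rw [hq] at this
    exact_mod_cast pos_of_mul_pos_right this (by positivity)
  obtain ⟨c, d⟩ := exists_orbitData_of_energy (κ := κ) (L := 1) hα hα0 hκ one_pos hz
    (by rw [Real.one_rpow, mul_one])
  refine ⟨_, 1, d.mem_homDomain hα hα0 hκ, q.den, q.num.natAbs, q.den_pos,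
    Int.natAbs_pos.2 (Rat.num_pos.2 hq0).ne', q.reduced.symm, ?_⟩
  rw [(d.apsidal hα hα0 hκ).2.2.2]
  change angleOfParam α z = _
  rw [hq]
  congr 1
  have h3 : ((q.num.natAbs : ℕ) : ℝ) = ((q.num : ℤ) : ℝ) := by
    rw [← Int.cast_natCast, Int.natAbs_of_nonneg (Rat.num_pos.2 hq0).le]
  rw [h3]
  exact_mod_cast (Rat.num_div_den q).symm

end Regularity

end CentralForce

open CentralForce in
theorem lemma4p4 (α κ : ℝ) (hα : α < 2) (hα0 : α ≠ 0) (hκ : 0 < κ) :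
    -- the standing assumptions on the potential and on the effective potential hold
    ContDiffOn ℝ 2 (homPotential α κ) (Set.Ioi 0) ∧
    (∀ L : ℝ, 0 < L →
      0 < homRadius α κ L ∧
      effPotential (homPotential α κ) L (homRadius α κ L)
        = -((2 - α) / (2 * α) * κ ^ (2 / (2 - α)) * L ^ (-(2 * α / (2 - α)))) ∧
      (∀ r ∈ Set.Ioo 0 (homRadius α κ L),
        deriv (effPotential (homPotential α κ) L) r < 0) ∧
      (∀ r ∈ Set.Ioi (homRadius α κ L),
        0 < deriv (effPotential (homPotential α κ) L) r)) ∧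
    -- the domain is open, and consists of the pairs for which `W(r; L) = H` has two solutions
    IsOpen (homDomain α κ) ∧
    (homDomain α κ).Nonempty ∧
    (∀ H L : ℝ, (H, L) ∈ homDomain α κ ↔
      0 < L ∧ (apsidalRadii (homPotential α κ) H L).encard = 2) ∧
    (∀ H L : ℝ, (H, L) ∈ homDomain α κ →
      apsidalRadii (homPotential α κ) H L
        = {rMinus (homPotential α κ) H L, rPlus (homPotential α κ) H L} ∧
      0 < rMinus (homPotential α κ) H L ∧
      rMinus (homPotential α κ) H L < homRadius α κ L ∧
      homRadius α κ L < rPlus (homPotential α κ) H L ∧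
      IntervalIntegrable (fun r => 1 / √(H - effPotential (homPotential α κ) L r))
        MeasureTheory.volume (rMinus (homPotential α κ) H L) (rPlus (homPotential α κ) H L) ∧
      IntervalIntegrable (fun r => 1 / (r ^ 2 * √(H - effPotential (homPotential α κ) L r)))
        MeasureTheory.volume (rMinus (homPotential α κ) H L) (rPlus (homPotential α κ) H L)) ∧
    -- `T` and `Θ` are of class `C¹` on the domain
    ContDiffOn ℝ 1 (fun p : ℝ × ℝ => radialPeriod (homPotential α κ) p.1 p.2)
      (homDomain α κ) ∧
    ContDiffOn ℝ 1 (fun p : ℝ × ℝ => apsidalAngle (homPotential α κ) p.1 p.2)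
      (homDomain α κ) ∧
    -- the formula for the nondegeneracy function
    (∀ H L : ℝ, (H, L) ∈ homDomain α κ →
      nondegeneracy (homPotential α κ) H L
        = -((2 + α) / (2 - α)) * L⁻¹ * radialPeriod (homPotential α κ) H L
            * partialH (apsidalAngle (homPotential α κ)) H L) ∧
    -- the nondegeneracy, and the signs of `∂_H Θ`, `D` and `∂_L Θ`
    (α ≠ -2 → α ≠ 1 →
      (∀ H L : ℝ, (H, L) ∈ homDomain α κ →
        nondegeneracy (homPotential α κ) H L ≠ 0 ∧
        (α < -2 ∨ 1 < α → 0 < partialH (apsidalAngle (homPotential α κ)) H L) ∧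
        (-2 < α ∧ α < 1 → partialH (apsidalAngle (homPotential α κ)) H L < 0) ∧
        (α < 1 → 0 < nondegeneracy (homPotential α κ) H L) ∧
        (1 < α → nondegeneracy (homPotential α κ) H L < 0) ∧
        (-2 < α ∧ α < 1 → 0 < partialL (apsidalAngle (homPotential α κ)) H L) ∧
        (α < -2 ∨ 1 < α → partialL (apsidalAngle (homPotential α κ)) H L < 0)) ∧
      -- commensurable pairs (invariant tori filled by periodic solutions) exist
      (∃ H L : ℝ, (H, L) ∈ homDomain α κ ∧ ∃ n k : ℕ, 0 < n ∧ 0 < k ∧ n.Coprime k ∧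
        apsidalAngle (homPotential α κ) H L = 2 * Real.pi * (k / n))) := by
  refine ⟨contDiffOn_homPotential κ 2, fun L hL => ⟨homRadius_pos α hκ hL,
    effPotential_homRadius hα hα0 hκ hL, fun r hr => deriv_effPotential_neg hα hα0 hκ hr,
    fun r hr => deriv_effPotential_pos hα hα0 hκ hL hr⟩, isOpen_homDomain hα hα0 hκ,
    homDomain_nonempty hα hα0 hκ, mem_homDomain_iff hα hα0 hκ, fun H L h => ?_,
    contDiffOn_radialPeriod hα hα0 hκ, contDiffOn_apsidalAngle hα hα0 hκ,
    fun H L h => nondegeneracy_eq hα hα0 hκ h,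
    fun h2 h1 => ⟨fun H L h => ?_, exists_commensurable hα hα0 hκ h2 h1⟩⟩
  · obtain ⟨z, c, d⟩ := exists_orbitData hα hα0 hκ h
    obtain ⟨hr1, hr2⟩ := d.mem_apsidalRadii hα hα0
    obtain ⟨e, e1, e2, hl, hr⟩ := apsidalRadii_eq_pair hα hα0 hκ d.L_pos hr1 hr2 (d.exp_lt hα)
    rw [e1, e2]
    exact ⟨e, hr1.1, hl, hr, (d.time_integral hα hα0).1, (d.angle_integral hα hα0).1⟩
  · have hD := nondegeneracy_eq hα hα0 hκ h
    have hT := radialPeriod_pos hα hα0 hκ h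
    have hL : 0 < L := h.1
    have hk : 0 < 2 - α := by linarith
    have hq : 0 < L⁻¹ * radialPeriod (homPotential α κ) H L / (2 - α) := by positivity
    -- A positive factor is split off, so the sign of D is that of -(2+α) ∂_H Θ. Both factors change
    -- sign at α = -2, so D keeps its sign there and changes it only at α = 1.
    have hD' : nondegeneracy (homPotential α κ) H L
        = -((2 + α) * partialH (apsidalAngle (homPotential α κ)) H L)
          * (L⁻¹ * radialPeriod (homPotential α κ) H L / (2 - α)) := by
      rw [hD]
      ring
    rcases sign_choice hα h2 h1 with ⟨a1, a2, hs⟩ | ⟨ha, hs⟩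
    · obtain ⟨s1, s2⟩ := partialH_apsidalAngle_sign hα hα0 hκ (Or.inl rfl) hs h
      rw [one_mul] at s1 s2
      have hDpos : 0 < nondegeneracy (homPotential α κ) H L := by
        rw [hD']
        exact mul_pos (neg_pos.2 (mul_neg_of_pos_of_neg (by linarith) s1)) hq
      refine ⟨hDpos.ne', fun ha => ?_, fun _ => s1, fun _ => hDpos, fun ha => ?_, fun _ => s2,
        fun ha => ?_⟩
      · rcases ha with ha | ha <;> linarith
      · linarith
      · rcases ha with ha | ha <;> linarith
    · obtain ⟨s1, s2⟩ := partialH_apsidalAngle_sign hα hα0 hκ (Or.inr rfl) hs h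
      replace s1 : 0 < partialH (apsidalAngle (homPotential α κ)) H L := by linarith
      replace s2 : partialL (apsidalAngle (homPotential α κ)) H L < 0 := by linarith
      have hpos : α < 1 → 0 < nondegeneracy (homPotential α κ) H L := by
        intro ha'
        rw [hD']
        refine mul_pos (neg_pos.2 (mul_neg_of_neg_of_pos ?_ s1)) hq
        rcases ha with ha | ha <;> linarith
      have hneg : 1 < α → nondegeneracy (homPotential α κ) H L < 0 := by
        intro ha'
        rw [hD']
        exact mul_neg_of_neg_of_pos (neg_neg_iff_pos.2 (mul_pos (by linarith) s1)) hq
      refine ⟨?_, fun _ => s1, fun ha' => ?_, hpos, hneg, fun ha' => ?_, fun _ => s2⟩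
      · rcases lt_or_gt_of_ne h1 with h3 | h3
        · exact (hpos h3).ne'
        · exact (hneg h3).ne
      · rcases ha with ha | ha <;> linarith [ha'.1, ha'.2]
      · rcases ha with ha | ha <;> linarith [ha'.1, ha'.2]
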